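/- There is an absolute constant $C>0$ with the following property. Let $p\ge 2$ be real, let $(\Omega,\mu)$ be a measure space, let $n\ge 1$, and let $E$ be an $n$-dimensional linear subspace of the real space $L_p(\Omega,\mu)$, with norm $\|\cdot\|_E=\|\cdot\|_{L_p(\mu)}$. Let $p^*$ be the conjugate exponent of $p$, i.e. $1/p+1/p^*=1$. Then for every $\varepsilon\in(0,1)$ there exist a scalar product $\langle\cdot,\cdot\rangle$ on $E$ (a Euclidean structure $H=(E,\langle\cdot,\cdot\rangle)$), with Euclidean norm $|y|_H=\langle y,y\rangle^{1/2}$, an integer $m\ge 1$ and points $x_1,\dots,x_m\in E$ such that $$ m\le \max\Big(1,\ \frac{C^p}{\varepsilon^2}\,n^{p/2}\,\log^{2/p^*}\!\Big(\frac{n}{\varepsilon^{4/p}}\Big)\Big) \quad\text{and also}\quad m\le \max\Big(1,\ \frac{C^p}{\varepsilon^2}\,n^{p/2}\,\log^{2}\!\Big(\frac{n}{\varepsilon^{4/p}}\Big)\Big), $$ $|x_j|_H=1$ for all $j$, and for all $y\in E$ $$ (1-\varepsilon)\|y\|_E\le\Big(\frac nm\sum_{j=1}^m|\langle y,x_j\rangle|^p\Big)^{1/p}\le(1+\varepsilon)\|y\|_E,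 $$ $$ (1-\varepsilon)|y|_H\le\Big(\frac nm\sum_{j=1}^m|\langle y,x_j\rangle|^2\Big)^{1/2}\le(1+\varepsilon)|y|_H. $$ (For $n\ge2$ the maximum with $1$ may be dropped after enlarging $C$.) -/

import Mathlib

open MeasureTheory

/-- The Euclidean norm `|y|_H = ⟨y, y⟩^{1/2}` of a Euclidean structure (scalar product) `H`
on a real vector space. -/
noncomputable def euclideanNorm {V : Type*} [AddCommGroup V] [Module ℝ V]
    (H : InnerProductSpace.Core ℝ V) (y : V) : ℝ :=
  Real.sqrt (H.inner y y)

/-- The quantity `(C^p / ε²) n^{p/2} log^s (n / ε^{4/p})`. -/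
noncomputable def sampleBound (C p : ℝ) (n : ℕ) (ε s : ℝ) : ℝ :=
  C ^ p / ε ^ 2 * (n : ℝ) ^ (p / 2) * (Real.log ((n : ℝ) / ε ^ (4 / p))) ^ s

/-- The normalized empirical moment `((n / m) ∑ⱼ |⟨y, xⱼ⟩|^r)^{1/r}`. -/
noncomputable def empiricalMoment {V : Type*} [AddCommGroup V] [Module ℝ V]
    (H : InnerProductSpace.Core ℝ V) (n : ℕ) {m : ℕ} (x : Fin m → V) (r : ℝ) (y : V) : ℝ :=
  ((n : ℝ) / (m : ℝ) * ∑ j, |H.inner y (x j)| ^ r) ^ (1 / r)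

section Gaussian

set_option linter.unusedSectionVars false

variable {V : Type*} [NormedAddCommGroup V] [InnerProductSpace ℝ V] [FiniteDimensional ℝ V]
  [MeasurableSpace V] [BorelSpace V]

/-- The unnormalized density of the standard Gaussian measure. -/
noncomputable def gaussWeight (x : V) : ℝ := Real.exp (-(1 / 2) * ‖x‖ ^ 2)

theorem gaussWeight_pos (x : V) : 0 < gaussWeight x := Real.exp_pos _

theorem integral_gaussWeight_pos : 0 < ∫ x : V, gaussWeight x := by
  unfold gaussWeight
  have h := GaussianFourier.integral_rexp_neg_mul_sq_norm (V := V) (b := 1 / 2) (by norm_num)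
  rw [h]
  positivity

theorem integrable_gaussWeight : Integrable (gaussWeight : V → ℝ) := by
  by_contra h
  exact integral_gaussWeight_pos.ne' (integral_undef h)

theorem exp_inner_mul_gaussWeight (v x : V) :
    Real.exp (inner ℝ v x) * gaussWeight x = Real.exp (‖v‖ ^ 2 / 2) * gaussWeight (x - v) := by
  unfold gaussWeight
  rw [← Real.exp_add, ← Real.exp_add, norm_sub_sq_real, real_inner_comm]
  congr 1
  ring

theorem integrable_exp_inner_mul_gaussWeight (v : V) :
    Integrable fun x : V => Real.exp (inner ℝ v x) * gaussWeight x := by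
  simp_rw [exp_inner_mul_gaussWeight]
  exact (integrable_gaussWeight.comp_sub_right v).const_mul _

theorem integral_exp_inner_mul_gaussWeight (v : V) :
    ∫ x : V, Real.exp (inner ℝ v x) * gaussWeight x =
      Real.exp (‖v‖ ^ 2 / 2) * ∫ x : V, gaussWeight x := by
  simp_rw [exp_inner_mul_gaussWeight]
  rw [integral_const_mul, integral_sub_right_eq_self (fun x : V => gaussWeight x)]

theorem integrable_cosh_inner_mul_gaussWeight (v : V) :
    Integrable fun x : V => Real.cosh (inner ℝ v x) * gaussWeight x := by
  have h := ((integrable_exp_inner_mul_gaussWeight v).add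
    (integrable_exp_inner_mul_gaussWeight (-v))).div_const 2
  refine h.congr (Filter.Eventually.of_forall fun x => ?_)
  simp only [Pi.add_apply, inner_neg_left, Real.cosh_eq]
  ring

theorem integral_cosh_inner_mul_gaussWeight (v : V) :
    ∫ x : V, Real.cosh (inner ℝ v x) * gaussWeight x =
      Real.exp (‖v‖ ^ 2 / 2) * ∫ x : V, gaussWeight x := by
  have h1 : ∀ x : V, Real.cosh (inner ℝ v x) * gaussWeight x =
      (Real.exp (inner ℝ v x) * gaussWeight x + Real.exp (inner ℝ (-v) x) * gaussWeight x) / 2 := by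
    intro x
    simp only [inner_neg_left, Real.cosh_eq]
    ring
  simp_rw [h1]
  rw [integral_div, integral_add (integrable_exp_inner_mul_gaussWeight v)
    (integrable_exp_inner_mul_gaussWeight (-v)), integral_exp_inner_mul_gaussWeight,
    integral_exp_inner_mul_gaussWeight, norm_neg]
  ring

/-- A translate of a symmetric set loses at most the factor `exp (-‖v‖² / 2)` of its Gaussian
measure. -/
theorem integral_indicator_translate_ge {K : Set V} (hK : MeasurableSet K)
    (hsymm : ∀ x, x ∈ K → -x ∈ K) (v : V) :
    Real.exp (-(‖v‖ ^ 2 / 2)) * ∫ x : V, K.indicator gaussWeight x ≤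
      ∫ x : V, (K.indicator (1 : V → ℝ) (x - v)) * gaussWeight x := by
  have hsymm' : ∀ x, -x ∈ K ↔ x ∈ K := fun x => ⟨fun h => by simpa using hsymm _ h, hsymm x⟩
  have hint : ∀ v : V, Integrable fun x : V =>
      K.indicator (fun x => Real.exp (inner ℝ v x) * gaussWeight x) x := fun v =>
    (integrable_exp_inner_mul_gaussWeight v).indicator hK
  have h1 : ∫ x : V, (K.indicator (1 : V → ℝ) (x - v)) * gaussWeight x =
      ∫ x : V, (K.indicator (1 : V → ℝ) x) * gaussWeight (x + v) := by
    rw [← integral_sub_right_eq_self (fun x : V => (K.indicator (1 : V → ℝ) x) * gaussWeight (x + v)) v]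
    simp
  have h2 : ∀ x : V, (K.indicator (1 : V → ℝ) x) * gaussWeight (x + v) =
      Real.exp (-(‖v‖ ^ 2 / 2)) *
        K.indicator (fun x => Real.exp (inner ℝ (-v) x) * gaussWeight x) x := by
    intro x
    by_cases hx : x ∈ K
    · simp only [Set.indicator_of_mem hx, Pi.one_apply, one_mul]
      rw [exp_inner_mul_gaussWeight, ← mul_assoc, ← Real.exp_add, norm_neg]
      simp
    · simp [hx]
  have h3 : ∫ x : V, K.indicator (fun x => Real.exp (inner ℝ (-v) x) * gaussWeight x) x =
      ∫ x : V, K.indicator (fun x => Real.exp (inner ℝ v x) * gaussWeight x) x := by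
    rw [← integral_neg_eq_self (fun x : V =>
      K.indicator (fun x => Real.exp (inner ℝ v x) * gaussWeight x) x)]
    congr 1
    ext x
    by_cases hx : x ∈ K
    · have hx' := hsymm x hx
      simp [hx, hx', gaussWeight]
    · have hx' : -x ∉ K := fun h => hx ((hsymm' x).1 h)
      simp [hx, hx']
  rw [h1]
  simp_rw [h2]
  rw [integral_const_mul]
  refine mul_le_mul_of_nonneg_left ?_ (Real.exp_pos _).le
  have h4 : ∫ x : V, K.indicator (fun x => Real.exp (inner ℝ (-v) x) * gaussWeight x) x =
      ∫ x : V, (K.indicator (fun x => Real.exp (inner ℝ (-v) x) * gaussWeight x) x +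
        K.indicator (fun x => Real.exp (inner ℝ v x) * gaussWeight x) x) / 2 := by
    rw [integral_div, integral_add (hint _) (hint _), h3]
    ring
  rw [h4]
  refine integral_mono (integrable_gaussWeight.indicator hK)
    (((hint _).add (hint _)).div_const 2) fun x => ?_
  by_cases hx : x ∈ K
  · simp only [Set.indicator_of_mem hx, inner_neg_left]
    have := Real.one_le_cosh (inner ℝ v x)
    rw [Real.cosh_eq] at this
    nlinarith [gaussWeight_pos x]
  · simp [hx]

theorem sq_le_two_mul_cosh_sub_one (z : ℝ) : z ^ 2 ≤ 2 * (Real.cosh z - 1) := by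
  have h := Real.cosh_sq' (z / 2)
  have h2 : Real.cosh z = 1 + 2 * Real.sinh (z / 2) ^ 2 := by
    have := Real.cosh_two_mul (z / 2)
    rw [mul_div_cancel₀ _ (two_ne_zero)] at this
    linarith
  have h3 : |z / 2| ≤ |Real.sinh (z / 2)| := by
    rw [Real.abs_sinh]
    exact Real.self_le_sinh_iff.2 (abs_nonneg _)
  have h4 := sq_le_sq.2 h3
  nlinarith

/-- The Gaussian measure of a polydisc-type set cut out by a quadratic form and finitely many
slabs is at least one half. -/
theorem half_le_integral_indicator {m : ℕ} (X : Fin m → V) (hX : ∀ j, ‖X j‖ = 1)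
    (W : Fin m → ℝ) (hW : ∀ j, 0 ≤ W j) {R₁ R₂ : ℝ} (hR₁ : 0 < R₁) (hR₂ : 0 < R₂)
    (h₁ : 6 * ∑ j, W j ≤ R₁ ^ 2) (h₂ : 8 * m * Real.exp (-(R₂ ^ 2 / 2)) ≤ 1) :
    (∫ x : V, gaussWeight x) / 2 ≤
      ∫ x : V, {x : V | ∑ j, W j * inner ℝ (X j) x ^ 2 ≤ R₁ ^ 2 ∧
        ∀ j, |inner ℝ (X j) x| ≤ R₂}.indicator gaussWeight x := by
  set K : Set V := {x : V | ∑ j, W j * inner ℝ (X j) x ^ 2 ≤ R₁ ^ 2 ∧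
        ∀ j, |inner ℝ (X j) x| ≤ R₂} with hKdef
  have hKc : IsClosed K := by
    have e : K = {x : V | ∑ j, W j * inner ℝ (X j) x ^ 2 ≤ R₁ ^ 2} ∩
        ⋂ j, {x : V | |inner ℝ (X j) x| ≤ R₂} := by
      ext x
      simp [hKdef]
    rw [e]
    exact IsClosed.inter (isClosed_le (by fun_prop) continuous_const)
      (isClosed_iInter fun j => isClosed_le (by fun_prop) continuous_const)
  set Z := ∫ x : V, gaussWeight x with hZ
  have hZpos : 0 < Z := integral_gaussWeight_pos
  set G : V → ℝ := fun x =>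
    (∑ j, W j * (2 * (Real.cosh (inner ℝ (X j) x) * gaussWeight x - gaussWeight x))) / R₁ ^ 2 +
      ∑ j, 2 * Real.exp (-R₂ ^ 2) * (Real.cosh (inner ℝ (R₂ • X j) x) * gaussWeight x) with hG
  have hGint : Integrable G := by
    refine Integrable.add (Integrable.div_const (integrable_finsetSum _ fun j _ => ?_) _)
      (integrable_finsetSum _ fun j _ => ?_)
    · exact (((integrable_cosh_inner_mul_gaussWeight (X j)).sub
        integrable_gaussWeight).const_mul 2).const_mul _
    · exact (integrable_cosh_inner_mul_gaussWeight _).const_mul _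
  have hGval : ∫ x, G x ≤ Z / 2 := by
    have e1 : ∫ x, G x = (∑ j, W j * (2 * (Real.exp (1 / 2) * Z - Z))) / R₁ ^ 2 +
        ∑ j : Fin m, 2 * Real.exp (-R₂ ^ 2) * (Real.exp (R₂ ^ 2 / 2) * Z) := by
      rw [hG, integral_add, integral_div, integral_finsetSum, integral_finsetSum]
      · congr 1
        · congr 1
          refine Finset.sum_congr rfl fun j _ => ?_
          rw [integral_const_mul, integral_const_mul, integral_sub
            (integrable_cosh_inner_mul_gaussWeight (X j)) integrable_gaussWeight,
            integral_cosh_inner_mul_gaussWeight, hX j]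
          simp [hZ]
        · refine Finset.sum_congr rfl fun j _ => ?_
          rw [integral_const_mul, integral_cosh_inner_mul_gaussWeight, norm_smul, hX j]
          simp [hZ]
      · intro j _
        exact (integrable_cosh_inner_mul_gaussWeight _).const_mul _
      · intro j _
        exact (((integrable_cosh_inner_mul_gaussWeight (X j)).sub
          integrable_gaussWeight).const_mul 2).const_mul _
      · exact Integrable.div_const (integrable_finsetSum _ fun j _ =>
          (((integrable_cosh_inner_mul_gaussWeight (X j)).sub
          integrable_gaussWeight).const_mul 2).const_mul _) _
      · exact integrable_finsetSum _ fun j _ =>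
          (integrable_cosh_inner_mul_gaussWeight _).const_mul _
    rw [e1]
    have e2 : Real.exp (1 / 2) ≤ 7 / 4 := by
      have h1 : Real.exp (1 / 2) ^ 2 = Real.exp 1 := by
        rw [← Real.exp_nat_mul]; norm_num
      have h2 := Real.exp_one_lt_d9
      by_contra hc
      push Not at hc
      nlinarith
    have e3 : (∑ j, W j * (2 * (Real.exp (1 / 2) * Z - Z))) / R₁ ^ 2 ≤ Z / 4 := by
      rw [← Finset.sum_mul, div_le_iff₀ (by positivity)]
      have hWs : 0 ≤ ∑ j, W j := Finset.sum_nonneg fun j _ => hW j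
      have : 2 * (Real.exp (1 / 2) * Z - Z) ≤ 3 / 2 * Z := by nlinarith
      calc (∑ j, W j) * (2 * (Real.exp (1 / 2) * Z - Z)) ≤ (∑ j, W j) * (3 / 2 * Z) := by gcongr
        _ = Z / 4 * (6 * ∑ j, W j) := by ring
        _ ≤ _ := by gcongr
    have e4 : ∑ j : Fin m, 2 * Real.exp (-R₂ ^ 2) * (Real.exp (R₂ ^ 2 / 2) * Z) ≤ Z / 4 := by
      have : Real.exp (-R₂ ^ 2) * Real.exp (R₂ ^ 2 / 2) = Real.exp (-(R₂ ^ 2 / 2)) := by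
        rw [← Real.exp_add]; ring_nf
      simp only [Finset.sum_const, Finset.card_univ, Fintype.card_fin, nsmul_eq_mul]
      calc (m : ℝ) * (2 * Real.exp (-R₂ ^ 2) * (Real.exp (R₂ ^ 2 / 2) * Z))
          = 2 * m * (Real.exp (-R₂ ^ 2) * Real.exp (R₂ ^ 2 / 2)) * Z := by ring
        _ = (8 * m * Real.exp (-(R₂ ^ 2 / 2))) * (Z / 4) := by rw [this]; ring
        _ ≤ 1 * (Z / 4) := by gcongr
        _ = _ := by ring
    linarith
  have hpt : ∀ x : V, gaussWeight x ≤ K.indicator gaussWeight x + G x := by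
    intro x
    have hw := (gaussWeight_pos x).le
    have t1 : ∀ j, 0 ≤ W j * (2 * (Real.cosh (inner ℝ (X j) x) * gaussWeight x - gaussWeight x)) := by
      intro j
      refine mul_nonneg (hW j) ?_
      nlinarith [Real.one_le_cosh (inner ℝ (X j) x)]
    have t2 : ∀ j, 0 ≤ 2 * Real.exp (-R₂ ^ 2) *
        (Real.cosh (inner ℝ (R₂ • X j) x) * gaussWeight x) := by
      intro j
      have := (Real.cosh_pos (inner ℝ (R₂ • X j) x)).le
      positivity
    by_cases hx : x ∈ K
    · rw [Set.indicator_of_mem hx]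
      have : 0 ≤ G x := add_nonneg (div_nonneg (Finset.sum_nonneg fun j _ => t1 j) (by positivity))
        (Finset.sum_nonneg fun j _ => t2 j)
      linarith
    · rw [Set.indicator_of_notMem hx, zero_add]
      replace hx := not_and_or.1 hx
      rcases hx with hx | hx
      · push Not at hx
        have a1 : (R₁ ^ 2) * gaussWeight x ≤
            ∑ j, W j * (2 * (Real.cosh (inner ℝ (X j) x) * gaussWeight x - gaussWeight x)) := by
          calc (R₁ ^ 2) * gaussWeight x ≤ (∑ j, W j * inner ℝ (X j) x ^ 2) * gaussWeight x := by
                gcongr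
            _ = ∑ j, W j * (inner ℝ (X j) x ^ 2 * gaussWeight x) := by
                rw [Finset.sum_mul]; simp_rw [mul_assoc]
            _ ≤ _ := by
                refine Finset.sum_le_sum fun j _ => mul_le_mul_of_nonneg_left ?_ (hW j)
                nlinarith [sq_le_two_mul_cosh_sub_one (inner ℝ (X j) x)]
        have a2 := Finset.sum_nonneg fun j (_ : j ∈ Finset.univ) => t2 j
        have a3 : gaussWeight x ≤ (∑ j, W j *
            (2 * (Real.cosh (inner ℝ (X j) x) * gaussWeight x - gaussWeight x))) / R₁ ^ 2 := by
          rw [le_div_iff₀ (by positivity)]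
          linarith
        simp only [hG]
        linarith
      · push Not at hx
        obtain ⟨j, hj⟩ := hx
        have hR : R₂ ^ 2 ≤ |inner ℝ (R₂ • X j) x| := by
          rw [real_inner_smul_left, abs_mul, abs_of_pos hR₂, sq]
          gcongr
        have hR' : Real.exp (R₂ ^ 2) ≤ 2 * Real.cosh (inner ℝ (R₂ • X j) x) := by
          rw [← Real.cosh_abs, Real.cosh_eq]
          have := Real.exp_le_exp.2 hR
          have := (Real.exp_pos (-|inner ℝ (R₂ • X j) x|)).le
          linarith
        have b1 : gaussWeight x ≤ 2 * Real.exp (-R₂ ^ 2) *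
            (Real.cosh (inner ℝ (R₂ • X j) x) * gaussWeight x) := by
          have h1 : 1 ≤ Real.exp (-R₂ ^ 2) * (2 * Real.cosh (inner ℝ (R₂ • X j) x)) := by
            calc (1 : ℝ) = Real.exp (-R₂ ^ 2) * Real.exp (R₂ ^ 2) := by
                  rw [← Real.exp_add]; simp
              _ ≤ _ := by gcongr
          nlinarith
        have b2 := Finset.single_le_sum (fun i _ => t2 i) (Finset.mem_univ j)
        have b3 : 0 ≤ (∑ j, W j *
            (2 * (Real.cosh (inner ℝ (X j) x) * gaussWeight x - gaussWeight x))) / R₁ ^ 2 :=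
          div_nonneg (Finset.sum_nonneg fun j _ => t1 j) (by positivity)
        simp only [hG]
        linarith
  have hfin : Z ≤ (∫ x : V, K.indicator gaussWeight x) + ∫ x, G x := by
    rw [← integral_add (integrable_gaussWeight.indicator hKc.measurableSet) hGint]
    exact integral_mono integrable_gaussWeight
      ((integrable_gaussWeight.indicator hKc.measurableSet).add hGint) hpt
  linarith

/-- Volumetric form of the dual Sudakov inequality: a separated subset of the ball of radius `ρ`
has at most `2 exp (ρ² / 2)` points. -/
theorem card_le_of_separated {m : ℕ} (X : Fin m → V) (hX : ∀ j, ‖X j‖ = 1)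
    (W : Fin m → ℝ) (hW : ∀ j, 0 ≤ W j) {R₁ R₂ ρ : ℝ} (hR₁ : 0 < R₁) (hR₂ : 0 < R₂)
    (h₁ : 6 * ∑ j, W j ≤ R₁ ^ 2) (h₂ : 8 * m * Real.exp (-(R₂ ^ 2 / 2)) ≤ 1)
    (P : Finset V) (hP : ∀ u ∈ P, ‖u‖ ≤ ρ)
    (hsep : ∀ u ∈ P, ∀ u' ∈ P, u ≠ u' →
      ¬(∑ j, W j * inner ℝ (X j) (u - u') ^ 2 ≤ 4 * R₁ ^ 2 ∧
        ∀ j, |inner ℝ (X j) (u - u')| ≤ 2 * R₂)) :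
    (P.card : ℝ) ≤ 2 * Real.exp (ρ ^ 2 / 2) := by
  have hhalf := half_le_integral_indicator X hX W hW hR₁ hR₂ h₁ h₂
  set K : Set V := {x : V | ∑ j, W j * inner ℝ (X j) x ^ 2 ≤ R₁ ^ 2 ∧
        ∀ j, |inner ℝ (X j) x| ≤ R₂} with hKdef
  have hKm : MeasurableSet K := by
    have e : K = {x : V | ∑ j, W j * inner ℝ (X j) x ^ 2 ≤ R₁ ^ 2} ∩
        ⋂ j, {x : V | |inner ℝ (X j) x| ≤ R₂} := by
      ext x
      simp [hKdef]
    rw [e]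
    exact (IsClosed.inter (isClosed_le (by fun_prop) continuous_const)
      (isClosed_iInter fun j => isClosed_le (by fun_prop) continuous_const)).measurableSet
  have hsymm : ∀ x, x ∈ K → -x ∈ K := fun x hx => by
    refine ⟨?_, fun j => ?_⟩
    · simpa [inner_neg_right] using hx.1
    · simpa [inner_neg_right] using hx.2 j
  have hsub : ∀ x ∈ K, ∀ y ∈ K, ∑ j, W j * inner ℝ (X j) (x - y) ^ 2 ≤ 4 * R₁ ^ 2 ∧
      ∀ j, |inner ℝ (X j) (x - y)| ≤ 2 * R₂ := by
    intro x hx y hy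
    refine ⟨?_, fun j => ?_⟩
    · calc ∑ j, W j * inner ℝ (X j) (x - y) ^ 2
          ≤ ∑ j, (2 * (W j * inner ℝ (X j) x ^ 2) + 2 * (W j * inner ℝ (X j) y ^ 2)) := by
            refine Finset.sum_le_sum fun j _ => ?_
            rw [inner_sub_right]
            nlinarith [mul_nonneg (hW j) (sq_nonneg (inner ℝ (X j) x + inner ℝ (X j) y))]
        _ = 2 * ∑ j, W j * inner ℝ (X j) x ^ 2 + 2 * ∑ j, W j * inner ℝ (X j) y ^ 2 := by
            rw [Finset.sum_add_distrib, Finset.mul_sum, Finset.mul_sum]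
        _ ≤ _ := by linarith [hx.1, hy.1]
    · rw [inner_sub_right]
      have := abs_sub (inner ℝ (X j) x) (inner ℝ (X j) y)
      linarith [hx.2 j, hy.2 j]
  set Z := ∫ x : V, gaussWeight x with hZ
  have hZpos : 0 < Z := integral_gaussWeight_pos
  have hint : ∀ u : V, Integrable fun x : V => K.indicator (1 : V → ℝ) (x - u) * gaussWeight x := by
    intro u
    have := integrable_gaussWeight.indicator (hKm.preimage (measurable_id.sub_const u))
    refine this.congr (Filter.Eventually.of_forall fun x => ?_)
    by_cases hx : x - u ∈ K
    · simp [Set.indicator, hx]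
    · simp [Set.indicator, hx]
  have hpt : ∀ x : V, ∑ u ∈ P, K.indicator (1 : V → ℝ) (x - u) * gaussWeight x ≤ gaussWeight x := by
    intro x
    rw [← Finset.sum_mul]
    refine mul_le_of_le_one_left (gaussWeight_pos x).le ?_
    by_cases h : ∃ u ∈ P, x - u ∈ K
    · obtain ⟨u, hu, hxu⟩ := h
      rw [Finset.sum_eq_single_of_mem u hu]
      · simp [hxu]
      · intro u' hu' hne
        refine Set.indicator_of_notMem (fun hxu' => hsep u' hu' u hu hne ?_) _
        have := hsub _ hxu _ hxu'
        simpa using this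
    · push Not at h
      rw [Finset.sum_eq_zero fun u hu => Set.indicator_of_notMem (h u hu) _]
      exact zero_le_one
  have hsum : ∑ u ∈ P, ∫ x : V, K.indicator (1 : V → ℝ) (x - u) * gaussWeight x ≤ Z := by
    rw [← integral_finsetSum _ fun u _ => hint u]
    exact integral_mono (integrable_finsetSum _ fun u _ => hint u) integrable_gaussWeight hpt
  have hlow : ∀ u ∈ P, Real.exp (-(ρ ^ 2 / 2)) * (Z / 2) ≤
      ∫ x : V, K.indicator (1 : V → ℝ) (x - u) * gaussWeight x := by
    intro u hu
    refine le_trans ?_ (integral_indicator_translate_ge hKm hsymm u)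
    have := hP u hu
    gcongr
  have hcard := (Finset.card_nsmul_le_sum P _ _ hlow).trans hsum
  rw [nsmul_eq_mul, Real.exp_neg] at hcard
  have he := Real.exp_pos (ρ ^ 2 / 2)
  have : (P.card : ℝ) * ((Real.exp (ρ ^ 2 / 2))⁻¹ * (Z / 2)) =
      (P.card / (2 * Real.exp (ρ ^ 2 / 2))) * Z := by
    field_simp
  rw [this] at hcard
  have h3 : (P.card / (2 * Real.exp (ρ ^ 2 / 2))) ≤ 1 := by
    by_contra hc
    push Not at hc
    nlinarith
  rwa [div_le_one (by positivity)] at h3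

end Gaussian

/-- A set all of whose separated finite subsets have at most `M` points can be labelled with `M`
labels so that points with the same label are close to a common point. -/
theorem exists_label_of_card_le {V : Type*} {M : ℕ} (hM : 0 < M) (Q : Set V) (r : V → V → Prop)
    (hrefl : ∀ x, r x x) (hsymm : ∀ x y, r x y → r y x)
    (hcard : ∀ P : Finset V, (∀ u ∈ P, u ∈ Q) →
      (∀ u ∈ P, ∀ u' ∈ P, u ≠ u' → ¬ r u u') → P.card ≤ M) :
    ∃ c : V → Fin M, ∀ y ∈ Q, ∀ z ∈ Q, c y = c z → ∃ u, r y u ∧ r z u := by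
  classical
  set S : Set ℕ := {k | ∃ P : Finset V, (∀ u ∈ P, u ∈ Q) ∧
      (∀ u ∈ P, ∀ u' ∈ P, u ≠ u' → ¬ r u u') ∧ P.card = k} with hS
  have hne : S.Nonempty := ⟨0, ∅, by simp⟩
  have hbdd : BddAbove S := ⟨M, by rintro k ⟨P, h1, h2, rfl⟩; exact hcard P h1 h2⟩
  obtain ⟨P, hPQ, hPs, hPc⟩ := Nat.sSup_mem hne hbdd
  have hcov : ∀ y ∈ Q, ∃ u ∈ P, r y u := by
    intro y hy
    by_contra hcon
    push Not at hcon
    have hyP : y ∉ P := fun h => hcon y h (hrefl y)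
    have hmem : (insert y P).card ∈ S := by
      refine ⟨insert y P, ?_, ?_, rfl⟩
      · intro u hu
        rcases Finset.mem_insert.1 hu with rfl | hu
        · exact hy
        · exact hPQ u hu
      · intro u hu u' hu' hne
        rcases Finset.mem_insert.1 hu with h1 | h1
        · rcases Finset.mem_insert.1 hu' with h2 | h2
          · exact absurd (h1.trans h2.symm) hne
          · exact h1 ▸ hcon u' h2
        · rcases Finset.mem_insert.1 hu' with h2 | h2
          · exact fun h => hcon u h1 (h2 ▸ hsymm _ _ h)
          · exact hPs u h1 u' h2 hne
    have := le_csSup hbdd hmem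
    rw [Finset.card_insert_of_notMem hyP, hPc] at this
    omega
  choose! f hfP hf using hcov
  have hle : P.card ≤ M := hcard P hPQ hPs
  refine ⟨fun y => if h : f y ∈ P then Fin.castLE hle (P.equivFin ⟨f y, h⟩) else ⟨0, hM⟩, ?_⟩
  intro y hy z hz hyz
  have h1 := hfP y hy
  have h2 := hfP z hz
  simp only [h1, h2, dif_pos] at hyz
  have h3 : f y = f z := by
    have := P.equivFin.injective (Fin.castLE_injective hle hyz)
    simpa using this
  exact ⟨f y, hf y hy, h3 ▸ hf z hz⟩

/-- The sign `±1` attached to a Boolean. -/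
def boolSign (b : Bool) : ℝ := if b then 1 else -1

theorem boolSign_mul_self (b : Bool) : boolSign b * boolSign b = 1 := by
  cases b <;> simp [boolSign]

/-- The average over all sign patterns. -/
noncomputable def signAvg {m : ℕ} (f : (Fin m → Bool) → ℝ) : ℝ := (∑ σ, f σ) / 2 ^ m

theorem signAvg_mono {m : ℕ} {f g : (Fin m → Bool) → ℝ} (h : ∀ σ, f σ ≤ g σ) :
    signAvg f ≤ signAvg g := by
  unfold signAvg
  gcongr with σ
  exact h σ

theorem signAvg_const {m : ℕ} (c : ℝ) : signAvg (fun _ : Fin m → Bool => c) = c := by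
  simp [signAvg]

theorem signAvg_add {m : ℕ} (f g : (Fin m → Bool) → ℝ) :
    signAvg (fun σ => f σ + g σ) = signAvg f + signAvg g := by
  simp [signAvg, Finset.sum_add_distrib, add_div]

theorem signAvg_const_mul {m : ℕ} (c : ℝ) (f : (Fin m → Bool) → ℝ) :
    signAvg (fun σ => c * f σ) = c * signAvg f := by
  simp [signAvg, ← Finset.mul_sum, mul_div_assoc]

theorem signAvg_sum {m : ℕ} {ι : Type*} (s : Finset ι) (f : ι → (Fin m → Bool) → ℝ) :
    signAvg (fun σ => ∑ i ∈ s, f i σ) = ∑ i ∈ s, signAvg (f i) := by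
  simp only [signAvg]
  rw [Finset.sum_comm, Finset.sum_div]

/-- The value at `σ` of the Rademacher process indexed by vectors. -/
def signSum {m : ℕ} (σ : Fin m → Bool) (a : Fin m → ℝ) : ℝ := ∑ j, boolSign (σ j) * a j

theorem signSum_sub {m : ℕ} (σ : Fin m → Bool) (a b : Fin m → ℝ) :
    signSum σ (a - b) = signSum σ a - signSum σ b := by
  simp [signSum, mul_sub]

theorem signSum_smul {m : ℕ} (σ : Fin m → Bool) (c : ℝ) (a : Fin m → ℝ) :
    signSum σ (c • a) = c * signSum σ a := by
  simp only [signSum, Pi.smul_apply, smul_eq_mul, Finset.mul_sum]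
  exact Finset.sum_congr rfl fun j _ => by ring

theorem abs_signSum_le {m : ℕ} (σ : Fin m → Bool) (a : Fin m → ℝ) :
    |signSum σ a| ≤ Real.sqrt m * Real.sqrt (∑ j, a j ^ 2) := by
  have h := Finset.sum_mul_sq_le_sq_mul_sq Finset.univ (fun j => boolSign (σ j)) a
  have h1 : ∀ j, boolSign (σ j) ^ 2 = 1 := fun j => by rw [sq, boolSign_mul_self]
  simp only [h1, Finset.sum_const, Finset.card_univ, Fintype.card_fin, nsmul_eq_mul, mul_one] at h
  rw [← Real.sqrt_mul (Nat.cast_nonneg m)]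
  exact Real.abs_le_sqrt h

theorem signAvg_exp_signSum_le {m : ℕ} (a : Fin m → ℝ) :
    signAvg (fun σ => Real.exp (signSum σ a)) ≤ Real.exp ((∑ j, a j ^ 2) / 2) := by
  have h1 : ∑ σ : Fin m → Bool, Real.exp (signSum σ a) = ∏ j, (2 * Real.cosh (a j)) := by
    have h := Finset.prod_univ_sum (fun _ : Fin m => (Finset.univ : Finset Bool))
      (fun j b => Real.exp (boolSign b * a j))
    rw [Fintype.piFinset_univ] at h
    simp only [signSum, Real.exp_sum]
    rw [← h]
    refine Finset.prod_congr rfl fun j _ => ?_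
    simp only [Fintype.sum_bool, boolSign, Real.cosh_eq]
    simp
    ring
  have h2 : ∏ j, (2 * Real.cosh (a j)) = 2 ^ m * ∏ j, Real.cosh (a j) := by
    rw [Finset.prod_mul_distrib]
    simp
  rw [signAvg, h1, h2, mul_div_cancel_left₀ _ (by positivity), Finset.sum_div, Real.exp_sum]
  exact Finset.prod_le_prod (fun j _ => (Real.cosh_pos _).le) fun j _ =>
    Real.cosh_le_exp_half_sq (a j)

/-- Simultaneous control of finitely many Rademacher sums organized in levels, level `k`
containing at most `2 ^ (c * 4 ^ k)` sums. -/
theorem exists_multilevel_bound {m : ℕ} (c K : ℕ) (N : ℕ → ℕ) (hN : ∀ k, N k ≤ 2 ^ (c * 4 ^ k))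
    (g : (k : ℕ) → Fin (N k) → Fin m → ℝ) :
    ∃ U : (Fin m → Bool) → ℝ, (∀ σ, 0 ≤ U σ) ∧ signAvg U ≤ 3 * (c + 2) ∧
      ∀ σ, ∀ k < K, ∀ a, |signSum σ (g k a)| ≤
        2 ^ k * Real.sqrt (∑ j, g k a j ^ 2) * U σ := by
  set nrm : (k : ℕ) → Fin (N k) → ℝ := fun k a => Real.sqrt (∑ j, g k a j ^ 2) with hnrm
  have hnrm0 : ∀ k a, 0 ≤ nrm k a := fun k a => Real.sqrt_nonneg _
  have hnrm2 : ∀ k a, nrm k a ^ 2 = ∑ j, g k a j ^ 2 := fun k a =>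
    Real.sq_sqrt (Finset.sum_nonneg fun j _ => sq_nonneg _)
  set lam : (k : ℕ) → Fin (N k) → ℝ := fun k a => 2 ^ k / nrm k a with hlam
  set s : ℕ → ℝ := fun k => (c + 2) * 4 ^ k with hs
  set Y : (Fin m → Bool) → ℝ := fun σ => ∑ k ∈ Finset.range K, ∑ a : Fin (N k),
    Real.exp (-s k) * (Real.exp (signSum σ (lam k a • g k a)) +
      Real.exp (signSum σ (-lam k a • g k a))) with hY
  have hY0 : ∀ σ, 0 ≤ Y σ := fun σ => Finset.sum_nonneg fun k _ => Finset.sum_nonneg fun a _ => by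
    positivity
  have hmgf : ∀ k a, ∀ e : ℝ, e ^ 2 = lam k a ^ 2 →
      signAvg (fun σ => Real.exp (signSum σ (e • g k a))) ≤ Real.exp (4 ^ k / 2) := by
    intro k a e he
    refine (signAvg_exp_signSum_le _).trans (Real.exp_le_exp.2 ?_)
    have : ∑ j, (e • g k a) j ^ 2 = lam k a ^ 2 * nrm k a ^ 2 := by
      simp only [Pi.smul_apply, smul_eq_mul, mul_pow, he, hnrm2, Finset.mul_sum]
    rw [this]
    have h4 : (4 : ℝ) ^ k = (2 ^ k) ^ 2 := by rw [← pow_mul, mul_comm, pow_mul]; norm_num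
    by_cases h0 : nrm k a = 0
    · rw [h0]
      simp only [ne_eq, OfNat.ofNat_ne_zero, not_false_eq_true, zero_pow, mul_zero, zero_div]
      positivity
    · rw [hlam, ← mul_pow, div_mul_cancel₀ _ h0, h4]
  have hYavg : signAvg Y ≤ 2 := by
    rw [hY, signAvg_sum]
    have hlev : ∀ k ∈ Finset.range K, signAvg (fun σ => ∑ a : Fin (N k),
        Real.exp (-s k) * (Real.exp (signSum σ (lam k a • g k a)) +
          Real.exp (signSum σ (-lam k a • g k a)))) ≤ (1 / 2) ^ k := by
      intro k _
      rw [signAvg_sum]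
      have h1 : ∀ a ∈ (Finset.univ : Finset (Fin (N k))), signAvg (fun σ =>
          Real.exp (-s k) * (Real.exp (signSum σ (lam k a • g k a)) +
          Real.exp (signSum σ (-lam k a • g k a)))) ≤
          Real.exp (-s k) * (2 * Real.exp (4 ^ k / 2)) := by
        intro a _
        rw [signAvg_const_mul, signAvg_add]
        have e1 := hmgf k a (lam k a) rfl
        have e2 := hmgf k a (-lam k a) (by ring)
        gcongr
        linarith
      refine (Finset.sum_le_sum h1).trans ?_
      rw [Finset.sum_const, Finset.card_univ, Fintype.card_fin, nsmul_eq_mul]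
      have hNk : (N k : ℝ) ≤ Real.exp (c * 4 ^ k) := by
        calc (N k : ℝ) ≤ 2 ^ (c * 4 ^ k) := by exact_mod_cast hN k
          _ ≤ (Real.exp 1) ^ (c * 4 ^ k) := by
              gcongr
              linarith [Real.add_one_le_exp (1 : ℝ)]
          _ = Real.exp (c * 4 ^ k) := by
              rw [← Real.exp_nat_mul]; push_cast; ring_nf
      have hk : ((k : ℝ) + 1) ≤ 4 ^ k := by
        have := Nat.lt_pow_self (n := k) (show 1 < 4 by norm_num)
        exact_mod_cast this
      calc (N k : ℝ) * (Real.exp (-s k) * (2 * Real.exp (4 ^ k / 2)))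
          ≤ Real.exp (c * 4 ^ k) * (Real.exp (-s k) * (2 * Real.exp (4 ^ k / 2))) := by gcongr
        _ = 2 * Real.exp (-(3 / 2 * 4 ^ k)) := by
            rw [mul_left_comm (Real.exp (-s k)), mul_left_comm (Real.exp (c * 4 ^ k)),
              ← Real.exp_add, ← Real.exp_add, hs]
            ring_nf
        _ ≤ 2 * Real.exp (-((k : ℝ) + 1)) := by
            gcongr
            nlinarith
        _ ≤ 2 * (1 / 2) ^ (k + 1) := by
            gcongr
            have : Real.exp (-((k : ℝ) + 1)) = Real.exp (-1) ^ (k + 1) := by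
              rw [← Real.exp_nat_mul]; push_cast; ring_nf
            rw [this]
            gcongr
            rw [Real.exp_neg, one_div]
            gcongr
            linarith [Real.add_one_le_exp (1 : ℝ)]
        _ = _ := by rw [pow_succ]; ring
    refine (Finset.sum_le_sum hlev).trans ?_
    have := geom_sum_eq (x := (1 / 2 : ℝ)) (by norm_num) K
    rw [this]
    have : (0 : ℝ) ≤ (1 / 2) ^ K := by positivity
    rw [div_le_iff_of_neg (by norm_num)]
    linarith
  refine ⟨fun σ => (c + 2) * (1 + Y σ), fun σ => ?_, ?_, ?_⟩
  · exact mul_nonneg (by positivity) (add_nonneg zero_le_one (hY0 σ))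
  · have h2 : (0 : ℝ) ≤ c + 2 := by positivity
    rw [signAvg_const_mul, signAvg_add (fun _ => (1 : ℝ)) Y, signAvg_const]
    generalize signAvg Y = y at hYavg
    calc ((c : ℝ) + 2) * (1 + y) ≤ (c + 2) * 3 := by
          gcongr
          linarith
      _ = _ := by ring
  · intro σ k hk a
    change |signSum σ (g k a)| ≤ 2 ^ k * nrm k a * ((c + 2) * (1 + Y σ))
    by_cases h0 : nrm k a = 0
    · have := abs_signSum_le σ (g k a)
      rw [show Real.sqrt (∑ j, g k a j ^ 2) = nrm k a from rfl, h0] at this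
      rw [h0]
      simpa using this
    have hpos : 0 < nrm k a := lt_of_le_of_ne (hnrm0 k a) (Ne.symm h0)
    have hlpos : 0 < lam k a := by rw [hlam]; positivity
    have hterm : Real.exp (-s k) * Real.exp (lam k a * |signSum σ (g k a)|) ≤ Y σ := by
      have t1 : Real.exp (-s k) * (Real.exp (signSum σ (lam k a • g k a)) +
          Real.exp (signSum σ (-lam k a • g k a))) ≤ Y σ := by
        refine le_trans ?_ (Finset.single_le_sum (f := fun k => ∑ a : Fin (N k),
          Real.exp (-s k) * (Real.exp (signSum σ (lam k a • g k a)) +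
          Real.exp (signSum σ (-lam k a • g k a))))
          (fun k _ => Finset.sum_nonneg fun a _ => by positivity) (Finset.mem_range.2 hk))
        exact Finset.single_le_sum (f := fun a : Fin (N k) =>
          Real.exp (-s k) * (Real.exp (signSum σ (lam k a • g k a)) +
          Real.exp (signSum σ (-lam k a • g k a)))) (fun a _ => by positivity) (Finset.mem_univ a)
      refine le_trans ?_ t1
      gcongr
      rw [signSum_smul, signSum_smul]
      rcases abs_cases (signSum σ (g k a)) with ⟨h, _⟩ | ⟨h, _⟩
      · rw [h]
        linarith [Real.exp_pos (-lam k a * signSum σ (g k a))]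
      · rw [h, show lam k a * -signSum σ (g k a) = -lam k a * signSum σ (g k a) by ring]
        linarith [Real.exp_pos (lam k a * signSum σ (g k a))]
    rw [← Real.exp_add] at hterm
    have h1 : lam k a * |signSum σ (g k a)| ≤ s k + Y σ := by
      linarith [Real.add_one_le_exp (-s k + lam k a * |signSum σ (g k a)|)]
    have h2 : |signSum σ (g k a)| = nrm k a / 2 ^ k * (lam k a * |signSum σ (g k a)|) := by
      rw [hlam]
      field_simp
    have h3 : (1 : ℝ) ≤ 4 ^ k := one_le_pow₀ (by norm_num)
    have h4 : (4 : ℝ) ^ k = 2 ^ k * 2 ^ k := by rw [← mul_pow]; norm_num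
    rw [h2]
    calc nrm k a / 2 ^ k * (lam k a * |signSum σ (g k a)|)
        ≤ nrm k a / 2 ^ k * (s k + Y σ) := by gcongr
      _ ≤ nrm k a / 2 ^ k * ((c + 2) * 4 ^ k * (1 + Y σ)) := by
          refine mul_le_mul_of_nonneg_left ?_ (by positivity)
          rw [hs]
          have h5 : (1 : ℝ) ≤ (c + 2) * 4 ^ k := by
            have : (0 : ℝ) ≤ c := by positivity
            nlinarith
          nlinarith [hY0 σ]
      _ = _ := by
          rw [h4]
          field_simp

/-- One refinement step of a labelling: classes are split according to the size of `s` and then by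
the labels provided by `hstep`. -/
theorem exists_refined_labels {V : Type*} (T : Set V) (d : V → V → ℝ) (s : V → ℝ) {h τ : ℝ} (k : ℕ)
    (hh : 0 < h) (hτ : 0 ≤ τ) (hs0 : ∀ x ∈ T, 0 ≤ s x) (hsh : ∀ x ∈ T, s x ≤ h)
    (hstep : ∀ (A : Set V) (δ r : ℝ), A ⊆ T → 0 ≤ δ → 0 ≤ r → (∀ x ∈ A, ∀ y ∈ A, d x y ≤ δ) →
      (∀ x ∈ A, s x ≤ r) → ∃ c : V → Fin (2 ^ (2 * 4 ^ k)), ∀ x ∈ A, ∀ y ∈ A, c x = c y →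
        d x y ≤ δ / 8 + 3 * r + τ)
    (ℓ : V → Fin (2 ^ (4 * 4 ^ k))) (δ : Fin (2 ^ (4 * 4 ^ k)) → ℝ) (hδ0 : ∀ a, 0 ≤ δ a)
    (hδ : ∀ x ∈ T, ∀ y ∈ T, ℓ x = ℓ y → d x y ≤ δ (ℓ x)) :
    ∃ (ℓ' : V → Fin (2 ^ (4 * 4 ^ (k + 1))))
      (π : Fin (2 ^ (4 * 4 ^ (k + 1))) → Fin (2 ^ (4 * 4 ^ k)))
      (δ' : Fin (2 ^ (4 * 4 ^ (k + 1))) → ℝ),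
      (∀ a, 0 ≤ δ' a) ∧ (∀ x ∈ T, π (ℓ' x) = ℓ x) ∧
      (∀ x ∈ T, ∀ y ∈ T, ℓ' x = ℓ' y → d x y ≤ δ' (ℓ' x)) ∧
      ∀ x ∈ T, δ' (ℓ' x) ≤ δ (ℓ x) / 8 + 3 * (s x + h / 2 ^ k) + τ := by
  classical
  set r : ℕ → ℝ := fun i => (i + 1) * (h / 2 ^ k) with hr
  have hr0 : ∀ i, 0 ≤ r i := fun i => by rw [hr]; positivity
  set i : V → ℕ := fun x => ⌊s x / (h / 2 ^ k)⌋₊ with hi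
  have hpos : 0 < h / 2 ^ k := by positivity
  have hi_le : ∀ x ∈ T, i x < 2 ^ k + 1 := by
    intro x hx
    rw [Nat.lt_succ_iff, hi]
    refine Nat.floor_le_of_le ?_
    rw [div_le_iff₀ hpos]
    have : ((2 ^ k : ℕ) : ℝ) * (h / 2 ^ k) = h := by
      push_cast
      field_simp
    rw [this]
    exact hsh x hx
  have hs_le : ∀ x ∈ T, s x ≤ r (i x) := by
    intro x hx
    have := (Nat.lt_floor_add_one (s x / (h / 2 ^ k))).le
    rwa [div_le_iff₀ hpos] at this
  have hr_le : ∀ x ∈ T, r (i x) ≤ s x + h / 2 ^ k := by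
    intro x hx
    have := Nat.floor_le (div_nonneg (hs0 x hx) hpos.le)
    rw [le_div_iff₀ hpos] at this
    rw [hr, hi]
    simp only
    linarith
  have hc : ∀ (a : Fin (2 ^ (4 * 4 ^ k))) (j : ℕ), ∃ c : V → Fin (2 ^ (2 * 4 ^ k)),
      ∀ x ∈ T, ∀ y ∈ T, ℓ x = a → ℓ y = a → i x = j → i y = j → c x = c y →
        d x y ≤ δ a / 8 + 3 * r j + τ := by
    intro a j
    obtain ⟨c, hc⟩ := hstep {x | x ∈ T ∧ ℓ x = a ∧ i x = j} (δ a) (r j) (fun x hx => hx.1) (hδ0 a)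
      (hr0 j) (fun x hx y hy => by
        have := hδ x hx.1 y hy.1 (hx.2.1.trans hy.2.1.symm)
        rwa [hx.2.1] at this)
      (fun x hx => by
        have := hs_le x hx.1
        rwa [hx.2.2] at this)
    exact ⟨c, fun x hx y hy h1 h2 h3 h4 h5 => hc x ⟨hx, h1, h3⟩ y ⟨hy, h2, h4⟩ h5⟩
  choose c hc using hc
  have hcard : Fintype.card (Fin (2 ^ (4 * 4 ^ k)) × Fin (2 ^ k + 1) × Fin (2 ^ (2 * 4 ^ k))) ≤
      Fintype.card (Fin (2 ^ (4 * 4 ^ (k + 1)))) := by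
    simp only [Fintype.card_prod, Fintype.card_fin]
    have h1 : 2 ^ k + 1 ≤ 2 ^ (k + 1) := by
      have := Nat.one_le_two_pow (n := k)
      rw [pow_succ]
      omega
    have h2 : k < 4 ^ k := Nat.lt_pow_self (by norm_num)
    calc 2 ^ (4 * 4 ^ k) * ((2 ^ k + 1) * 2 ^ (2 * 4 ^ k))
        ≤ 2 ^ (4 * 4 ^ k) * (2 ^ (k + 1) * 2 ^ (2 * 4 ^ k)) := by gcongr
      _ = 2 ^ (4 * 4 ^ k + (k + 1) + 2 * 4 ^ k) := by ring
      _ ≤ _ := by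
        refine Nat.pow_le_pow_right (by norm_num) ?_
        rw [pow_succ]
        omega
  obtain ⟨e⟩ := Function.Embedding.nonempty_of_card_le hcard
  have : Nonempty (Fin (2 ^ (4 * 4 ^ k)) × Fin (2 ^ k + 1) × Fin (2 ^ (2 * 4 ^ k))) :=
    ⟨(⟨0, by positivity⟩, 0, ⟨0, by positivity⟩)⟩
  have hinv : ∀ z, Function.invFun e (e z) = z := Function.leftInverse_invFun e.injective
  refine ⟨fun x => e (ℓ x, Fin.ofNat _ (i x), c (ℓ x) (i x) x),
    fun a => (Function.invFun e a).1,
    fun a => δ (Function.invFun e a).1 / 8 + 3 * r (Function.invFun e a).2.1 + τ, ?_, ?_, ?_, ?_⟩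
  · intro a
    have h1 := hδ0 (Function.invFun e a).1
    have h2 := hr0 (Function.invFun e a).2.1
    positivity
  · intro x _
    simp only [hinv]
  · intro x hx y hy hxy
    have hxy' := e.injective hxy
    simp only [Prod.mk.injEq] at hxy'
    obtain ⟨h1, h2, h3⟩ := hxy'
    have h2' : i x = i y := by
      have := congrArg Fin.val h2
      simpa [Fin.ofNat, Nat.mod_eq_of_lt (hi_le x hx), Nat.mod_eq_of_lt (hi_le y hy)] using this
    simp only [hinv]
    have e1 : ((Fin.ofNat (2 ^ k + 1) (i x)).val) = i x := Nat.mod_eq_of_lt (hi_le x hx)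
    rw [e1]
    refine hc (ℓ x) (i x) x hx y hy rfl h1.symm rfl h2'.symm ?_
    rw [h3, h1, h2']
  · intro x hx
    simp only [hinv]
    have e1 : ((Fin.ofNat (2 ^ k + 1) (i x)).val) = i x := Nat.mod_eq_of_lt (hi_le x hx)
    rw [e1]
    linarith [hr_le x hx]

/-- Iteration of `exists_refined_labels`. -/
theorem exists_label_sequence {V : Type*} (T : Set V) (d : V → V → ℝ) (s : ℕ → V → ℝ) (h τ : ℕ → ℝ)
    {Δ : ℝ} (hΔ : 0 ≤ Δ) (hd : ∀ x ∈ T, ∀ y ∈ T, d x y ≤ Δ)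
    (hh : ∀ k, 0 < h k) (hτ : ∀ k, 0 ≤ τ k) (hs0 : ∀ k, ∀ x ∈ T, 0 ≤ s k x)
    (hsh : ∀ k, ∀ x ∈ T, s k x ≤ h k)
    (hstep : ∀ k, ∀ (A : Set V) (δ r : ℝ), A ⊆ T → 0 ≤ δ → 0 ≤ r →
      (∀ x ∈ A, ∀ y ∈ A, d x y ≤ δ) →
      (∀ x ∈ A, s k x ≤ r) → ∃ c : V → Fin (2 ^ (2 * 4 ^ k)), ∀ x ∈ A, ∀ y ∈ A, c x = c y →
        d x y ≤ δ / 8 + 3 * r + τ k) :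
    ∃ (ℓ : (k : ℕ) → V → Fin (2 ^ (4 * 4 ^ k)))
      (π : (k : ℕ) → Fin (2 ^ (4 * 4 ^ (k + 1))) → Fin (2 ^ (4 * 4 ^ k)))
      (δ : (k : ℕ) → Fin (2 ^ (4 * 4 ^ k)) → ℝ),
      (∀ x y, ℓ 0 x = ℓ 0 y) ∧ (∀ a, δ 0 a = Δ) ∧ (∀ k a, 0 ≤ δ k a) ∧
      (∀ k, ∀ x ∈ T, π k (ℓ (k + 1) x) = ℓ k x) ∧
      (∀ k, ∀ x ∈ T, ∀ y ∈ T, ℓ k x = ℓ k y → d x y ≤ δ k (ℓ k x)) ∧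
      ∀ k, ∀ x ∈ T, δ (k + 1) (ℓ (k + 1) x) ≤
        δ k (ℓ k x) / 8 + 3 * (s k x + h k / 2 ^ k) + τ k := by
  have hex : ∀ (k : ℕ) (p : {p : (V → Fin (2 ^ (4 * 4 ^ k))) × (Fin (2 ^ (4 * 4 ^ k)) → ℝ) //
      (∀ a, 0 ≤ p.2 a) ∧ ∀ x ∈ T, ∀ y ∈ T, p.1 x = p.1 y → d x y ≤ p.2 (p.1 x)}),
      ∃ p' : {p : (V → Fin (2 ^ (4 * 4 ^ (k + 1)))) × (Fin (2 ^ (4 * 4 ^ (k + 1))) → ℝ) //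
        (∀ a, 0 ≤ p.2 a) ∧ ∀ x ∈ T, ∀ y ∈ T, p.1 x = p.1 y → d x y ≤ p.2 (p.1 x)},
      ∃ π : Fin (2 ^ (4 * 4 ^ (k + 1))) → Fin (2 ^ (4 * 4 ^ k)),
        (∀ x ∈ T, π (p'.1.1 x) = p.1.1 x) ∧ ∀ x ∈ T, p'.1.2 (p'.1.1 x) ≤
          p.1.2 (p.1.1 x) / 8 + 3 * (s k x + h k / 2 ^ k) + τ k := by
    intro k p
    obtain ⟨ℓ', π, δ', h1, h2, h3, h4⟩ := exists_refined_labels T d (s k) k (hh k) (hτ k) (hs0 k)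
      (hsh k) (hstep k) p.1.1 p.1.2 p.2.1 p.2.2
    exact ⟨⟨(ℓ', δ'), h1, h3⟩, π, h2, h4⟩
  choose nxt π hπ hnxt using hex
  let p : (k : ℕ) → {p : (V → Fin (2 ^ (4 * 4 ^ k))) × (Fin (2 ^ (4 * 4 ^ k)) → ℝ) //
      (∀ a, 0 ≤ p.2 a) ∧ ∀ x ∈ T, ∀ y ∈ T, p.1 x = p.1 y → d x y ≤ p.2 (p.1 x)} := fun k =>
    Nat.rec ⟨(fun _ => ⟨0, by positivity⟩, fun _ => Δ), fun _ => hΔ, fun x hx y hy _ => hd x hx y hy⟩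
      (fun k p => nxt k p) k
  exact ⟨fun k => (p k).1.1, fun k => π k (p k), fun k => (p k).1.2, fun _ _ => rfl, fun _ => rfl,
    fun k => (p k).2.1, fun k => hπ k (p k), fun k => (p k).2.2, fun k => hnxt k (p k)⟩

/-- Euclidean distance of two vectors of reals. -/
noncomputable def vecDist {m : ℕ} (a b : Fin m → ℝ) : ℝ := Real.sqrt (∑ j, (a j - b j) ^ 2)

theorem vecDist_eq_dist {m : ℕ} (a b : Fin m → ℝ) :
    vecDist a b = dist (WithLp.toLp 2 a) (WithLp.toLp 2 b) := by
  rw [EuclideanSpace.dist_eq, vecDist]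
  simp [Real.dist_eq]

theorem vecDist_nonneg {m : ℕ} (a b : Fin m → ℝ) : 0 ≤ vecDist a b := Real.sqrt_nonneg _

theorem vecDist_comm {m : ℕ} (a b : Fin m → ℝ) : vecDist a b = vecDist b a := by
  rw [vecDist_eq_dist, vecDist_eq_dist, dist_comm]

theorem vecDist_self {m : ℕ} (a : Fin m → ℝ) : vecDist a a = 0 := by
  rw [vecDist_eq_dist, dist_self]

theorem vecDist_triangle {m : ℕ} (a b c : Fin m → ℝ) :
    vecDist a c ≤ vecDist a b + vecDist b c := by
  simp only [vecDist_eq_dist]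
  exact dist_triangle _ _ _

/-- The generic chaining bound for Rademacher processes. -/
theorem exists_bound_of_label_sequence {V : Type*} {m K : ℕ} (T : Set V) (f : V → Fin m → ℝ)
    {x₀ : V} (hx₀ : x₀ ∈ T) (hf : f x₀ = 0) (hm : m ≤ 4 ^ K)
    (ℓ : (k : ℕ) → V → Fin (2 ^ (4 * 4 ^ k)))
    (π : (k : ℕ) → Fin (2 ^ (4 * 4 ^ (k + 1))) → Fin (2 ^ (4 * 4 ^ k)))
    (δ : (k : ℕ) → Fin (2 ^ (4 * 4 ^ k)) → ℝ)
    (hℓ0 : ∀ x y, ℓ 0 x = ℓ 0 y) (hδ0 : ∀ k a, 0 ≤ δ k a)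
    (hπ : ∀ k, ∀ x ∈ T, π k (ℓ (k + 1) x) = ℓ k x)
    (hδ : ∀ k, ∀ x ∈ T, ∀ y ∈ T, ℓ k x = ℓ k y → vecDist (f x) (f y) ≤ δ k (ℓ k x)) {G : ℝ}
    (hG : ∀ x ∈ T, ∑ k ∈ Finset.range (K + 1), 2 ^ k * δ k (ℓ k x) ≤ G) :
    ∃ U : (Fin m → Bool) → ℝ, signAvg U ≤ 55 * G ∧
      ∀ σ, ∀ x ∈ T, |signSum σ (f x)| ≤ U σ := by
  classical
  have hG0 : 0 ≤ G := le_trans (Finset.sum_nonneg fun k _ =>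
    mul_nonneg (by positivity) (hδ0 k _)) (hG x₀ hx₀)
  have hrep : ∀ (k : ℕ) (a : Fin (2 ^ (4 * 4 ^ k))), ∃ y ∈ T, (a = ℓ k x₀ → y = x₀) ∧
      ∀ x ∈ T, ℓ k x = a → ℓ k y = a := by
    intro k a
    by_cases h0 : a = ℓ k x₀
    · exact ⟨x₀, hx₀, fun _ => rfl, fun _ _ _ => h0.symm⟩
    · by_cases h1 : ∃ x ∈ T, ℓ k x = a
      · obtain ⟨x, hx, hxa⟩ := h1
        exact ⟨x, hx, fun h => absurd h h0, fun _ _ _ => hxa⟩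
      · exact ⟨x₀, hx₀, fun _ => rfl, fun x hx hxa => absurd ⟨x, hx, hxa⟩ h1⟩
  choose rep hrepT hrep0 hrepℓ using hrep
  set g : (k : ℕ) → Fin (2 ^ (4 * 4 ^ (k + 1))) → Fin m → ℝ := fun k a =>
    f (rep (k + 1) a) - f (rep k (π k a)) with hg
  obtain ⟨U, hU0, hUavg, hU⟩ := exists_multilevel_bound (m := m) 16 K
    (fun k => 2 ^ (4 * 4 ^ (k + 1))) (fun k => by
      refine Nat.pow_le_pow_right (by norm_num) ?_
      rw [pow_succ]
      omega) g
  refine ⟨fun σ => G * (U σ + 1), ?_, ?_⟩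
  · rw [signAvg_const_mul, signAvg_add U (fun _ => 1), signAvg_const]
    push_cast at hUavg
    nlinarith
  intro σ x hx
  set y : ℕ → V := fun k => rep k (ℓ k x) with hy
  have hyT : ∀ k, y k ∈ T := fun k => hrepT _ _
  have hyℓ : ∀ k, ℓ k (y k) = ℓ k x := fun k => hrepℓ k _ x hx rfl
  have hy0 : y 0 = x₀ := hrep0 0 _ (hℓ0 x x₀)
  have hinc : ∀ k, vecDist (f (y (k + 1))) (f (y k)) ≤ δ k (ℓ k x) := by
    intro k
    have h1 : ℓ k (y (k + 1)) = ℓ k x := by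
      rw [← hπ k _ (hyT (k + 1)), hyℓ (k + 1), hπ k x hx]
    have := hδ k _ (hyT (k + 1)) _ (hyT k) (h1.trans (hyℓ k).symm)
    rwa [h1] at this
  have hincU : ∀ k < K, |signSum σ (f (y (k + 1))) - signSum σ (f (y k))| ≤
      2 ^ k * δ k (ℓ k x) * U σ := by
    intro k hk
    have h1 := hU σ k hk (ℓ (k + 1) x)
    have h2 : g k (ℓ (k + 1) x) = f (y (k + 1)) - f (y k) := by
      simp only [hg, hπ k x hx, hy]
    rw [h2, signSum_sub] at h1
    refine h1.trans ?_
    have h3 := hinc k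
    unfold vecDist at h3
    have h4 := hU0 σ
    simp only [Pi.sub_apply]
    gcongr
  have hlast : |signSum σ (f x) - signSum σ (f (y K))| ≤ 2 ^ K * δ K (ℓ K x) := by
    rw [← signSum_sub]
    refine (abs_signSum_le _ _).trans ?_
    have h1 := hδ K x hx (y K) (hyT K) (hyℓ K).symm
    unfold vecDist at h1
    have h2 : Real.sqrt m ≤ 2 ^ K := by
      rw [Real.sqrt_le_left (by positivity), ← pow_mul, mul_comm, pow_mul]
      exact_mod_cast hm
    simp only [Pi.sub_apply]
    gcongr
  have htel : ∀ n ≤ K, |signSum σ (f (y n))| ≤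
      ∑ k ∈ Finset.range n, 2 ^ k * δ k (ℓ k x) * U σ := by
    intro n
    induction n with
    | zero =>
      intro _
      rw [hy0, hf]
      simp [signSum]
    | succ n ih =>
      intro hn
      rw [Finset.sum_range_succ]
      have h1 := ih (by omega)
      have h2 := hincU n (by omega)
      have h3 := abs_add_le (signSum σ (f (y (n + 1))) - signSum σ (f (y n))) (signSum σ (f (y n)))
      rw [sub_add_cancel] at h3
      linarith
  have h1 := htel K le_rfl
  have h3 := abs_add_le (signSum σ (f x) - signSum σ (f (y K))) (signSum σ (f (y K)))
  rw [sub_add_cancel] at h3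
  rw [← Finset.sum_mul] at h1
  have h4 := hG x hx
  rw [Finset.sum_range_succ] at h4
  have h5 : 0 ≤ ∑ k ∈ Finset.range K, 2 ^ k * δ k (ℓ k x) :=
    Finset.sum_nonneg fun k _ => mul_nonneg (by positivity) (hδ0 k _)
  have h6 : 0 ≤ 2 ^ K * δ K (ℓ K x) := mul_nonneg (by positivity) (hδ0 K _)
  nlinarith [hU0 σ]

/-- The interpolation step: near-minimality of `π x`, `π y` for the functional
`P + t * d x ·` together with uniform convexity bounds `P (π x - π y)`. -/
theorem uniformlyConvex_thin {V : Type*} [AddCommGroup V] [Module ℝ V] {m : ℕ} (P : V → ℝ)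
    (f : V → Fin m → ℝ) {q : ℝ}
    (hUC : ∀ x y, P ((1 / 2 : ℝ) • (x + y)) + (1 / 2) ^ q * P (x - y) ≤ (P x + P y) / 2)
    (hmid : ∀ x y, vecDist (f ((1 / 2 : ℝ) • (x + y))) (f x) ≤ vecDist (f x) (f y))
    (hP0 : ∀ x, 0 ≤ P x)
    {t δ r : ℝ} (ht : 0 ≤ t) {x y u v : V} (hu1 : P u ≤ 1) (hv1 : P v ≤ 1)
    (hu : ∀ z, P z ≤ 1 → P u + t * vecDist (f x) (f u) ≤ P z + t * vecDist (f x) (f z))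
    (hv : ∀ z, P z ≤ 1 → P v + t * vecDist (f y) (f v) ≤ P z + t * vecDist (f y) (f z))
    (hxy : vecDist (f x) (f y) ≤ δ) (hxu : vecDist (f x) (f u) ≤ r)
    (hyv : vecDist (f y) (f v) ≤ r) :
    P (u - v) ≤ 2 ^ q * (t * (δ + 2 * r)) := by
  set w := (1 / 2 : ℝ) • (u + v) with hw
  have h1 := hUC u v
  have hq : (0 : ℝ) < (1 / 2) ^ q := by positivity
  have hw1 : P w ≤ 1 := by nlinarith [hP0 (u - v)]
  have hd1 : vecDist (f u) (f w) ≤ vecDist (f u) (f v) := by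
    rw [vecDist_comm]
    exact hmid u v
  have hd2 : vecDist (f v) (f w) ≤ vecDist (f u) (f v) := by
    rw [vecDist_comm, vecDist_comm (f u), hw, add_comm]
    exact hmid v u
  have huv : vecDist (f u) (f v) ≤ δ + 2 * r := by
    have e1 := vecDist_triangle (f u) (f x) (f v)
    have e2 := vecDist_triangle (f x) (f y) (f v)
    rw [vecDist_comm (f u) (f x)] at e1
    linarith
  have a1 := hu w hw1
  have a2 := hv w hw1
  have b1 := vecDist_triangle (f x) (f u) (f w)
  have b2 := vecDist_triangle (f y) (f v) (f w)
  have c1 : t * vecDist (f x) (f w) ≤ t * (vecDist (f x) (f u) + (δ + 2 * r)) := by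
    gcongr
    linarith
  have c2 : t * vecDist (f y) (f w) ≤ t * (vecDist (f y) (f v) + (δ + 2 * r)) := by
    gcongr
    linarith
  have key : (1 / 2) ^ q * P (u - v) ≤ t * (δ + 2 * r) := by linarith
  have h2 : (2 : ℝ) ^ q * (1 / 2) ^ q = 1 := by
    rw [← Real.mul_rpow (by norm_num) (by norm_num)]
    norm_num
  calc P (u - v) = 2 ^ q * ((1 / 2) ^ q * P (u - v)) := by rw [← mul_assoc, h2, one_mul]
    _ ≤ _ := by gcongr

theorem sum_mul_minimizer_dist_le {V : Type*} {m : ℕ} (P : V → ℝ)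
    (f : V → Fin m → ℝ) (hP0 : ∀ x, 0 ≤ P x) {b : ℝ} (hb : 0 < b) {x : V} (hx : P x ≤ 1)
    (u : ℕ → V) (hu1 : ∀ k, P (u k) ≤ 1)
    (hu : ∀ k, ∀ z, P z ≤ 1 → P (u k) + b * 2 ^ k * vecDist (f x) (f (u k)) ≤
      P z + b * 2 ^ k * vecDist (f x) (f z)) (n : ℕ) :
    ∑ k ∈ Finset.range (n + 1), 2 ^ k * vecDist (f x) (f (u k)) ≤ 2 / b := by
  have key : ∀ n, b / 2 * ∑ k ∈ Finset.range (n + 1), 2 ^ k * vecDist (f x) (f (u k)) ≤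
      P (u n) + b * 2 ^ n * vecDist (f x) (f (u n)) := by
    intro n
    induction n with
    | zero =>
      have := hP0 (u 0)
      have h2 := vecDist_nonneg (f x) (f (u 0))
      simp only [zero_add, Finset.range_one, Finset.sum_singleton, pow_zero]
      nlinarith
    | succ n ih =>
      rw [Finset.sum_range_succ]
      have h1 := hu n (u (n + 1)) (hu1 _)
      have h2 : (2 : ℝ) ^ (n + 1) = 2 * 2 ^ n := by ring
      rw [h2]
      linarith
  have h1 := key n
  have h2 := hu n x hx
  rw [vecDist_self, mul_zero, add_zero] at h2
  rw [le_div_iff₀ hb]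
  linarith

theorem rpow_mul_rpow_le_add {x y w : ℝ} (hx : 0 ≤ x) (hy : 0 ≤ y) (hw0 : 0 ≤ w) (hw1 : w ≤ 1) :
    x ^ w * y ^ (1 - w) ≤ x + y := by
  have h := Real.geom_mean_le_arith_mean2_weighted hw0 (sub_nonneg.2 hw1) hx hy (by ring)
  nlinarith

/-- Numerical part of the covering step. -/
theorem interpolation_numeric {q L c b E : ℝ} (k : ℕ) (hq : 2 ≤ q) (hL : 1 ≤ L) (hc : 1 ≤ c)
    (hb : b = (1 / (16 * c)) ^ q * L ^ (-(1 - 1 / q))) (hE : 0 ≤ E) :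
    c ^ q / 2 ^ k * (2 * (b * 2 ^ k * E) ^ (1 / q) +
      Real.sqrt L * (2 * (b * 2 ^ k * E) ^ (1 / q)) ^ q) ≤
      E / 8 + 16 * (c ^ 2) ^ q / 2 ^ k * L ^ (-(1 / q)) := by
  have hL0 : 0 < L := by linarith
  have hc0 : 0 < c := by linarith
  have hq0 : 0 < q := by linarith
  set w := 1 / q with hw
  have hw0 : 0 < w := by positivity
  have hw2 : w ≤ 1 / 2 := by rw [hw]; gcongr
  have hwq : w * q = 1 := by rw [hw]; field_simp
  set K : ℝ := 2 ^ k with hK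
  have hK0 : 0 < K := by positivity
  set β := 1 / (16 * c) with hβ
  have hβ0 : 0 < β := by positivity
  have hb0 : 0 < b := by rw [hb]; positivity
  set Z := b * K * E with hZ
  have hZ0 : 0 ≤ Z := by positivity
  have hD : (2 * Z ^ w) ^ q = 2 ^ q * Z := by
    rw [Real.mul_rpow (by norm_num) (by positivity), ← Real.rpow_mul hZ0, hwq, Real.rpow_one]
  have hcb : 2 * c * β = 1 / 8 := by rw [hβ]; field_simp; norm_num
  have hsecond : c ^ q / K * (Real.sqrt L * (2 ^ q * Z)) ≤ E / 64 := by
    have e1 : c ^ q / K * (Real.sqrt L * (2 ^ q * Z)) =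
        (2 * c * β) ^ q * (Real.sqrt L * L ^ (-(1 - w))) * E := by
      rw [hZ, hb, Real.mul_rpow (by positivity) hβ0.le, Real.mul_rpow (by norm_num) hc0.le]
      field_simp
    have e2 : (2 * c * β) ^ q ≤ 1 / 64 := by
      rw [hcb]
      calc ((1 : ℝ) / 8) ^ q ≤ (1 / 8) ^ (2 : ℝ) :=
            Real.rpow_le_rpow_of_exponent_ge (by norm_num) (by norm_num) hq
        _ = 1 / 64 := by norm_num
    have e3 : Real.sqrt L * L ^ (-(1 - w)) ≤ 1 := by
      rw [Real.sqrt_eq_rpow, ← Real.rpow_add hL0]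
      exact Real.rpow_le_one_of_one_le_of_nonpos hL (by linarith)
    rw [e1]
    calc (2 * c * β) ^ q * (Real.sqrt L * L ^ (-(1 - w))) * E ≤ 1 / 64 * 1 * E := by gcongr
      _ = _ := by ring
  have hfirst : c ^ q / K * (2 * Z ^ w) ≤ E / 16 + 16 * (c ^ 2) ^ q / K * L ^ (-w) := by
    set Y := 16 * (c ^ 2) ^ q / K * L ^ (-w) with hY
    have hY0 : 0 < Y := by positivity
    refine le_trans ?_ (rpow_mul_rpow_le_add (x := E / 16) (y := Y) (w := w) (by positivity) hY0.le
      hw0.le (by linarith))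
    have f1 : Z ^ w = β * L ^ (-(1 - w) * w) * K ^ w * E ^ w := by
      rw [hZ, hb, Real.mul_rpow (by positivity) hE, Real.mul_rpow (by positivity) hK0.le,
        Real.mul_rpow (by positivity) (by positivity), ← Real.rpow_mul hβ0.le, mul_comm q w, hwq,
        Real.rpow_one, ← Real.rpow_mul hL0.le]
    have f2 : Y ^ (1 - w) = 16 ^ (1 - w) * c ^ (2 * (q - 1)) * (K ^ (1 - w))⁻¹ *
        L ^ (-(1 - w) * w) := by
      have g1 : ((c ^ 2) ^ q) ^ (1 - w) = c ^ (2 * (q - 1)) := by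
        rw [← Real.rpow_natCast c 2, ← Real.rpow_mul hc0.le, ← Real.rpow_mul hc0.le]
        congr 1
        push_cast
        linear_combination (-2) * hwq
      rw [hY, Real.mul_rpow (by positivity) (by positivity), div_eq_mul_inv,
        Real.mul_rpow (by positivity) (by positivity), Real.mul_rpow (by positivity) (by positivity),
        ← Real.rpow_mul hL0.le, Real.inv_rpow hK0.le, g1]
      ring_nf
    have f3 : (E / 16) ^ w = E ^ w * (16 ^ w)⁻¹ := by
      rw [Real.div_rpow hE (by norm_num), div_eq_mul_inv]
    have f4 : K⁻¹ * K ^ w = (K ^ (1 - w))⁻¹ := by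
      rw [Real.rpow_sub hK0, Real.rpow_one]
      field_simp
    have f5 : (16 : ℝ) ^ (1 - w) * (16 ^ w)⁻¹ = 16 ^ (1 - 2 * w) := by
      rw [← Real.rpow_neg (by norm_num), ← Real.rpow_add (by norm_num)]
      ring_nf
    have f6 : 2 * c ^ q * β ≤ 16 ^ (1 - 2 * w) * c ^ (2 * (q - 1)) := by
      have i1 : (1 : ℝ) ≤ 16 ^ (1 - 2 * w) := Real.one_le_rpow (by norm_num) (by linarith)
      have i2 : c ^ q ≤ c ^ (2 * (q - 1)) := Real.rpow_le_rpow_of_exponent_le hc (by linarith)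
      have i3 : 2 * β ≤ 1 := by nlinarith
      have i4 : 0 < c ^ q := by positivity
      calc 2 * c ^ q * β = (2 * β) * c ^ q := by ring
        _ ≤ 1 * c ^ q := by gcongr
        _ ≤ 16 ^ (1 - 2 * w) * c ^ (2 * (q - 1)) := by gcongr
    calc c ^ q / K * (2 * Z ^ w)
        = (2 * c ^ q * β) * (L ^ (-(1 - w) * w) * (K⁻¹ * K ^ w) * E ^ w) := by
          rw [f1]; ring
      _ ≤ (16 ^ (1 - 2 * w) * c ^ (2 * (q - 1))) * (L ^ (-(1 - w) * w) * (K⁻¹ * K ^ w) * E ^ w) := by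
          gcongr
      _ = _ := by
          rw [f2, f3, f4, ← f5]; ring
  rw [hD]
  have : c ^ q / K * (2 * Z ^ w + Real.sqrt L * (2 ^ q * Z)) =
      c ^ q / K * (2 * Z ^ w) + c ^ q / K * (Real.sqrt L * (2 ^ q * Z)) := by ring
  rw [this]
  linarith

/-- Bound for the supremum of a Rademacher process over the unit ball of a uniformly convex
functional all of whose small balls admit good coverings. -/
theorem exists_bound_of_uniformlyConvex {V : Type*} [AddCommGroup V] [Module ℝ V] {m K : ℕ}
    (P : V → ℝ) (f g : V → Fin m → ℝ) {q L c : ℝ} (hq : 2 ≤ q) (hL : 1 ≤ L) (hc : 1 ≤ c)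
    (hP0 : ∀ x, 0 ≤ P x) (hPz : P 0 = 0) (hg0 : g 0 = 0)
    (hgf : ∀ x y, vecDist (g x) (g y) ≤ vecDist (f x) (f y))
    (hUC : ∀ x y, P ((1 / 2 : ℝ) • (x + y)) + (1 / 2) ^ q * P (x - y) ≤ (P x + P y) / 2)
    (hmid : ∀ x y, vecDist (f ((1 / 2 : ℝ) • (x + y))) (f x) ≤ vecDist (f x) (f y))
    (hmin : ∀ x, P x ≤ 1 → ∀ t, 0 ≤ t → ∃ y, P y ≤ 1 ∧ ∀ z, P z ≤ 1 →
      P y + t * vecDist (f x) (f y) ≤ P z + t * vecDist (f x) (f z))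
    (hdiam : ∀ x, P x ≤ 1 → ∀ y, P y ≤ 1 → vecDist (f x) (f y) ≤ c ^ q)
    (hLC : ∀ z₀, P z₀ ≤ 1 → ∀ D, 0 ≤ D → ∀ k : ℕ, ∃ lab : V → Fin (2 ^ (2 * 4 ^ k)),
      ∀ x y, P x ≤ 1 → P y ≤ 1 → P (x - z₀) ≤ D ^ q → P (y - z₀) ≤ D ^ q → lab x = lab y →
        vecDist (f x) (f y) ≤ c ^ q / 2 ^ k * (D + Real.sqrt L * D ^ q))
    (hm : m ≤ 4 ^ K) (hK : (K : ℝ) ≤ 3 * L) :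
    ∃ U : (Fin m → Bool) → ℝ, signAvg U ≤ (1600 * c ^ 2) ^ q * L ^ (1 - 1 / q) ∧
      ∀ σ x, P x ≤ 1 → |signSum σ (g x)| ≤ U σ := by
  have hL0 : 0 < L := by linarith
  have hc0 : 0 < c := by linarith
  have hq0 : 0 < q := by linarith
  obtain ⟨b, hb⟩ : ∃ b, b = (1 / (16 * c)) ^ q * L ^ (-(1 - 1 / q)) := ⟨_, rfl⟩
  have hb0 : 0 < b := by rw [hb]; positivity
  have hmin' : ∀ (k : ℕ) (x : V), ∃ y, P x ≤ 1 → P y ≤ 1 ∧ ∀ z, P z ≤ 1 →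
      P y + b * 2 ^ k * vecDist (f x) (f y) ≤ P z + b * 2 ^ k * vecDist (f x) (f z) := by
    intro k x
    by_cases hx : P x ≤ 1
    · obtain ⟨y, h1, h2⟩ := hmin x hx (b * 2 ^ k) (by positivity)
      exact ⟨y, fun _ => ⟨h1, h2⟩⟩
    · exact ⟨x, fun h => absurd h hx⟩
  choose u hu using hmin'
  set s : ℕ → V → ℝ := fun k x => vecDist (f x) (f (u k x)) with hs
  set τ : ℕ → ℝ := fun k => 16 * (c ^ 2) ^ q / 2 ^ k * L ^ (-(1 / q)) with hτ
  have hτ0 : ∀ k, 0 ≤ τ k := fun k => by rw [hτ]; positivity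
  obtain ⟨ℓ, π, δ, hℓ0, hδΔ, hδ0, hπ, hδ, hrec⟩ := exists_label_sequence {x | P x ≤ 1}
    (fun x y => vecDist (f x) (f y)) s (fun k => 1 / (b * 2 ^ k)) τ (Δ := c ^ q) (by positivity)
    (fun x hx y hy => hdiam x hx y hy) (fun k => by positivity) hτ0
    (fun k x _ => vecDist_nonneg _ _)
    (fun k x hx => by
      have h1 := (hu k x hx).2 x hx
      have hx' : P x ≤ 1 := hx
      rw [vecDist_self, mul_zero, add_zero] at h1
      rw [le_div_iff₀ (by positivity)]
      have := hP0 (u k x)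
      rw [hs]
      simp only
      linarith)
    (by
      intro k A δ r hA hδ hr hAd hAs
      by_cases hne : A.Nonempty
      · obtain ⟨x₀, hx₀⟩ := hne
        set E := δ + 2 * r with hE
        have hE0 : 0 ≤ E := by positivity
        obtain ⟨lab, hlab⟩ := hLC (u k x₀) (hu k x₀ (hA hx₀)).1
          (2 * (b * 2 ^ k * E) ^ (1 / q)) (by positivity) k
        have hD : (2 * (b * 2 ^ k * E) ^ (1 / q)) ^ q = 2 ^ q * (b * 2 ^ k * E) := by
          rw [Real.mul_rpow (by norm_num) (by positivity), ← Real.rpow_mul (by positivity)]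
          rw [one_div_mul_cancel hq0.ne', Real.rpow_one]
        have hthin : ∀ x ∈ A, P (u k x - u k x₀) ≤ (2 * (b * 2 ^ k * E) ^ (1 / q)) ^ q := by
          intro x hx
          rw [hD]
          exact uniformlyConvex_thin P f hUC hmid hP0 (by positivity) (hu k x (hA hx)).1
            (hu k x₀ (hA hx₀)).1 (hu k x (hA hx)).2 (hu k x₀ (hA hx₀)).2 (hAd x hx x₀ hx₀)
            (hAs x hx) (hAs x₀ hx₀)
        refine ⟨fun x => lab (u k x), fun x hx y hy hxy => ?_⟩
        have h1 := hlab _ _ (hu k x (hA hx)).1 (hu k y (hA hy)).1 (hthin x hx) (hthin y hy) hxy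
        have h2 := interpolation_numeric k hq hL hc hb hE0
        have h3 := hAs x hx
        have h4 := hAs y hy
        simp only [hs] at h3 h4
        have e1 := vecDist_triangle (f x) (f (u k x)) (f y)
        have e2 := vecDist_triangle (f (u k x)) (f (u k y)) (f y)
        rw [vecDist_comm (f (u k y)) (f y)] at e2
        simp only [hτ]
        linarith
      · exact ⟨fun _ => ⟨0, by positivity⟩, fun x hx => absurd ⟨x, hx⟩ hne⟩)
  set a : V → ℕ → ℝ := fun x k => 2 ^ k * δ k (ℓ k x) with ha
  set H : ℝ := 12 * (L ^ (1 - 1 / q) * (16 * c ^ 2) ^ q) with hH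
  have hbinv : 1 / b ≤ L ^ (1 - 1 / q) * (16 * c ^ 2) ^ q := by
    have : 1 / b = L ^ (1 - 1 / q) * (16 * c) ^ q := by
      rw [hb, one_div (16 * c), Real.inv_rpow (by positivity), Real.rpow_neg hL0.le]
      field_simp
    rw [this]
    gcongr
    nlinarith
  have hsum : ∀ x, P x ≤ 1 → ∑ k ∈ Finset.range (K + 1), a x k ≤
      180 * (L ^ (1 - 1 / q) * (16 * c ^ 2) ^ q) := by
    intro x hx
    have hstep : ∀ k, a x (k + 1) ≤ a x k / 4 + 6 * (2 ^ k * s k x) + 6 / b * (1 / 2) ^ k +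
        32 * (c ^ 2) ^ q * L ^ (-(1 / q)) := by
      intro k
      have h1 := hrec k x hx
      have h2 : a x (k + 1) ≤ 2 ^ (k + 1) *
          (δ k (ℓ k x) / 8 + 3 * (s k x + 1 / (b * 2 ^ k) / 2 ^ k) + τ k) := by
        simp only [ha]
        gcongr
      refine h2.trans (le_of_eq ?_)
      simp only [ha, hτ]
      have : (2 : ℝ) ^ (k + 1) = 2 * 2 ^ k := by ring
      rw [this, one_div_pow]
      field_simp
      ring
    have hpart : ∀ n, ∑ k ∈ Finset.range (n + 1), a x k ≤ a x 0 +
        (∑ k ∈ Finset.range n, a x k) / 4 + 6 * ∑ k ∈ Finset.range n, 2 ^ k * s k x +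
        6 / b * ∑ k ∈ Finset.range n, (1 / 2) ^ k +
        n * (32 * (c ^ 2) ^ q * L ^ (-(1 / q))) := by
      intro n
      induction n with
      | zero => simp
      | succ n ih =>
        rw [Finset.sum_range_succ, Finset.sum_range_succ (fun k => a x k) n,
          Finset.sum_range_succ (fun k => 2 ^ k * s k x) n,
          Finset.sum_range_succ (fun k => (1 / 2 : ℝ) ^ k) n]
        rw [Finset.sum_range_succ (fun k => a x k) n] at ih
        have := hstep n
        push_cast
        linarith
    have h0 := hpart K
    have ha0 : ∀ k, 0 ≤ a x k := fun k => mul_nonneg (by positivity) (hδ0 k _)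
    have h1 : ∑ k ∈ Finset.range K, 2 ^ k * s k x ≤ 2 / b := by
      refine le_trans ?_ (sum_mul_minimizer_dist_le P f hP0 hb0 hx (fun k => u k x)
        (fun k => (hu k x hx).1) (fun k => (hu k x hx).2) K)
      rw [Finset.sum_range_succ]
      have : 0 ≤ 2 ^ K * vecDist (f x) (f (u K x)) := mul_nonneg (by positivity) (vecDist_nonneg _ _)
      linarith
    have h2 : ∑ k ∈ Finset.range K, (1 / 2 : ℝ) ^ k ≤ 2 := by
      rw [geom_sum_eq (by norm_num), div_le_iff_of_neg (by norm_num)]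
      have : (0 : ℝ) ≤ (1 / 2) ^ K := by positivity
      linarith
    have h3 : a x 0 = c ^ q := by simp [ha, hδΔ]
    have h4 : (K : ℝ) * (32 * (c ^ 2) ^ q * L ^ (-(1 / q))) ≤
        96 * (L ^ (1 - 1 / q) * (16 * c ^ 2) ^ q) := by
      calc (K : ℝ) * (32 * (c ^ 2) ^ q * L ^ (-(1 / q)))
          ≤ 3 * L * (32 * (16 * c ^ 2) ^ q * L ^ (-(1 / q))) := by
            gcongr
            nlinarith
        _ = _ := by
            rw [sub_eq_add_neg, Real.rpow_add hL0, Real.rpow_one]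
            ring
    have h5 : c ^ q ≤ L ^ (1 - 1 / q) * (16 * c ^ 2) ^ q := by
      have i1 : 1 ≤ L ^ (1 - 1 / q) := Real.one_le_rpow hL (by
        rw [sub_nonneg, div_le_one hq0]; linarith)
      have i2 : c ^ q ≤ (16 * c ^ 2) ^ q := by
        gcongr
        nlinarith
      nlinarith [show 0 ≤ (16 * c ^ 2) ^ q by positivity]
    have h6 : (∑ k ∈ Finset.range K, a x k) ≤ ∑ k ∈ Finset.range (K + 1), a x k := by
      rw [Finset.sum_range_succ]
      linarith [ha0 K]
    have h7 : 6 / b * ∑ k ∈ Finset.range K, (1 / 2 : ℝ) ^ k ≤ 12 * (1 / b) := by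
      calc _ ≤ 6 / b * 2 := by gcongr
        _ = _ := by ring
    have h8 : 2 / b = 2 * (1 / b) := by ring
    set S := ∑ k ∈ Finset.range (K + 1), a x k
    set W := L ^ (1 - 1 / q) * (16 * c ^ 2) ^ q
    have h9 : 0 ≤ W := by positivity
    linarith
  obtain ⟨U, hU1, hU2⟩ := exists_bound_of_label_sequence {x | P x ≤ 1} g (x₀ := 0)
    (by simp [hPz]) hg0 hm ℓ π δ hℓ0 hδ0 hπ
    (fun k x hx y hy h => (hgf x y).trans (hδ k x hx y hy h)) hsum
  refine ⟨U, hU1.trans ?_, fun σ x hx => hU2 σ x hx⟩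
  have h1 : (1600 * c ^ 2) ^ q = 100 ^ q * (16 * c ^ 2) ^ q := by
    rw [← Real.mul_rpow (by norm_num) (by positivity)]
    ring_nf
  have h2 : (10000 : ℝ) ≤ 100 ^ q := by
    calc (10000 : ℝ) = 100 ^ (2 : ℝ) := by norm_num
      _ ≤ _ := Real.rpow_le_rpow_of_exponent_le (by norm_num) hq
  rw [h1]
  have h3 : 0 ≤ L ^ (1 - 1 / q) * (16 * c ^ 2) ^ q := by positivity
  nlinarith

/-- The odd power function `s |s| ^ (q - 1)`. -/
noncomputable def oddPow (q s : ℝ) : ℝ := s * |s| ^ (q - 1)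

theorem abs_mul_abs_rpow_sub_one {q : ℝ} (hq : 0 < q) (s : ℝ) : |s| * |s| ^ (q - 1) = |s| ^ q := by
  rcases eq_or_ne s 0 with rfl | hs
  · simp [Real.zero_rpow hq.ne']
  · have : 0 < |s| := abs_pos.2 hs
    rw [Real.rpow_sub_one this.ne']
    field_simp

theorem abs_oddPow {q : ℝ} (hq : 0 < q) (s : ℝ) : |oddPow q s| = |s| ^ q := by
  rw [oddPow, abs_mul, abs_of_nonneg (Real.rpow_nonneg (abs_nonneg s) _),
    abs_mul_abs_rpow_sub_one hq]

theorem oddPow_neg (q s : ℝ) : oddPow q (-s) = -oddPow q s := by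
  simp [oddPow]

theorem oddPow_of_nonneg {q s : ℝ} (hq : 0 < q) (hs : 0 ≤ s) : oddPow q s = s ^ q := by
  have := abs_mul_abs_rpow_sub_one hq s
  rw [abs_of_nonneg hs] at this
  rw [oddPow, abs_of_nonneg hs, this]

theorem oddPow_monotone {q : ℝ} (hq : 0 < q) : Monotone (oddPow q) := by
  intro s t hst
  rcases le_total 0 s with hs | hs
  · rw [oddPow_of_nonneg hq hs, oddPow_of_nonneg hq (hs.trans hst)]
    gcongr
  · rcases le_total 0 t with ht | ht
    · have h1 : oddPow q s ≤ 0 := mul_nonpos_of_nonpos_of_nonneg hs (by positivity)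
      have h2 : 0 ≤ oddPow q t := mul_nonneg ht (by positivity)
      exact h1.trans h2
    · have h1 : oddPow q (-t) ≤ oddPow q (-s) := by
        rw [oddPow_of_nonneg hq (neg_nonneg.2 ht), oddPow_of_nonneg hq (neg_nonneg.2 hs)]
        gcongr
        exact neg_nonneg.2 ht
      rw [oddPow_neg, oddPow_neg] at h1
      linarith

theorem continuous_oddPow {q : ℝ} (hq : 1 ≤ q) : Continuous (oddPow q) :=
  continuous_id.mul (continuous_abs.rpow_const fun _ => Or.inr (by linarith))

theorem abs_oddPow_midpoint_sub_le {q : ℝ} (hq : 0 < q) (s t : ℝ) :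
    |oddPow q (1 / 2 * (s + t)) - oddPow q s| ≤ |oddPow q s - oddPow q t| := by
  have hmono := oddPow_monotone hq
  rcases le_total s t with h | h
  · have h1 := hmono (show s ≤ 1 / 2 * (s + t) by linarith)
    have h2 := hmono (show 1 / 2 * (s + t) ≤ t by linarith)
    rw [abs_of_nonneg (by linarith), abs_of_nonpos (by linarith)]
    linarith
  · have h1 := hmono (show 1 / 2 * (s + t) ≤ s by linarith)
    have h2 := hmono (show t ≤ 1 / 2 * (s + t) by linarith)
    rw [abs_of_nonpos (by linarith), abs_of_nonneg (by linarith)]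
    linarith

theorem rpow_sub_rpow_le {q u v : ℝ} (hq : 1 ≤ q) (hv : 0 ≤ v) (hvu : v ≤ u) :
    u ^ q - v ^ q ≤ q * (u - v) * u ^ (q - 1) := by
  rcases (hv.trans hvu).eq_or_lt with h0 | hu
  · have : v = u := le_antisymm hvu (by rw [← h0]; exact hv)
    simp [this]
  · have h1 := one_add_mul_self_le_rpow_one_add (s := v / u - 1)
      (by have := div_nonneg hv hu.le; linarith) hq
    rw [add_sub_cancel, Real.div_rpow hv hu.le, le_div_iff₀ (by positivity)] at h1
    have h2 : u ^ q = u * u ^ (q - 1) := by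
      rw [Real.rpow_sub_one hu.ne']
      field_simp
    have h3 : q * (v / u - 1) * u ^ q = -(q * (u - v) * u ^ (q - 1)) := by
      rw [h2]
      field_simp
      ring
    nlinarith

theorem abs_oddPow_sub_le {q : ℝ} (hq : 1 ≤ q) (s t : ℝ) :
    |oddPow q s - oddPow q t| ≤ q * |s - t| * (|s| ^ (q - 1) + |t| ^ (q - 1)) := by
  have hq0 : 0 < q := by linarith
  have key : ∀ v u : ℝ, 0 ≤ v → v ≤ u →
      oddPow q u - oddPow q v ≤ q * (u - v) * (u ^ (q - 1) + v ^ (q - 1)) := by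
    intro v u hv hvu
    have hu := hv.trans hvu
    rw [oddPow_of_nonneg hq0 hv, oddPow_of_nonneg hq0 hu]
    refine (rpow_sub_rpow_le hq hv hvu).trans ?_
    have : 0 ≤ v ^ (q - 1) := by positivity
    have h2 : 0 ≤ q * (u - v) := mul_nonneg hq0.le (by linarith)
    nlinarith
  have main : ∀ s t : ℝ, t ≤ s →
      oddPow q s - oddPow q t ≤ q * (s - t) * (|s| ^ (q - 1) + |t| ^ (q - 1)) := by
    intro s t hts
    rcases le_total 0 t with ht | ht
    · rw [abs_of_nonneg ht, abs_of_nonneg (ht.trans hts)]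
      exact key t s ht hts
    · rcases le_total 0 s with hs | hs
      · have h1 := abs_mul_abs_rpow_sub_one hq0 s
        have h2 := abs_mul_abs_rpow_sub_one hq0 t
        have e1 : oddPow q s = s * |s| ^ (q - 1) := rfl
        have e2 : oddPow q t = t * |t| ^ (q - 1) := rfl
        rw [e1, e2]
        have p1 : 0 ≤ |s| ^ (q - 1) := by positivity
        have p2 : 0 ≤ |t| ^ (q - 1) := by positivity
        have h3 : 0 ≤ (s - t) * (|s| ^ (q - 1) + |t| ^ (q - 1)) :=
          mul_nonneg (by linarith) (by linarith)
        have h4 : s * |s| ^ (q - 1) - t * |t| ^ (q - 1) ≤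
            (s - t) * (|s| ^ (q - 1) + |t| ^ (q - 1)) := by nlinarith
        nlinarith
      · have h1 := key (-s) (-t) (neg_nonneg.2 hs) (by linarith)
        rw [oddPow_neg, oddPow_neg] at h1
        rw [abs_of_nonpos hs, abs_of_nonpos ht]
        have : -t - -s = s - t := by ring
        rw [this] at h1
        linarith
  rcases le_total t s with h | h
  · rw [abs_of_nonneg (sub_nonneg.2 (oddPow_monotone hq0 h)), abs_of_nonneg (sub_nonneg.2 h)]
    exact main s t h
  · rw [abs_sub_comm, abs_sub_comm s t, add_comm,
      abs_of_nonneg (sub_nonneg.2 (oddPow_monotone hq0 h)), abs_of_nonneg (sub_nonneg.2 h)]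
    exact main t s h

theorem add_rpow_le_two_rpow_mul {r u v : ℝ} (hr : 0 ≤ r) (hu : 0 ≤ u) (hv : 0 ≤ v) :
    (u + v) ^ r ≤ 2 ^ r * (u ^ r + v ^ r) := by
  rcases le_total u v with h | h
  · calc (u + v) ^ r ≤ (2 * v) ^ r := by
          gcongr
          linarith
      _ = 2 ^ r * v ^ r := Real.mul_rpow (by norm_num) hv
      _ ≤ _ := by
          gcongr
          have : 0 ≤ u ^ r := by positivity
          linarith
  · calc (u + v) ^ r ≤ (2 * u) ^ r := by
          gcongr
          linarith
      _ = 2 ^ r * u ^ r := Real.mul_rpow (by norm_num) hu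
      _ ≤ _ := by
          gcongr
          have : 0 ≤ v ^ r := by positivity
          linarith

theorem abs_rpow_two_mul_sub_two {q : ℝ} (s : ℝ) : (|s| ^ (q - 1)) ^ 2 = |s| ^ (2 * q - 2) := by
  rw [← Real.rpow_natCast, ← Real.rpow_mul (abs_nonneg s)]
  congr 1
  push_cast
  ring

theorem abs_rpow_two_mul_sub_two_le {q a s : ℝ} (hq : 2 ≤ q) (ha : |s| ≤ a) :
    |s| ^ (2 * q - 2) ≤ a ^ (q - 2) * |s| ^ q := by
  rcases eq_or_ne s 0 with rfl | hs
  · rw [abs_zero, Real.zero_rpow (by linarith), Real.zero_rpow (by linarith), mul_zero]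
  · have h : |s| ^ (2 * q - 2) = |s| ^ (q - 2) * |s| ^ q := by
      rw [← Real.rpow_add (abs_pos.2 hs)]
      ring_nf
    rw [h]
    have : 0 ≤ q - 2 := by linarith
    gcongr

/-- Increment bound around a center `z`. -/
theorem sq_oddPow_sub_le {q : ℝ} (hq : 2 ≤ q) (s t z : ℝ) :
    (oddPow q s - oddPow q t) ^ 2 ≤ 3 / 4 * q ^ 2 * 4 ^ q * (s - t) ^ 2 *
      (4 * |z| ^ (2 * q - 2) + |s - z| ^ (2 * q - 2) + |t - z| ^ (2 * q - 2)) := by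
  have h1 := abs_oddPow_sub_le (show 1 ≤ q by linarith) s t
  have hs : |s| ^ (q - 1) ≤ 2 ^ (q - 1) * (|z| ^ (q - 1) + |s - z| ^ (q - 1)) := by
    refine le_trans ?_ (add_rpow_le_two_rpow_mul (by linarith) (abs_nonneg _) (abs_nonneg _))
    have : |s| ≤ |z| + |s - z| := by
      have := abs_add_le z (s - z)
      rwa [add_sub_cancel] at this
    have : 0 ≤ q - 1 := by linarith
    gcongr
  have ht : |t| ^ (q - 1) ≤ 2 ^ (q - 1) * (|z| ^ (q - 1) + |t - z| ^ (q - 1)) := by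
    refine le_trans ?_ (add_rpow_le_two_rpow_mul (by linarith) (abs_nonneg _) (abs_nonneg _))
    have : |t| ≤ |z| + |t - z| := by
      have := abs_add_le z (t - z)
      rwa [add_sub_cancel] at this
    have : 0 ≤ q - 1 := by linarith
    gcongr
  rw [← abs_rpow_two_mul_sub_two z, ← abs_rpow_two_mul_sub_two (s - z),
    ← abs_rpow_two_mul_sub_two (t - z)]
  set a := |z| ^ (q - 1)
  set b := |s - z| ^ (q - 1)
  set c := |t - z| ^ (q - 1)
  have h2 : |oddPow q s - oddPow q t| ≤ q * |s - t| * (2 ^ (q - 1) * (2 * a + b + c)) := by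
    refine h1.trans ?_
    gcongr
    linarith
  have h4 : (4 : ℝ) ^ q = (2 ^ q) ^ 2 := by
    rw [← Real.rpow_natCast, ← Real.rpow_mul (by norm_num), mul_comm, Real.rpow_mul (by norm_num)]
    norm_num
  have h5 : (2 : ℝ) ^ (q - 1) = 2 ^ q / 2 := Real.rpow_sub_one (by norm_num) q
  calc (oddPow q s - oddPow q t) ^ 2 = |oddPow q s - oddPow q t| ^ 2 := (sq_abs _).symm
    _ ≤ (q * |s - t| * (2 ^ (q - 1) * (2 * a + b + c))) ^ 2 := by gcongr
    _ = q ^ 2 * 4 ^ q / 4 * (s - t) ^ 2 * (2 * a + b + c) ^ 2 := by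
        rw [h5, h4, ← sq_abs (s - t)]
        ring
    _ ≤ q ^ 2 * 4 ^ q / 4 * (s - t) ^ 2 * (3 * (4 * a ^ 2 + b ^ 2 + c ^ 2)) := by
        gcongr
        nlinarith [sq_nonneg (2 * a - b), sq_nonneg (2 * a - c), sq_nonneg (b - c)]
    _ = _ := by ring

section Local

variable {V : Type*} [NormedAddCommGroup V] [InnerProductSpace ℝ V] [FiniteDimensional ℝ V]

/-- Covering of a ball centered at `z` by few sets that are simultaneously small for a weighted
quadratic form and for finitely many linear functionals. -/
theorem exists_label_ball {m : ℕ} (X : Fin m → V) (hX : ∀ j, ‖X j‖ = 1)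
    (W : Fin m → ℝ) (hW : ∀ j, 0 ≤ W j) {R₁ R₂ r : ℝ} (hR₁ : 0 < R₁) (hR₂ : 0 < R₂) (hr : 0 < r)
    (h₁ : 6 * ∑ j, W j ≤ R₁ ^ 2) (h₂ : 8 * m * Real.exp (-(R₂ ^ 2 / 2)) ≤ 1) (z : V) (k : ℕ) :
    ∃ lab : V → Fin (2 ^ (2 * 4 ^ k)), ∀ x y, ‖x - z‖ ≤ r → ‖y - z‖ ≤ r → lab x = lab y →
      ∑ j, W j * inner ℝ (X j) (x - y) ^ 2 ≤ 16 * R₁ ^ 2 * (r / 2 ^ k) ^ 2 ∧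
        ∀ j, |inner ℝ (X j) (x - y)| ≤ 4 * R₂ * (r / 2 ^ k) := by
  classical
  borelize V
  set ρ : ℝ := 2 ^ k with hρ
  have hρ0 : 0 < ρ := by positivity
  set a : ℝ := ρ / r with ha
  have ha0 : 0 < a := by positivity
  let near : V → V → Prop := fun x y =>
    ∑ j, W j * inner ℝ (X j) (a • (x - y)) ^ 2 ≤ 4 * R₁ ^ 2 ∧
      ∀ j, |inner ℝ (X j) (a • (x - y))| ≤ 2 * R₂
  obtain ⟨lab, hlab⟩ := exists_label_of_card_le (M := 2 ^ (2 * 4 ^ k)) (by positivity)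
    {x : V | ‖x - z‖ ≤ r} near
    (fun x => by
      refine ⟨?_, fun j => ?_⟩
      · simp only [sub_self, smul_zero, inner_zero_right]
        simp
        positivity
      · simp [hR₂.le])
    (fun x y hxy => by
      have e : a • (y - x) = -(a • (x - y)) := by rw [← smul_neg, neg_sub]
      refine ⟨?_, fun j => ?_⟩
      · simp only [e, inner_neg_right, neg_sq]
        exact hxy.1
      · simp only [e, inner_neg_right, abs_neg]
        exact hxy.2 j)
    (fun P hP hsep => by
      have hinj : Function.Injective fun x : V => a • (x - z) := fun x y h => by
        have := smul_right_injective V ha0.ne' h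
        simpa using this
      have := card_le_of_separated X hX W hW (ρ := ρ) hR₁ hR₂ h₁ h₂ (P.image fun x => a • (x - z))
        (by
          intro u hu
          obtain ⟨x, hx, rfl⟩ := Finset.mem_image.1 hu
          have h1 : ‖x - z‖ ≤ r := hP x hx
          rw [norm_smul, Real.norm_of_nonneg ha0.le, ha, div_mul_eq_mul_div, div_le_iff₀ hr]
          gcongr)
        (by
          intro u hu u' hu' hne
          obtain ⟨x, hx, rfl⟩ := Finset.mem_image.1 hu
          obtain ⟨x', hx', rfl⟩ := Finset.mem_image.1 hu'
          have h1 := hsep x hx x' hx' (fun h => hne (by rw [h]))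
          have e : a • (x - z) - a • (x' - z) = a • (x - x') := by
            rw [← smul_sub, sub_sub_sub_cancel_right]
          rw [e]
          exact h1)
      rw [Finset.card_image_of_injective _ hinj] at this
      have h4 : ρ ^ 2 = 4 ^ k := by rw [hρ, ← pow_mul, mul_comm, pow_mul]; norm_num
      have hk : (1 : ℝ) ≤ 4 ^ k := one_le_pow₀ (by norm_num)
      have h5 : (2 : ℝ) ≤ Real.exp (7 / 10) := by
        have h6 := Real.log_two_lt_d9
        rw [← Real.log_le_iff_le_exp (by norm_num)]
        linarith
      have h7 : Real.exp (1 / 2) ≤ 2 := by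
        have h6 := Real.log_two_gt_d9
        rw [← Real.le_log_iff_exp_le (by norm_num)]
        linarith
      have h8 : (2 : ℝ) * Real.exp (ρ ^ 2 / 2) ≤ ((2 ^ (2 * 4 ^ k) : ℕ) : ℝ) := by
        rw [h4]
        have : Real.exp (4 ^ k / 2) = Real.exp (1 / 2) ^ (4 ^ k) := by
          rw [← Real.exp_nat_mul]; push_cast; ring_nf
        rw [this]
        push_cast
        have h9 : (1 : ℕ) ≤ 4 ^ k := Nat.one_le_pow _ _ (by norm_num)
        calc (2 : ℝ) * Real.exp (1 / 2) ^ (4 ^ k) ≤ 2 ^ (4 ^ k) * 2 ^ (4 ^ k) := by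
              gcongr
              exact le_self_pow₀ (by norm_num) (by omega)
          _ = _ := by rw [← pow_add]; ring_nf
      exact_mod_cast this.trans h8)
  refine ⟨lab, fun x y hx hy hxy => ?_⟩
  obtain ⟨u, hxu, hyu⟩ := hlab x hx y hy hxy
  have hin : ∀ j, inner ℝ (X j) (x - y) =
      (r / ρ) * (inner ℝ (X j) (a • (x - u)) - inner ℝ (X j) (a • (y - u))) := by
    intro j
    rw [← inner_sub_right, ← smul_sub, sub_sub_sub_cancel_right, real_inner_smul_right, ← mul_assoc,
      ha, div_mul_div_cancel₀ hρ0.ne', div_self hr.ne', one_mul]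
  refine ⟨?_, fun j => ?_⟩
  · calc ∑ j, W j * inner ℝ (X j) (x - y) ^ 2
        ≤ ∑ j, (r / ρ) ^ 2 * (2 * (W j * inner ℝ (X j) (a • (x - u)) ^ 2) +
            2 * (W j * inner ℝ (X j) (a • (y - u)) ^ 2)) := by
          refine Finset.sum_le_sum fun j _ => ?_
          rw [hin j]
          set s := inner ℝ (X j) (a • (x - u))
          set t := inner ℝ (X j) (a • (y - u))
          have : W j * (r / ρ * (s - t)) ^ 2 = (r / ρ) ^ 2 * (W j * (s - t) ^ 2) := by ring
          rw [this]
          gcongr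
          nlinarith [mul_nonneg (hW j) (sq_nonneg (s + t))]
      _ = (r / ρ) ^ 2 * (2 * ∑ j, W j * inner ℝ (X j) (a • (x - u)) ^ 2 +
            2 * ∑ j, W j * inner ℝ (X j) (a • (y - u)) ^ 2) := by
          rw [← Finset.mul_sum, Finset.sum_add_distrib, Finset.mul_sum, Finset.mul_sum]
      _ ≤ (r / ρ) ^ 2 * (2 * (4 * R₁ ^ 2) + 2 * (4 * R₁ ^ 2)) := by
          gcongr
          · exact hxu.1
          · exact hyu.1
      _ = _ := by ring
  · rw [hin j, abs_mul, abs_of_pos (by positivity : 0 < r / ρ)]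
    have := abs_sub (inner ℝ (X j) (a • (x - u))) (inner ℝ (X j) (a • (y - u)))
    have h1 := hxu.2 j
    have h2 := hyu.2 j
    calc r / ρ * |inner ℝ (X j) (a • (x - u)) - inner ℝ (X j) (a • (y - u))|
        ≤ r / ρ * (2 * R₂ + 2 * R₂) := by
          gcongr
          linarith
      _ = _ := by ring

end Local

section Rademacher

variable {V : Type*} [NormedAddCommGroup V] [InnerProductSpace ℝ V] [FiniteDimensional ℝ V]

/-- Covering of small balls of `P` for the distance of the odd powers. -/
theorem exists_label_oddPow {m : ℕ} (X : Fin m → V) (hX : ∀ j, ‖X j‖ = 1) (P : V → ℝ)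
    {q A S L M : ℝ} (hq : 2 ≤ q) (hA : 0 < A) (hS : 0 < S) (hL : 1 ≤ L) (hmL : (m : ℝ) ≤ Real.exp L)
    (hM0 : 0 < M) (hM : M ^ 2 = A ^ q * S)
    (hPA : ∀ y, ‖y‖ ^ q ≤ A ^ q * P y) (hPS : ∀ y, ∑ j, |inner ℝ (X j) y| ^ q ≤ S * P y)
    (z : V) (hz : P z ≤ 1) (D : ℝ) (hD : 0 ≤ D) (k : ℕ) :
    ∃ lab : V → Fin (2 ^ (2 * 4 ^ k)),
      ∀ x y, P x ≤ 1 → P y ≤ 1 → P (x - z) ≤ D ^ q → P (y - z) ≤ D ^ q → lab x = lab y →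
        vecDist (fun j => oddPow q (inner ℝ (X j) x) / M) (fun j => oddPow q (inner ℝ (X j) y) / M) ≤
          17 ^ q / 2 ^ k * (D + Real.sqrt L * D ^ q) := by
  have hq0 : 0 < q := by linarith
  have hball : ∀ D : ℝ, 0 ≤ D → ∀ y, P y ≤ D ^ q → ‖y‖ ≤ A * D := by
    intro D hD y hy
    rw [← Real.rpow_le_rpow_iff (norm_nonneg y) (by positivity) hq0, Real.mul_rpow hA.le hD]
    refine (hPA y).trans ?_
    gcongr
  have hzA : ‖z‖ ≤ A := by
    have := hball 1 zero_le_one z (by rwa [Real.one_rpow])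
    rwa [mul_one] at this
  have hXle : ∀ j y, |inner ℝ (X j) y| ≤ ‖y‖ := by
    intro j y
    have := abs_real_inner_le_norm (X j) y
    rwa [hX j, one_mul] at this
  rcases hD.eq_or_lt with rfl | hDpos
  · refine ⟨fun _ => ⟨0, by positivity⟩, fun x y _ _ hx hy _ => ?_⟩
    have h1 := hball 0 le_rfl _ hx
    have h2 := hball 0 le_rfl _ hy
    rw [mul_zero] at h1 h2
    have h3 : x = z := by simpa [sub_eq_zero] using le_antisymm h1 (norm_nonneg _)
    have h4 : y = z := by simpa [sub_eq_zero] using le_antisymm h2 (norm_nonneg _)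
    rw [h3, h4, vecDist_self]
    positivity
  set W : Fin m → ℝ := fun j => |inner ℝ (X j) z| ^ (2 * q - 2) with hW
  have hW0 : ∀ j, 0 ≤ W j := fun j => Real.rpow_nonneg (abs_nonneg _) _
  have hWsum : ∑ j, W j ≤ A ^ (q - 2) * S := by
    calc ∑ j, W j ≤ ∑ j, A ^ (q - 2) * |inner ℝ (X j) z| ^ q :=
          Finset.sum_le_sum fun j _ =>
            abs_rpow_two_mul_sub_two_le hq ((hXle j z).trans hzA)
      _ = A ^ (q - 2) * ∑ j, |inner ℝ (X j) z| ^ q := by rw [Finset.mul_sum]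
      _ ≤ A ^ (q - 2) * (S * P z) := by gcongr; exact hPS z
      _ ≤ A ^ (q - 2) * (S * 1) := by gcongr
      _ = _ := by rw [mul_one]
  set R₁ : ℝ := Real.sqrt (6 * (A ^ (q - 2) * S)) with hR₁
  have hR₁sq : R₁ ^ 2 = 6 * (A ^ (q - 2) * S) := Real.sq_sqrt (by positivity)
  have hR₁0 : 0 < R₁ := Real.sqrt_pos.2 (by positivity)
  set R₂ : ℝ := 3 * Real.sqrt L with hR₂
  have hsL : Real.sqrt L ^ 2 = L := Real.sq_sqrt (by linarith)
  have hsL0 : 0 < Real.sqrt L := Real.sqrt_pos.2 (by linarith)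
  have h8 : 8 * (m : ℝ) * Real.exp (-(R₂ ^ 2 / 2)) ≤ 1 := by
    have e1 : R₂ ^ 2 / 2 = 9 / 2 * L := by rw [hR₂, mul_pow, hsL]; ring
    have e2 : (8 : ℝ) ≤ Real.exp 3 := by
      have h6 := Real.log_two_lt_d9
      rw [← Real.log_le_iff_le_exp (by norm_num), show (8 : ℝ) = 2 ^ 3 by norm_num, Real.log_pow]
      push_cast
      linarith
    rw [e1]
    calc 8 * (m : ℝ) * Real.exp (-(9 / 2 * L)) ≤ Real.exp 3 * Real.exp L * Real.exp (-(9 / 2 * L)) := by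
          gcongr
      _ = Real.exp (3 + L - 9 / 2 * L) := by rw [← Real.exp_add, ← Real.exp_add]; ring_nf
      _ ≤ 1 := by
          rw [Real.exp_le_one_iff]
          linarith
  set r := A * D with hr
  have hr0 : 0 < r := by positivity
  obtain ⟨lab, hlab⟩ := exists_label_ball X hX W hW0 hR₁0 (by positivity) hr0
    (by rw [hR₁sq]; gcongr) h8 z k
  refine ⟨lab, fun x y _ _ hx hy hxy => ?_⟩
  obtain ⟨hq1, hq2⟩ := hlab x y (hball D hD _ hx) (hball D hD _ hy) hxy
  set ρ : ℝ := 2 ^ k with hρ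
  have hρ0 : 0 < ρ := by positivity
  have hM2 : A ^ (q - 2) * S * A ^ 2 = M ^ 2 := by
    rw [hM, ← Real.rpow_natCast A 2, mul_right_comm, ← Real.rpow_add hA]
    norm_num
  have hrest : ∀ v, P (v - z) ≤ D ^ q →
      ∑ j, inner ℝ (X j) (x - y) ^ 2 * |inner ℝ (X j) v - inner ℝ (X j) z| ^ (2 * q - 2) ≤
        144 * (L * (D ^ q) ^ 2) * M ^ 2 / ρ ^ 2 := by
    intro v hv
    have hvr := hball D hD _ hv
    have t1 : ∀ j, inner ℝ (X j) (x - y) ^ 2 ≤ 144 * L * (r / ρ) ^ 2 := by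
      intro j
      rw [← sq_abs]
      calc |inner ℝ (X j) (x - y)| ^ 2 ≤ (4 * R₂ * (r / ρ)) ^ 2 := by
            have := hq2 j
            gcongr
        _ = _ := by rw [hR₂, mul_pow, mul_pow, mul_pow, hsL]; ring
    calc ∑ j, inner ℝ (X j) (x - y) ^ 2 * |inner ℝ (X j) v - inner ℝ (X j) z| ^ (2 * q - 2)
        ≤ ∑ j, 144 * L * (r / ρ) ^ 2 * (r ^ (q - 2) * |inner ℝ (X j) (v - z)| ^ q) := by
          refine Finset.sum_le_sum fun j _ => ?_
          rw [← inner_sub_right]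
          have h1 := t1 j
          have h2 := abs_rpow_two_mul_sub_two_le hq ((hXle j (v - z)).trans hvr)
          gcongr
      _ = 144 * L * (r / ρ) ^ 2 * (r ^ (q - 2) * ∑ j, |inner ℝ (X j) (v - z)| ^ q) := by
          rw [Finset.mul_sum, Finset.mul_sum]
      _ ≤ 144 * L * (r / ρ) ^ 2 * (r ^ (q - 2) * (S * D ^ q)) := by
          have := hPS (v - z)
          gcongr
          exact this.trans (by gcongr)
      _ = _ := by
          rw [hr, Real.mul_rpow hA.le hD, ← hM2, Real.rpow_sub hDpos, Real.rpow_two]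
          field_simp
  have hsum : ∑ j, (oddPow q (inner ℝ (X j) x) / M - oddPow q (inner ℝ (X j) y) / M) ^ 2 ≤
      (17 ^ q / ρ * (D + Real.sqrt L * D ^ q)) ^ 2 := by
    have e0 : ∀ j, (oddPow q (inner ℝ (X j) x) / M - oddPow q (inner ℝ (X j) y) / M) ^ 2 ≤
        3 / 4 * q ^ 2 * 4 ^ q / M ^ 2 * (4 * (W j * inner ℝ (X j) (x - y) ^ 2) +
        inner ℝ (X j) (x - y) ^ 2 * |inner ℝ (X j) x - inner ℝ (X j) z| ^ (2 * q - 2) +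
        inner ℝ (X j) (x - y) ^ 2 * |inner ℝ (X j) y - inner ℝ (X j) z| ^ (2 * q - 2)) := by
      intro j
      have := sq_oddPow_sub_le hq (inner ℝ (X j) x) (inner ℝ (X j) y) (inner ℝ (X j) z)
      rw [← sub_div, div_pow, inner_sub_right, div_le_iff₀ (by positivity)]
      refine this.trans (le_of_eq ?_)
      simp only [hW]
      field_simp
    have hb1 := hrest x hx
    have hb2 := hrest y hy
    have hb0 : ∑ j, W j * inner ℝ (X j) (x - y) ^ 2 ≤ 96 * D ^ 2 * M ^ 2 / ρ ^ 2 := by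
      refine hq1.trans (le_of_eq ?_)
      rw [hR₁sq, hr, ← hM2]
      field_simp
      ring
    have hnum : 288 * (q ^ 2 * 4 ^ q) ≤ ((17 : ℝ) ^ q) ^ 2 := by
      have n1 : q ≤ 2 ^ q := by
        have := one_add_mul_self_le_rpow_one_add (s := 1) (by norm_num) (show 1 ≤ q by linarith)
        norm_num at this
        linarith
      have n2 : (288 : ℝ) ≤ 17 ^ q := by
        calc (288 : ℝ) ≤ 17 ^ (2 : ℝ) := by norm_num
          _ ≤ _ := Real.rpow_le_rpow_of_exponent_le (by norm_num) hq
      have n3 : ((2 : ℝ) ^ q) ^ 2 * 4 ^ q = 16 ^ q := by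
        rw [sq, ← Real.mul_rpow (by norm_num) (by norm_num), ← Real.mul_rpow (by norm_num) (by norm_num)]
        norm_num
      have n4 : (16 : ℝ) ^ q ≤ 17 ^ q := by gcongr; norm_num
      calc 288 * (q ^ 2 * 4 ^ q) ≤ 17 ^ q * ((2 ^ q) ^ 2 * 4 ^ q) := by gcongr
        _ ≤ 17 ^ q * 17 ^ q := by rw [n3]; gcongr
        _ = _ := by ring
    calc ∑ j, (oddPow q (inner ℝ (X j) x) / M - oddPow q (inner ℝ (X j) y) / M) ^ 2
        ≤ ∑ j, 3 / 4 * q ^ 2 * 4 ^ q / M ^ 2 * (4 * (W j * inner ℝ (X j) (x - y) ^ 2) +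
        inner ℝ (X j) (x - y) ^ 2 * |inner ℝ (X j) x - inner ℝ (X j) z| ^ (2 * q - 2) +
        inner ℝ (X j) (x - y) ^ 2 * |inner ℝ (X j) y - inner ℝ (X j) z| ^ (2 * q - 2)) :=
          Finset.sum_le_sum fun j _ => e0 j
      _ = 3 / 4 * q ^ 2 * 4 ^ q / M ^ 2 * (4 * ∑ j, W j * inner ℝ (X j) (x - y) ^ 2 +
        ∑ j, inner ℝ (X j) (x - y) ^ 2 * |inner ℝ (X j) x - inner ℝ (X j) z| ^ (2 * q - 2) +
        ∑ j, inner ℝ (X j) (x - y) ^ 2 * |inner ℝ (X j) y - inner ℝ (X j) z| ^ (2 * q - 2)) := by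
          rw [← Finset.mul_sum, Finset.sum_add_distrib, Finset.sum_add_distrib, Finset.mul_sum]
      _ ≤ 3 / 4 * q ^ 2 * 4 ^ q / M ^ 2 * (4 * (96 * D ^ 2 * M ^ 2 / ρ ^ 2) +
        144 * (L * (D ^ q) ^ 2) * M ^ 2 / ρ ^ 2 + 144 * (L * (D ^ q) ^ 2) * M ^ 2 / ρ ^ 2) := by
          gcongr
      _ = 288 * (q ^ 2 * 4 ^ q) / ρ ^ 2 * (D ^ 2 + 3 / 4 * L * (D ^ q) ^ 2) := by
          field_simp
          ring
      _ ≤ (17 ^ q) ^ 2 / ρ ^ 2 * (D + Real.sqrt L * D ^ q) ^ 2 := by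
          have hDq : 0 ≤ D ^ q := by positivity
          gcongr
          have e3 : (D + Real.sqrt L * D ^ q) ^ 2 = D ^ 2 + 2 * (D * (Real.sqrt L * D ^ q)) +
            Real.sqrt L ^ 2 * (D ^ q) ^ 2 := by ring
          rw [e3, hsL]
          have e4 : 0 ≤ D * (Real.sqrt L * D ^ q) := by positivity
          have e5 : 0 ≤ L * (D ^ q) ^ 2 := by positivity
          linarith
      _ = _ := by rw [mul_pow, div_pow]
  unfold vecDist
  rw [Real.sqrt_le_left (by positivity)]
  exact hsum

/-- Rademacher averages of `|⟨Xⱼ, y⟩| ^ q` over the unit ball of a uniformly convex functional. -/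
theorem exists_rademacher_bound {m : ℕ} (X : Fin m → V) (hX : ∀ j, ‖X j‖ = 1) (P : V → ℝ)
    {q A S L : ℝ} (hq : 2 ≤ q) (hA : 0 < A) (hS : 0 < S) (hL : 1 ≤ L) (hmL : (m : ℝ) ≤ Real.exp L)
    (hPc : Continuous P) (hP0 : ∀ x, 0 ≤ P x) (hPz : P 0 = 0)
    (hUC : ∀ x y, P ((1 / 2 : ℝ) • (x + y)) + (1 / 2) ^ q * P (x - y) ≤ (P x + P y) / 2)
    (hPA : ∀ y, ‖y‖ ^ q ≤ A ^ q * P y) (hPS : ∀ y, ∑ j, |inner ℝ (X j) y| ^ q ≤ S * P y) :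
    ∃ U : (Fin m → Bool) → ℝ,
      signAvg U ≤ 500000 ^ q * (Real.sqrt (A ^ q) * Real.sqrt S) * L ^ (1 - 1 / q) ∧
      ∀ σ y, P y ≤ 1 → |signSum σ (fun j => |inner ℝ (X j) y| ^ q)| ≤ U σ := by
  have hq0 : 0 < q := by linarith
  set M := Real.sqrt (A ^ q) * Real.sqrt S with hMdef
  have hM0 : 0 < M := by positivity
  have hM : M ^ 2 = A ^ q * S := by
    rw [hMdef, mul_pow, Real.sq_sqrt (by positivity), Real.sq_sqrt hS.le]
  have hball : ∀ y, P y ≤ 1 → ‖y‖ ≤ A := by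
    intro y hy
    rw [← Real.rpow_le_rpow_iff (norm_nonneg y) hA.le hq0]
    refine (hPA y).trans ?_
    exact mul_le_of_le_one_right (by positivity) hy
  set f : V → Fin m → ℝ := fun y j => oddPow q (inner ℝ (X j) y) / M with hf
  have hfc : ∀ x, Continuous fun y => vecDist (f x) (f y) := by
    intro x
    unfold vecDist
    refine Real.continuous_sqrt.comp (continuous_finsetSum _ fun j _ => ?_)
    refine (continuous_const.sub (Continuous.div_const ?_ _)).pow 2
    exact (continuous_oddPow (by linarith)).comp (by fun_prop)
  have hfn : ∀ y, P y ≤ 1 → vecDist (f y) 0 ≤ 1 := by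
    intro y hy
    unfold vecDist
    rw [Real.sqrt_le_one]
    have e1 : ∀ j, (f y j - (0 : Fin m → ℝ) j) ^ 2 ≤ A ^ q * |inner ℝ (X j) y| ^ q / M ^ 2 := by
      intro j
      simp only [hf, Pi.zero_apply, sub_zero]
      rw [div_pow, ← sq_abs (oddPow q _), abs_oddPow hq0]
      gcongr
      rw [sq]
      have h1 : |inner ℝ (X j) y| ≤ A := by
        have := abs_real_inner_le_norm (X j) y
        rw [hX j, one_mul] at this
        exact this.trans (hball y hy)
      gcongr
    refine (Finset.sum_le_sum fun j _ => e1 j).trans ?_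
    rw [← Finset.sum_div, ← Finset.mul_sum, div_le_one (by positivity), hM]
    have := hPS y
    gcongr
    nlinarith
  obtain ⟨U, hU1, hU2⟩ := exists_bound_of_uniformlyConvex (K := ⌈L⌉₊) P f
    (fun y j => |inner ℝ (X j) y| ^ q / M) (c := 17) hq hL (by norm_num) hP0 hPz
    (by
      ext j
      simp [Real.zero_rpow hq0.ne'])
    (fun x y => by
      unfold vecDist
      refine Real.sqrt_le_sqrt (Finset.sum_le_sum fun j _ => ?_)
      simp only [hf]
      rw [← sub_div, ← sub_div, div_pow, div_pow]
      gcongr ?_ / _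
      rw [← abs_oddPow hq0, ← abs_oddPow hq0]
      exact sq_le_sq.2 (abs_abs_sub_abs_le _ _))
    hUC
    (fun x y => by
      unfold vecDist
      refine Real.sqrt_le_sqrt (Finset.sum_le_sum fun j _ => ?_)
      simp only [hf]
      rw [← sub_div, ← sub_div, div_pow, div_pow]
      gcongr ?_ / _
      rw [real_inner_smul_right, inner_add_right]
      exact sq_le_sq.2 (abs_oddPow_midpoint_sub_le hq0 _ _))
    (fun x hx t ht => by
      have hcomp : IsCompact {y : V | P y ≤ 1} := by
        refine Metric.isCompact_of_isClosed_isBounded (isClosed_le hPc continuous_const) ?_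
        refine (Metric.isBounded_closedBall (x := (0 : V)) (r := A)).subset fun y hy => ?_
        simpa using hball y hy
      obtain ⟨y, hy, hmin⟩ := hcomp.exists_isMinOn ⟨x, hx⟩
        (hPc.add (continuous_const.mul (hfc x))).continuousOn (f := fun y => P y + t * vecDist (f x) (f y))
      exact ⟨y, hy, fun z hz => hmin hz⟩)
    (fun x hx y hy => by
      have h1 := vecDist_triangle (f x) 0 (f y)
      have h2 := hfn x hx
      have h3 := hfn y hy
      rw [vecDist_comm] at h3
      have h4 : (2 : ℝ) ≤ 17 ^ q := by
        calc (2 : ℝ) ≤ 17 ^ (2 : ℝ) := by norm_num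
          _ ≤ _ := Real.rpow_le_rpow_of_exponent_le (by norm_num) hq
      linarith)
    (fun z hz D hD k => exists_label_oddPow X hX P hq hA hS hL hmL hM0 hM hPA hPS z hz D hD k)
    (by
      have h1 : (m : ℝ) ≤ 4 ^ ⌈L⌉₊ := by
        calc (m : ℝ) ≤ Real.exp L := hmL
          _ ≤ Real.exp ⌈L⌉₊ := by gcongr; exact Nat.le_ceil L
          _ = Real.exp 1 ^ ⌈L⌉₊ := by rw [← Real.exp_nat_mul, mul_one]
          _ ≤ _ := by
            gcongr
            linarith [Real.exp_one_lt_d9]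
      exact_mod_cast h1)
    (by
      have := Nat.ceil_lt_add_one (show 0 ≤ L by linarith)
      linarith)
  refine ⟨fun σ => M * U σ, ?_, fun σ y hy => ?_⟩
  · rw [signAvg_const_mul]
    calc M * signAvg U ≤ M * ((1600 * 17 ^ 2) ^ q * L ^ (1 - 1 / q)) := by gcongr
      _ ≤ M * (500000 ^ q * L ^ (1 - 1 / q)) := by
          gcongr
          norm_num
      _ = _ := by ring
  · have h1 := hU2 σ y hy
    have h2 : (fun j => |inner ℝ (X j) y| ^ q) = M • fun j => |inner ℝ (X j) y| ^ q / M := by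
      ext j
      simp only [Pi.smul_apply, smul_eq_mul]
      field_simp
    rw [h2, signSum_smul, abs_mul, abs_of_pos hM0]
    exact mul_le_mul_of_nonneg_left h1 hM0.le

end Rademacher

section Sampling

variable {K : Type*} [Fintype K]

/-- Expectation of a function of `m` independent samples with weights `w`. -/
noncomputable def sampleAvg {m : ℕ} (w : K → ℝ) (F : (Fin m → K) → ℝ) : ℝ :=
  ∑ κ, (∏ j, w (κ j)) * F κ

theorem sampleAvg_mono {m : ℕ} {w : K → ℝ} (hw : ∀ k, 0 ≤ w k) {F G : (Fin m → K) → ℝ}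
    (h : ∀ κ, F κ ≤ G κ) : sampleAvg w F ≤ sampleAvg w G :=
  Finset.sum_le_sum fun κ _ => mul_le_mul_of_nonneg_left (h κ) (Finset.prod_nonneg fun _ _ => hw _)

theorem sampleAvg_const_mul {m : ℕ} (w : K → ℝ) (c : ℝ) (F : (Fin m → K) → ℝ) :
    sampleAvg w (fun κ => c * F κ) = c * sampleAvg w F := by
  simp only [sampleAvg, Finset.mul_sum]
  exact Finset.sum_congr rfl fun κ _ => by ring

theorem sampleAvg_add {m : ℕ} (w : K → ℝ) (F G : (Fin m → K) → ℝ) :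
    sampleAvg w (fun κ => F κ + G κ) = sampleAvg w F + sampleAvg w G := by
  simp only [sampleAvg, mul_add, Finset.sum_add_distrib]

theorem sum_prod_weights (m : ℕ) {w : K → ℝ} (hw1 : ∑ k, w k = 1) :
    ∑ κ : Fin m → K, ∏ j, w (κ j) = 1 := by
  classical
  have h := Finset.prod_univ_sum (fun _ : Fin m => (Finset.univ : Finset K)) (fun _ k => w k)
  rw [Fintype.piFinset_univ] at h
  rw [← h]
  simp [hw1]

theorem sampleAvg_const {m : ℕ} {w : K → ℝ} (hw1 : ∑ k, w k = 1) (c : ℝ) :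
    sampleAvg w (fun _ : Fin m → K => c) = c := by
  rw [sampleAvg, ← Finset.sum_mul, sum_prod_weights m hw1, one_mul]

theorem sampleAvg_apply {m : ℕ} {w : K → ℝ} (hw1 : ∑ k, w k = 1) (h : K → ℝ) (i : Fin m) :
    sampleAvg w (fun κ => h (κ i)) = ∑ k, w k * h k := by
  classical
  have h1 := Finset.prod_univ_sum (fun _ : Fin m => (Finset.univ : Finset K))
    (fun j k => if j = i then w k * h k else w k)
  rw [Fintype.piFinset_univ] at h1
  have h2 : ∀ κ : Fin m → K, (∏ j, if j = i then w (κ j) * h (κ j) else w (κ j)) =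
      (∏ j, w (κ j)) * h (κ i) := by
    intro κ
    have : ∀ j, (if j = i then w (κ j) * h (κ j) else w (κ j)) =
        w (κ j) * if j = i then h (κ j) else 1 := by
      intro j
      split_ifs <;> simp
    simp_rw [this]
    rw [Finset.prod_mul_distrib, Finset.prod_ite_eq' Finset.univ i (fun j => h (κ j))]
    simp
  simp_rw [h2] at h1
  rw [sampleAvg, ← h1, Finset.prod_eq_single i]
  · simp
  · intro j _ hj
    simp [hj, hw1]
  · simp

theorem exists_le_of_sampleAvg_le {m : ℕ} {w : K → ℝ} (hw : ∀ k, 0 ≤ w k) (hw1 : ∑ k, w k = 1)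
    {F : (Fin m → K) → ℝ} {c : ℝ} (h : sampleAvg w F ≤ c) : ∃ κ, F κ ≤ c := by
  by_contra hcon
  push Not at hcon
  have h1 : sampleAvg w (fun κ => F κ - c) ≤ 0 := by
    have h2 : sampleAvg w (fun κ => F κ - c) = sampleAvg w F - c := by
      have := sampleAvg_add w F (fun _ : Fin m → K => -c)
      rw [sampleAvg_const hw1] at this
      simpa [sub_eq_add_neg] using this
    linarith
  have hnn : ∀ κ ∈ (Finset.univ : Finset (Fin m → K)), 0 ≤ (∏ j, w (κ j)) * (F κ - c) := fun κ _ =>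
    mul_nonneg (Finset.prod_nonneg fun j _ => hw _) (by linarith [hcon κ])
  have h3 := (Finset.sum_eq_zero_iff_of_nonneg hnn).1 (le_antisymm h1 (Finset.sum_nonneg hnn))
  have h4 : ∑ κ : Fin m → K, ∏ j, w (κ j) = 0 := Finset.sum_eq_zero fun κ hκ => by
    have := h3 κ hκ
    rcases mul_eq_zero.1 this with h | h
    · exact h
    · linarith [hcon κ]
  rw [sum_prod_weights m hw1] at h4
  exact one_ne_zero h4

/-- The empirical counting vector of a sample, with signs. -/
noncomputable def signedCount [DecidableEq K] {m : ℕ} (a : Fin m → ℝ) (κ : Fin m → K) : K → ℝ :=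
  ∑ j, a j • Pi.single (κ j) (1 : ℝ)

theorem sum_signedCount_mul [DecidableEq K] {m : ℕ} (a : Fin m → ℝ) (κ : Fin m → K) (h : K → ℝ) :
    ∑ k, signedCount a κ k * h k = ∑ j, a j * h (κ j) := by
  simp only [signedCount, Finset.sum_apply, Pi.smul_apply, smul_eq_mul, Finset.sum_mul]
  rw [Finset.sum_comm]
  refine Finset.sum_congr rfl fun j _ => ?_
  rw [Finset.sum_eq_single (κ j)]
  · simp
  · intro k _ hk
    simp [Pi.single_eq_of_ne hk]
  · simp

theorem sum_weights_signedCount [DecidableEq K] {m : ℕ} {w : K → ℝ} (hw1 : ∑ k, w k = 1) :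
    ∑ κ : Fin m → K, (∏ j, w (κ j)) • signedCount (fun _ : Fin m => 1) κ = (m : ℝ) • w := by
  ext k
  simp only [Finset.sum_apply, Pi.smul_apply, smul_eq_mul, signedCount, one_smul, Finset.mul_sum]
  rw [Finset.sum_comm]
  have : ∀ j : Fin m, ∑ κ : Fin m → K, (∏ i, w (κ i)) * (Pi.single (κ j) (1 : ℝ) : K → ℝ) k = w k := by
    intro j
    have h := sampleAvg_apply (m := m) hw1 (fun k' => (Pi.single k' (1 : ℝ) : K → ℝ) k) j
    rw [sampleAvg] at h
    rw [h, Finset.sum_eq_single k]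
    · simp
    · intro b _ hb
      simp [Pi.single_eq_of_ne hb.symm]
    · simp
  simp [this]

/-- Symmetrization for the empirical measure of an independent sample. -/
theorem symmetrization [DecidableEq K] {m : ℕ} {w : K → ℝ} (hw : ∀ k, 0 ≤ w k)
    (hw1 : ∑ k, w k = 1) (Φ : Seminorm ℝ (K → ℝ)) :
    sampleAvg w (fun κ : Fin m → K => Φ (signedCount (fun _ => 1) κ - (m : ℝ) • w)) ≤
      2 * sampleAvg w (fun κ : Fin m → K =>
        signAvg fun σ => Φ (signedCount (fun j => boolSign (σ j)) κ)) := by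
  set p : (Fin m → K) → ℝ := fun κ => ∏ j, w (κ j) with hp
  have hp0 : ∀ κ, 0 ≤ p κ := fun κ => Finset.prod_nonneg fun j _ => hw _
  have hp1 : ∑ κ, p κ = 1 := sum_prod_weights m hw1
  let Q : (Fin m → Bool) → ℝ := fun σ => ∑ κ : Fin m → K, ∑ κ' : Fin m → K, p κ * p κ' *
    Φ (signedCount (fun j => boolSign (σ j)) κ - signedCount (fun j => boolSign (σ j)) κ')
  have hjensen : sampleAvg w (fun κ : Fin m → K => Φ (signedCount (fun _ => 1) κ - (m : ℝ) • w)) ≤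
      Q fun _ => true := by
    refine Finset.sum_le_sum fun κ _ => ?_
    change p κ * _ ≤ _
    simp_rw [mul_assoc]
    rw [← Finset.mul_sum]
    refine mul_le_mul_of_nonneg_left ?_ (hp0 κ)
    have e1 : signedCount (fun _ => 1) κ - (m : ℝ) • w =
        ∑ κ' : Fin m → K, p κ' • (signedCount (fun _ => (1 : ℝ)) κ - signedCount (fun _ => 1) κ') := by
      simp_rw [smul_sub]
      rw [Finset.sum_sub_distrib, ← Finset.sum_smul, hp1, one_smul, sum_weights_signedCount hw1]
    rw [e1]
    refine (Finset.le_sum_of_subadditive Φ (map_zero Φ).le (map_add_le_add Φ) _ _).trans (Finset.sum_le_sum fun κ' _ => ?_)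
    rw [map_smul_eq_mul, Real.norm_of_nonneg (hp0 κ')]
    simp [boolSign]
  have hpair : ∀ F : (Fin m → K) → (Fin m → K) → ℝ, ∑ κ : Fin m → K, ∑ κ' : Fin m → K, F κ κ' =
      ∑ z : Fin m → K × K, F (fun j => (z j).1) (fun j => (z j).2) := by
    intro F
    rw [← Fintype.sum_prod_type' F]
    exact (Fintype.sum_equiv (Equiv.arrowProdEquivProdArrow (Fin m) (fun _ => K) (fun _ => K)) _ _
      fun z => rfl).symm
  have hswap : ∀ σ, Q σ = Q fun _ => true := by
    intro σ
    simp only [Q]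
    rw [hpair, hpair]
    have hinv : Function.Involutive fun (z : Fin m → K × K) j => if σ j then z j else (z j).swap := by
      intro z
      ext j <;> simp only <;> split_ifs <;> simp
    refine Fintype.sum_equiv hinv.toPerm _ _ fun z => ?_
    simp only [Function.Involutive.coe_toPerm]
    congr 1
    · simp only [hp, ← Finset.prod_mul_distrib]
      refine Finset.prod_congr rfl fun j _ => ?_
      split_ifs
      · rfl
      · simp [mul_comm]
    · congr 1
      simp only [signedCount, ← Finset.sum_sub_distrib]
      refine Finset.sum_congr rfl fun j _ => ?_
      cases h : σ j <;> simp [boolSign]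
      abel
  have hQle : ∀ σ, Q σ ≤ 2 * sampleAvg w
      (fun κ : Fin m → K => Φ (signedCount (fun j => boolSign (σ j)) κ)) := by
    intro σ
    set φ : (Fin m → K) → ℝ := fun κ => Φ (signedCount (fun j => boolSign (σ j)) κ)
    calc Q σ ≤ ∑ κ : Fin m → K, ∑ κ' : Fin m → K, (p κ * φ κ * p κ' + p κ * (p κ' * φ κ')) := by
          refine Finset.sum_le_sum fun κ _ => Finset.sum_le_sum fun κ' _ => ?_
          have := map_sub_le_add Φ (signedCount (fun j => boolSign (σ j)) κ)
            (signedCount (fun j => boolSign (σ j)) κ')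
          have h2 := mul_le_mul_of_nonneg_left this (mul_nonneg (hp0 κ) (hp0 κ'))
          refine h2.trans (le_of_eq ?_)
          simp only [φ]
          ring
      _ = _ := by
          simp_rw [Finset.sum_add_distrib, ← Finset.mul_sum]
          simp_rw [hp1, mul_one]
          rw [← Finset.sum_mul, hp1, one_mul, ← two_mul]
          rfl
  calc _ ≤ Q fun _ => true := hjensen
    _ = signAvg Q := by
        have : Q = fun _ => Q fun _ => true := funext hswap
        rw [this, signAvg_const]
    _ ≤ signAvg (fun σ => 2 * sampleAvg w
          (fun κ : Fin m → K => Φ (signedCount (fun j => boolSign (σ j)) κ))) := signAvg_mono hQle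
    _ = _ := by
        rw [signAvg_const_mul]
        simp only [sampleAvg]
        rw [signAvg_sum]
        simp_rw [signAvg_const_mul]

end Sampling

theorem uniformly_convex_abs_rpow {q : ℝ} (hq : 2 ≤ q) (s t : ℝ) :
    |1 / 2 * (s + t)| ^ q + (1 / 2) ^ q * |s - t| ^ q ≤ (|s| ^ q + |t| ^ q) / 2 := by
  have h2 : ∀ x : ℝ, |x| ^ q = (x ^ 2) ^ (q / 2) := by
    intro x
    rw [← sq_abs, ← Real.rpow_natCast, ← Real.rpow_mul (abs_nonneg x)]
    congr 1
    push_cast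
    ring
  have h3 : (1 / 2 : ℝ) ^ q * |s - t| ^ q = |1 / 2 * (s - t)| ^ q := by
    rw [abs_mul, Real.mul_rpow (abs_nonneg _) (abs_nonneg _), abs_of_pos (by norm_num : (0 : ℝ) < 1 / 2)]
  have hq2 : 1 ≤ q / 2 := by linarith
  rw [h3, h2, h2, h2 s, h2 t]
  refine (Real.add_rpow_le_rpow_add (sq_nonneg _) (sq_nonneg _) hq2).trans ?_
  have h4 := (convexOn_rpow hq2).2 (Set.mem_Ici.2 (sq_nonneg s)) (Set.mem_Ici.2 (sq_nonneg t))
    (show (0 : ℝ) ≤ 1 / 2 by norm_num) (show (0 : ℝ) ≤ 1 / 2 by norm_num) (by norm_num)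
  simp only [smul_eq_mul] at h4
  have h5 : (1 / 2 * (s + t)) ^ 2 + (1 / 2 * (s - t)) ^ 2 = 1 / 2 * s ^ 2 + 1 / 2 * t ^ 2 := by ring
  rw [h5]
  linarith

section Moments

variable {V : Type*} [NormedAddCommGroup V] [InnerProductSpace ℝ V]
  {K : Type*} [Fintype K]

/-- The normalized moment functional `n ∑ₖ wₖ |⟨Xₖ, y⟩| ^ q`. -/
noncomputable def momentFun (n q : ℝ) (w : K → ℝ) (X : K → V) (y : V) : ℝ :=
  n * ∑ k, w k * |inner ℝ (X k) y| ^ q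

theorem momentFun_nonneg {n q : ℝ} (hn : 0 ≤ n) {w : K → ℝ} (hw : ∀ k, 0 ≤ w k) (X : K → V) (y : V) :
    0 ≤ momentFun n q w X y :=
  mul_nonneg hn (Finset.sum_nonneg fun k _ => mul_nonneg (hw k) (by positivity))

theorem momentFun_zero {n q : ℝ} (hq : q ≠ 0) (w : K → ℝ) (X : K → V) :
    momentFun n q w X 0 = 0 := by
  simp [momentFun, Real.zero_rpow hq]

theorem momentFun_smul {n q : ℝ} (w : K → ℝ) (X : K → V) (t : ℝ) (y : V) :
    momentFun n q w X (t • y) = |t| ^ q * momentFun n q w X y := by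
  simp only [momentFun, real_inner_smul_right, abs_mul, Real.mul_rpow (abs_nonneg _) (abs_nonneg _),
    Finset.mul_sum]
  exact Finset.sum_congr rfl fun k _ => by ring

theorem continuous_momentFun {n q : ℝ} (hq : 0 ≤ q) (w : K → ℝ) (X : K → V) :
    Continuous (momentFun n q w X) := by
  unfold momentFun
  refine continuous_const.mul (continuous_finsetSum _ fun k _ => continuous_const.mul ?_)
  exact Continuous.rpow_const (by fun_prop) fun _ => Or.inr hq

theorem momentFun_uniformly_convex {n q : ℝ} (hn : 0 ≤ n) (hq : 2 ≤ q) {w : K → ℝ}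
    (hw : ∀ k, 0 ≤ w k) (X : K → V) (x y : V) :
    momentFun n q w X ((1 / 2 : ℝ) • (x + y)) + (1 / 2) ^ q * momentFun n q w X (x - y) ≤
      (momentFun n q w X x + momentFun n q w X y) / 2 := by
  simp only [momentFun]
  have h : ∑ k, (w k * |inner ℝ (X k) ((1 / 2 : ℝ) • (x + y))| ^ q +
      (1 / 2) ^ q * (w k * |inner ℝ (X k) (x - y)| ^ q)) ≤
      ∑ k, (w k * |inner ℝ (X k) x| ^ q / 2 + w k * |inner ℝ (X k) y| ^ q / 2) := by
    refine Finset.sum_le_sum fun k _ => ?_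
    have := mul_le_mul_of_nonneg_left
      (uniformly_convex_abs_rpow hq (inner ℝ (X k) x) (inner ℝ (X k) y)) (hw k)
    rw [real_inner_smul_right, inner_add_right, inner_sub_right]
    linarith
  rw [Finset.sum_add_distrib, Finset.sum_add_distrib, ← Finset.mul_sum, ← Finset.sum_div,
    ← Finset.sum_div] at h
  have := mul_le_mul_of_nonneg_left h hn
  linarith

theorem norm_rpow_le_momentFun {n q : ℝ} (hn : 0 < n) (hq : 2 ≤ q) {w : K → ℝ}
    (hw : ∀ k, 0 ≤ w k) (hw1 : ∑ k, w k = 1) (X : K → V)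
    (hiso : ∀ y, n * ∑ k, w k * inner ℝ (X k) y ^ 2 = ‖y‖ ^ 2) (y : V) :
    ‖y‖ ^ q ≤ n ^ (q / 2 - 1) * momentFun n q w X y := by
  have h2 : ∀ x : ℝ, |x| ^ q = (x ^ 2) ^ (q / 2) := by
    intro x
    rw [← sq_abs, ← Real.rpow_natCast, ← Real.rpow_mul (abs_nonneg x)]
    congr 1
    push_cast
    ring
  have h0 : ‖y‖ ^ q = (‖y‖ ^ 2) ^ (q / 2) := by
    have := h2 ‖y‖
    rwa [abs_norm] at this
  have h1 := Real.rpow_arith_mean_le_arith_mean_rpow Finset.univ w (fun k => inner ℝ (X k) y ^ 2)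
    (fun k _ => hw k) hw1 (fun k _ => sq_nonneg _) (show 1 ≤ q / 2 by linarith)
  have hnn : 0 ≤ ∑ k, w k * inner ℝ (X k) y ^ 2 :=
    Finset.sum_nonneg fun k _ => mul_nonneg (hw k) (sq_nonneg _)
  rw [h0, ← hiso y, Real.mul_rpow hn.le hnn, momentFun, ← mul_assoc, Real.rpow_sub_one hn.ne',
    div_mul_cancel₀ _ hn.ne']
  simp_rw [h2]
  gcongr

end Moments

section SamplingBound

variable {V : Type*} [NormedAddCommGroup V] [InnerProductSpace ℝ V] [FiniteDimensional ℝ V]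
  {K : Type*} [Fintype K] [DecidableEq K]

/-- The deviation seminorm: supremum over the unit ball of the moment functional. -/
noncomputable def deviation (n q : ℝ) (w : K → ℝ) (X : K → V) (a : K → ℝ) : ℝ :=
  ⨆ y : {y : V // momentFun n q w X y ≤ 1}, |∑ k, a k * |inner ℝ (X k) y.1| ^ q|

theorem exists_sampling_deviation_le {n q L : ℝ} {m : ℕ} (hn : 0 < n) (hm : 0 < m) (hq : 2 ≤ q)
    (hL : 1 ≤ L) (hmL : (m : ℝ) ≤ Real.exp L) {w : K → ℝ}
    (hw : ∀ k, 0 ≤ w k) (hw1 : ∑ k, w k = 1) (X : K → V) (hX : ∀ k, ‖X k‖ = 1)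
    (hiso : ∀ y, n * ∑ k, w k * inner ℝ (X k) y ^ 2 = ‖y‖ ^ 2)
    {κ₀ : ℝ} (hκ₀ : κ₀ ≤ 1 / 2)
    (hκ : 2 * 500000 ^ q * Real.sqrt (n ^ (q / 2) / m) * L ^ (1 - 1 / q) ≤ κ₀) :
    ∃ D : (Fin m → K) → ℝ, sampleAvg w D ≤ 2 * κ₀ ∧ (∀ κ, 0 ≤ D κ) ∧ ∀ κ y,
      |n / m * ∑ j, |inner ℝ (X (κ j)) y| ^ q - momentFun n q w X y| ≤ D κ * momentFun n q w X y := by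
  have hq0 : 0 < q := by linarith
  have hm0 : (0 : ℝ) < m := by exact_mod_cast hm
  set P := momentFun n q w X with hP
  set A : ℝ := n ^ ((q / 2 - 1) / q) with hA
  have hA0 : 0 < A := by positivity
  have hAq : A ^ q = n ^ (q / 2 - 1) := by
    rw [hA, ← Real.rpow_mul hn.le, div_mul_cancel₀ _ hq0.ne']
  have hPA : ∀ y, ‖y‖ ^ q ≤ A ^ q * P y := fun y => by
    rw [hAq]
    exact norm_rpow_le_momentFun hn hq hw hw1 X hiso y
  have hP0 : ∀ y, 0 ≤ P y := momentFun_nonneg hn.le hw X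
  have hPz : P 0 = 0 := momentFun_zero hq0.ne' w X
  have hfb : ∀ y, P y ≤ 1 → ∀ k, |inner ℝ (X k) y| ^ q ≤ A ^ q := by
    intro y hy k
    have h1 := abs_real_inner_le_norm (X k) y
    rw [hX k, one_mul] at h1
    calc |inner ℝ (X k) y| ^ q ≤ ‖y‖ ^ q := by gcongr
      _ ≤ A ^ q * P y := hPA y
      _ ≤ A ^ q := mul_le_of_le_one_right (by positivity) hy
  let ι := {y : V // P y ≤ 1}
  let g : (K → ℝ) → ι → ℝ := fun a y => |∑ k, a k * |inner ℝ (X k) y.1| ^ q|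
  have hbdd : ∀ a, BddAbove (Set.range (g a)) := by
    intro a
    refine ⟨∑ k, |a k| * A ^ q, ?_⟩
    rintro _ ⟨y, rfl⟩
    refine (Finset.abs_sum_le_sum_abs _ _).trans (Finset.sum_le_sum fun k _ => ?_)
    rw [abs_mul, abs_of_nonneg (Real.rpow_nonneg (abs_nonneg _) q)]
    have := hfb y.1 y.2 k
    gcongr
  have : Nonempty ι := ⟨⟨0, by rw [hPz]; exact zero_le_one⟩⟩
  have hdev : ∀ a, deviation n q w X a = ⨆ y, g a y := fun a => rfl
  let Φ : Seminorm ℝ (K → ℝ) := Seminorm.of (deviation n q w X)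
    (fun a b => by
      rw [hdev, hdev, hdev]
      refine ciSup_le fun y => ?_
      have h1 := le_ciSup (hbdd a) y
      have h2 := le_ciSup (hbdd b) y
      refine le_trans ?_ (add_le_add h1 h2)
      simp only [g, Pi.add_apply, add_mul, Finset.sum_add_distrib]
      exact abs_add_le _ _)
    (fun c a => by
      rw [hdev, hdev, Real.norm_eq_abs, Real.mul_iSup_of_nonneg (abs_nonneg c)]
      congr 1
      ext y
      simp only [g, Pi.smul_apply, smul_eq_mul, mul_assoc, ← Finset.mul_sum, abs_mul])
  have hΦle : ∀ a y, P y ≤ 1 → |∑ k, a k * |inner ℝ (X k) y| ^ q| ≤ Φ a := fun a y hy =>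
    le_ciSup (hbdd a) ⟨y, hy⟩
  have hleΦ : ∀ a c, (∀ y, P y ≤ 1 → |∑ k, a k * |inner ℝ (X k) y| ^ q| ≤ c) → Φ a ≤ c :=
    fun a c h => ciSup_le fun y => h y.1 y.2
  set D : (Fin m → K) → ℝ := fun κ => n / m * Φ (signedCount (fun _ => 1) κ - (m : ℝ) • w) with hD
  have hD0 : ∀ κ, 0 ≤ D κ := fun κ => mul_nonneg (by positivity) (apply_nonneg _ _)
  have hval : ∀ (κ : Fin m → K) y, n / m * ∑ k, (signedCount (fun _ => 1) κ - (m : ℝ) • w : K → ℝ) k *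
      |inner ℝ (X k) y| ^ q = n / m * ∑ j, |inner ℝ (X (κ j)) y| ^ q - P y := by
    intro κ y
    simp only [Pi.sub_apply, Pi.smul_apply, smul_eq_mul, sub_mul, Finset.sum_sub_distrib]
    rw [sum_signedCount_mul]
    simp only [one_mul, mul_assoc, ← Finset.mul_sum, hP, momentFun]
    field_simp
  have hdevB : ∀ (κ : Fin m → K) y, P y ≤ 1 → |n / m * ∑ j, |inner ℝ (X (κ j)) y| ^ q - P y| ≤ D κ := by
    intro κ y hy
    rw [← hval, abs_mul, abs_of_pos (by positivity : 0 < n / (m : ℝ)), hD]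
    exact mul_le_mul_of_nonneg_left (hΦle (signedCount (fun _ => 1) κ - (m : ℝ) • w) y hy)
      (by positivity)
  have hdevAll : ∀ (κ : Fin m → K) y, |n / m * ∑ j, |inner ℝ (X (κ j)) y| ^ q - P y| ≤ D κ * P y := by
    intro κ y
    rcases (hP0 y).eq_or_lt with h0 | hpos
    · have h1 := hPA y
      rw [← h0, mul_zero] at h1
      have h2 : ‖y‖ ^ q = 0 := le_antisymm h1 (by positivity)
      have h3 : y = 0 := by
        rw [Real.rpow_eq_zero (norm_nonneg y) hq0.ne'] at h2
        exact norm_eq_zero.1 h2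
      rw [← h0, h3]
      simp [Real.zero_rpow hq0.ne']
    · set t := (P y) ^ (-(1 / q)) with ht
      have ht0 : 0 < t := by positivity
      have htq : |t| ^ q = (P y)⁻¹ := by
        rw [abs_of_pos ht0, ht, ← Real.rpow_mul hpos.le, neg_mul, one_div_mul_cancel hq0.ne',
          Real.rpow_neg_one]
      have h1 : P (t • y) = 1 := by
        rw [hP, momentFun_smul, htq]
        exact inv_mul_cancel₀ hpos.ne'
      have h2 := hdevB κ (t • y) h1.le
      rw [h1] at h2
      simp only [real_inner_smul_right, abs_mul, Real.mul_rpow (abs_nonneg _) (abs_nonneg _), htq,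
        ← Finset.mul_sum] at h2
      have h3 : n / m * ∑ j, |inner ℝ (X (κ j)) y| ^ q - P y =
          (n / m * ((P y)⁻¹ * ∑ j, |inner ℝ (X (κ j)) y| ^ q) - 1) * P y := by
        field_simp
      rw [h3, abs_mul, abs_of_pos hpos]
      gcongr
  have hsign : ∀ κ : Fin m → K, signAvg (fun σ => Φ (signedCount (fun j => boolSign (σ j)) κ)) ≤
      500000 ^ q * Real.sqrt (A ^ q) * Real.sqrt (m / n) * L ^ (1 - 1 / q) * (1 + D κ) := by
    intro κ
    have hS : 0 < m / n * (1 + D κ) := by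
      have := hD0 κ
      positivity
    obtain ⟨U, hU1, hU2⟩ := exists_rademacher_bound (fun j => X (κ j)) (fun j => hX _) P hq hA0 hS hL
      hmL (continuous_momentFun hq0.le w X) hP0 hPz
      (momentFun_uniformly_convex hn.le hq hw X) hPA (fun y => by
        have h1 := (abs_le.1 (hdevAll κ y)).2
        have h2 : n / m * ∑ j, |inner ℝ (X (κ j)) y| ^ q ≤ (1 + D κ) * P y := by linarith
        calc ∑ j, |inner ℝ (X (κ j)) y| ^ q
            = m / n * (n / m * ∑ j, |inner ℝ (X (κ j)) y| ^ q) := by field_simp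
          _ ≤ m / n * ((1 + D κ) * P y) := by gcongr
          _ = _ := by ring)
    have h3 : ∀ σ, Φ (signedCount (fun j => boolSign (σ j)) κ) ≤ U σ := by
      intro σ
      refine hleΦ _ _ fun y hy => ?_
      rw [sum_signedCount_mul]
      exact hU2 σ y hy
    refine (signAvg_mono h3).trans (hU1.trans ?_)
    have h4 : Real.sqrt (m / n * (1 + D κ)) ≤ Real.sqrt (m / n) * (1 + D κ) := by
      rw [Real.sqrt_mul (by positivity)]
      gcongr
      rw [Real.sqrt_le_left (by linarith [hD0 κ])]
      nlinarith [hD0 κ]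
    calc 500000 ^ q * (Real.sqrt (A ^ q) * Real.sqrt (m / n * (1 + D κ))) * L ^ (1 - 1 / q)
        ≤ 500000 ^ q * (Real.sqrt (A ^ q) * (Real.sqrt (m / n) * (1 + D κ))) * L ^ (1 - 1 / q) := by
          gcongr
      _ = _ := by ring
  have hED : sampleAvg w D ≤ κ₀ * (1 + sampleAvg w D) := by
    have h1 := symmetrization (m := m) hw hw1 Φ
    have h2 : sampleAvg w D = n / m * sampleAvg w
        (fun κ : Fin m → K => Φ (signedCount (fun _ => 1) κ - (m : ℝ) • w)) :=
      sampleAvg_const_mul _ _ _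
    set B := 500000 ^ q * Real.sqrt (A ^ q) * Real.sqrt (m / n) * L ^ (1 - 1 / q) with hB
    have h3 := sampleAvg_mono hw hsign
    rw [sampleAvg_const_mul, sampleAvg_add w (fun _ => 1) D, sampleAvg_const hw1] at h3
    have hE0 : 0 ≤ sampleAvg w D :=
      Finset.sum_nonneg fun κ _ => mul_nonneg (Finset.prod_nonneg fun j _ => hw _) (hD0 κ)
    have h4 : n / m * (2 * B) ≤ κ₀ := by
      refine le_trans (le_of_eq ?_) hκ
      have h5 : n / m * (Real.sqrt (A ^ q) * Real.sqrt (m / n)) = Real.sqrt (n ^ (q / 2) / m) := by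
        rw [← Real.sqrt_mul (by positivity), hAq]
        have h6 : n / m = Real.sqrt ((n / m) ^ 2) := (Real.sqrt_sq (by positivity)).symm
        rw [h6, ← Real.sqrt_mul (by positivity)]
        congr 1
        rw [Real.rpow_sub_one hn.ne']
        field_simp
      rw [hB, ← h5]
      ring
    calc sampleAvg w D ≤ n / m * (2 * (B * (1 + sampleAvg w D))) := by
          rw [h2]
          gcongr
          rw [← h2]
          linarith
      _ = n / m * (2 * B) * (1 + sampleAvg w D) := by ring
      _ ≤ _ := by gcongr
  refine ⟨D, ?_, hD0, hdevAll⟩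
  have hE0 : 0 ≤ sampleAvg w D :=
    Finset.sum_nonneg fun κ _ => mul_nonneg (Finset.prod_nonneg fun j _ => hw _) (hD0 κ)
  nlinarith

end SamplingBound

section Lewis

variable {n : ℕ}

/-- The action of a square matrix on Euclidean space. -/
noncomputable def matAct (T : Matrix (Fin n) (Fin n) ℝ) (x : EuclideanSpace ℝ (Fin n)) :
    EuclideanSpace ℝ (Fin n) := WithLp.toLp 2 (T.mulVec x.ofLp)

theorem inner_matAct (T : Matrix (Fin n) (Fin n) ℝ) (x y : EuclideanSpace ℝ (Fin n)) :
    inner ℝ (matAct T x) y = inner ℝ x (matAct T.transpose y) := by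
  simp only [matAct, EuclideanSpace.inner_eq_star_dotProduct, star_trivial]
  rw [dotProduct_comm, ← Matrix.vecMul_transpose, ← Matrix.dotProduct_mulVec, dotProduct_comm]

theorem matAct_mul (S T : Matrix (Fin n) (Fin n) ℝ) (x : EuclideanSpace ℝ (Fin n)) :
    matAct (S * T) x = matAct S (matAct T x) := by
  simp [matAct, Matrix.mulVec_mulVec]

theorem matAct_one_add_smul (s : ℝ) (B : Matrix (Fin n) (Fin n) ℝ) (x : EuclideanSpace ℝ (Fin n)) :
    matAct (1 + s • B) x = x + s • matAct B x := by
  ext i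
  simp [matAct, Matrix.add_mulVec, Matrix.smul_mulVec]

theorem matAct_smul (s : ℝ) (B : Matrix (Fin n) (Fin n) ℝ) (x : EuclideanSpace ℝ (Fin n)) :
    matAct (s • B) x = s • matAct B x := by
  ext i
  simp [matAct, Matrix.smul_mulVec]

theorem matAct_vecMulVec (y x : EuclideanSpace ℝ (Fin n)) :
    matAct (Matrix.vecMulVec y.ofLp y.ofLp) x = inner ℝ x y • y := by
  ext i
  simp only [matAct, Matrix.vecMulVec_mulVec, EuclideanSpace.inner_eq_star_dotProduct, star_trivial]
  simp [mul_comm]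

theorem hasDerivAt_det_one_add_smul (B : Matrix (Fin n) (Fin n) ℝ) :
    HasDerivAt (fun s : ℝ => (1 + s • B).det) B.trace 0 := by
  set Q := (Matrix.det (1 + (Polynomial.X : Polynomial ℝ) • B.map Polynomial.C)).divX.divX
  have e : (fun s : ℝ => (1 + s • B).det) = fun s => 1 + B.trace * s + Q.eval s * s ^ 2 :=
    funext fun s => Matrix.det_one_add_smul s B
  rw [e]
  have h := (((hasDerivAt_id (0 : ℝ)).const_mul B.trace).const_add 1).add
    ((Q.hasDerivAt 0).mul ((hasDerivAt_id (0 : ℝ)).pow 2))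
  have h2 : HasDerivAt (fun s : ℝ => 1 + B.trace * s + Q.eval s * s ^ 2) _ 0 := h
  refine h2.congr_deriv ?_
  simp

theorem hasDerivAt_sum_norm_rpow {K V : Type*} [Fintype K] [NormedAddCommGroup V]
    [InnerProductSpace ℝ V] {p : ℝ} (hp : 1 < p) (u b : K → V) :
    HasDerivAt (fun s : ℝ => ∑ k, ‖u k + s • b k‖ ^ p)
      (p * ∑ k, ‖u k‖ ^ (p - 2) * inner ℝ (u k) (b k)) 0 := by
  rw [Finset.mul_sum]
  refine HasDerivAt.fun_sum fun k _ => ?_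
  have h1 : HasDerivAt (fun s : ℝ => u k + s • b k) (b k) 0 := by
    have := ((hasDerivAt_id (0 : ℝ)).smul_const (b k)).const_add (u k)
    simpa using this
  have h2 := hasFDerivAt_norm_rpow (u k + (0 : ℝ) • b k) hp
  have h3 := h2.comp_hasDerivAt (0 : ℝ) h1
  have h4 : HasDerivAt (fun s : ℝ => ‖u k + s • b k‖ ^ p) _ 0 := h3
  refine h4.congr_deriv ?_
  simp [mul_assoc]

/-- Lewis' lemma: a finite family spanning Euclidean space can be put in Lewis position by a
change of coordinates. -/
theorem exists_lewis_position {K : Type*} [Fintype K] (hn : 0 < n)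
    (v : K → EuclideanSpace ℝ (Fin n)) {p : ℝ} (hp : 2 ≤ p)
    (hspan : ∀ y, (∀ k, inner ℝ (v k) y = 0) → y = 0) :
    ∃ (Ψ : EuclideanSpace ℝ (Fin n) ≃ₗ[ℝ] EuclideanSpace ℝ (Fin n))
      (u : K → EuclideanSpace ℝ (Fin n)),
      (∀ k y, inner ℝ (v k) y = inner ℝ (u k) (Ψ y)) ∧
      ∀ y, ∑ k, ‖u k‖ ^ (p - 2) * inner ℝ (u k) y ^ 2 = ‖y‖ ^ 2 := by
  have hp0 : 0 < p := by linarith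
  have hnR : (0 : ℝ) < n := by exact_mod_cast hn
  set G : Matrix (Fin n) (Fin n) ℝ → ℝ := fun T => ∑ k, ‖matAct T (v k)‖ ^ p with hG
  have hG0 : ∀ T, 0 ≤ G T := fun T => Finset.sum_nonneg fun k _ => by positivity
  have hGsmul : ∀ (s : ℝ) T, G (s • T) = |s| ^ p * G T := by
    intro s T
    simp only [hG, matAct_smul, norm_smul, Real.norm_eq_abs,
      Real.mul_rpow (abs_nonneg _) (norm_nonneg _), Finset.mul_sum]
  have hGc : Continuous G := by
    refine continuous_finsetSum _ fun k _ => Continuous.rpow_const (Continuous.norm ?_)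
      fun _ => Or.inr hp0.le
    unfold matAct
    exact (PiLp.continuous_toLp 2 _).comp (continuous_id.matrix_mulVec continuous_const)
  have hcoer : ∃ c : ℝ, 0 < c ∧ ∀ T i, c * ‖(WithLp.toLp 2 (T i) : EuclideanSpace ℝ (Fin n))‖ ^ p ≤ G T := by
    set P : EuclideanSpace ℝ (Fin n) → ℝ := fun y => ∑ k, |inner ℝ (v k) y| ^ p with hP
    have hPc : Continuous P := continuous_finsetSum _ fun k _ =>
      Continuous.rpow_const (by fun_prop) fun _ => Or.inr hp0.le
    have hPs : ∀ (t : ℝ) y, P (t • y) = |t| ^ p * P y := by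
      intro t y
      simp only [hP, real_inner_smul_right, abs_mul, Real.mul_rpow (abs_nonneg _) (abs_nonneg _),
        Finset.mul_sum]
    have hne : (Metric.sphere (0 : EuclideanSpace ℝ (Fin n)) 1).Nonempty := by
      have : Nonempty (Fin n) := ⟨⟨0, hn⟩⟩
      exact NormedSpace.sphere_nonempty.2 zero_le_one
    obtain ⟨y₀, hy₀, hmin⟩ := (isCompact_sphere (0 : EuclideanSpace ℝ (Fin n)) 1).exists_isMinOn
      hne hPc.continuousOn
    have hP0 : 0 < P y₀ := by
      have hnn : ∀ k ∈ Finset.univ, 0 ≤ |inner ℝ (v k) y₀| ^ p := fun k _ => by positivity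
      rcases (Finset.sum_nonneg hnn).eq_or_lt with h | h
      · exfalso
        have h0 := (Finset.sum_eq_zero_iff_of_nonneg hnn).1 h.symm
        have : y₀ = 0 := hspan _ fun k => by
          have := h0 k (Finset.mem_univ k)
          rw [Real.rpow_eq_zero (abs_nonneg _) hp0.ne'] at this
          exact abs_eq_zero.1 this
        rw [this] at hy₀
        simp at hy₀
      · exact h
    refine ⟨P y₀, hP0, fun T i => ?_⟩
    set r : EuclideanSpace ℝ (Fin n) := WithLp.toLp 2 (T i)
    have h1 : P y₀ * ‖r‖ ^ p ≤ P r := by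
      rcases eq_or_ne r 0 with h0 | h0
      · rw [h0, norm_zero, Real.zero_rpow hp0.ne', mul_zero]
        exact Finset.sum_nonneg fun k _ => by positivity
      · have hr : 0 < ‖r‖ := norm_pos_iff.2 h0
        have h2 : P y₀ ≤ P (‖r‖⁻¹ • r) := hmin (by simp [norm_smul, hr.ne'])
        rw [hPs, abs_of_pos (inv_pos.2 hr), Real.inv_rpow hr.le, inv_mul_eq_div,
          le_div_iff₀ (by positivity)] at h2
        exact h2
    refine h1.trans (Finset.sum_le_sum fun k _ => ?_)
    gcongr
    have h3 : inner ℝ (v k) r = (matAct T (v k)).ofLp i := by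
      simp only [EuclideanSpace.inner_eq_star_dotProduct, star_trivial, matAct, r, Matrix.mulVec]
    rw [h3]
    exact PiLp.norm_apply_le (matAct T (v k)) i
  obtain ⟨c, hc, hcoer⟩ := hcoer
  have hGpos : ∀ T, T ≠ 0 → 0 < G T := by
    intro T hT
    rcases (hG0 T).eq_or_lt with h | h
    · exfalso
      refine hT (Matrix.ext fun i j => ?_)
      have h1 := hcoer T i
      rw [← h] at h1
      have h2 : ‖(WithLp.toLp 2 (T i) : EuclideanSpace ℝ (Fin n))‖ ^ p = 0 :=
        le_antisymm (by nlinarith) (by positivity)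
      rw [Real.rpow_eq_zero (norm_nonneg _) hp0.ne', norm_eq_zero] at h2
      have := congrArg (fun z : EuclideanSpace ℝ (Fin n) => z.ofLp j) h2
      simpa using this
    · exact h
  set C : Set (Matrix (Fin n) (Fin n) ℝ) := {T | G T ≤ n} with hC
  have hCcomp : IsCompact C := by
    set R : ℝ := (n / c) ^ (1 / p) with hR
    have hbox : IsCompact {T : Matrix (Fin n) (Fin n) ℝ | ∀ i j, T i j ∈ Set.Icc (-R) R} := by
      have h := isCompact_univ_pi (fun _ : Fin n => isCompact_univ_pi
        (fun _ : Fin n => isCompact_Icc (a := -R) (b := R)))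
      have e : {T : Matrix (Fin n) (Fin n) ℝ | ∀ i j, T i j ∈ Set.Icc (-R) R} =
          (Set.univ.pi fun _ : Fin n => Set.univ.pi fun _ : Fin n => Set.Icc (-R) R :
            Set (Fin n → Fin n → ℝ)) := by
        apply Set.ext
        intro T
        exact ⟨fun h i _ j _ => h i j, fun h i j => h i trivial j trivial⟩
      rw [e]
      exact h
    refine hbox.of_isClosed_subset (isClosed_le hGc continuous_const) fun T hT i j => ?_
    have h1 := (hcoer T i).trans hT
    have h2 : ‖(WithLp.toLp 2 (T i) : EuclideanSpace ℝ (Fin n))‖ ≤ R := by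
      rw [hR, one_div, Real.le_rpow_inv_iff_of_pos (norm_nonneg _) (by positivity) hp0,
        le_div_iff₀ hc, mul_comm]
      exact h1
    exact abs_le.1 ((PiLp.norm_apply_le (WithLp.toLp 2 (T i) : EuclideanSpace ℝ (Fin n)) j).trans h2)
  obtain ⟨T₀, hT₀, hmax⟩ := hCcomp.exists_isMaxOn ⟨0, by
      simp only [hC, Set.mem_ofPred_eq, hG]
      have : ∀ k, matAct (0 : Matrix (Fin n) (Fin n) ℝ) (v k) = 0 := fun k => by
        ext i; simp [matAct]
      simp [this, Real.zero_rpow hp0.ne']⟩ (Continuous.matrix_det continuous_id).continuousOn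
  have hdet : 0 < T₀.det := by
    set S := G 1 with hS
    have hS0 : 0 ≤ S := hG0 1
    set s : ℝ := (n / (S + n)) ^ (1 / p) with hs
    have hs0 : 0 < s := by positivity
    have h1 : s • (1 : Matrix (Fin n) (Fin n) ℝ) ∈ C := by
      simp only [hC, Set.mem_ofPred_eq]
      rw [hGsmul, abs_of_pos hs0, hs, ← Real.rpow_mul (by positivity), one_div_mul_cancel hp0.ne',
        Real.rpow_one, ← hS, div_mul_eq_mul_div, div_le_iff₀ (by positivity)]
      nlinarith
    have h2 := hmax h1
    simp only [Set.mem_ofPred_eq, id, Matrix.det_smul, Matrix.det_one, mul_one] at h2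
    exact lt_of_lt_of_le (by positivity) h2
  set u : K → EuclideanSpace ℝ (Fin n) := fun k => matAct T₀ (v k) with hu
  have hGT : ∀ (B : Matrix (Fin n) (Fin n) ℝ) (s : ℝ), G ((1 + s • B) * T₀) =
      ∑ k, ‖u k + s • matAct B (u k)‖ ^ p := by
    intro B s
    simp only [hG, matAct_mul, matAct_one_add_smul, hu]
  have hineq : ∀ (B : Matrix (Fin n) (Fin n) ℝ) (s : ℝ),
      (1 + s • B).det ≤ ((∑ k, ‖u k + s • matAct B (u k)‖ ^ p) / n) ^ (n / p) := by
    intro B s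
    have : Nonempty (Fin n) := ⟨⟨0, hn⟩⟩
    rw [← hGT]
    set T := (1 + s • B) * T₀ with hT
    rcases le_or_gt (1 + s • B).det 0 with h | h
    · exact h.trans (Real.rpow_nonneg (div_nonneg (hG0 _) hnR.le) _)
    · have hTdet : T.det = (1 + s • B).det * T₀.det := Matrix.det_mul _ _
      have hTne : T ≠ 0 := by
        intro h0
        rw [h0, Matrix.det_zero] at hTdet
        exact (mul_pos h hdet).ne hTdet
      have hGp := hGpos T hTne
      set l : ℝ := (G T / n) ^ (1 / p) with hl
      have hl0 : 0 < l := by positivity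
      have hlp : l ^ p = G T / n := by
        rw [hl, ← Real.rpow_mul (by positivity), one_div_mul_cancel hp0.ne', Real.rpow_one]
      have hln : l ^ n = (G T / n) ^ (n / p) := by
        rw [hl, ← Real.rpow_natCast, ← Real.rpow_mul (by positivity)]
        ring_nf
      have hmem : l⁻¹ • T ∈ C := by
        simp only [hC, Set.mem_ofPred_eq]
        rw [hGsmul, abs_of_pos (inv_pos.2 hl0), Real.inv_rpow hl0.le, hlp]
        apply le_of_eq
        field_simp
      have h2 := hmax hmem
      simp only [Set.mem_ofPred_eq, id, Matrix.det_smul, Fintype.card_fin, hTdet] at h2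
      rw [← hln]
      rw [inv_pow, inv_mul_le_iff₀ (by positivity)] at h2
      exact le_of_mul_le_mul_right h2 hdet
  have hGn : (∑ k, ‖u k‖ ^ p) / n = 1 := by
    have h1 := hineq 0 0
    simp only [smul_zero, add_zero, Matrix.det_one, zero_smul] at h1
    have h2 : (∑ k, ‖u k‖ ^ p) / n ≤ 1 := (div_le_one hnR).2 hT₀
    refine le_antisymm h2 ?_
    by_contra hcon
    push Not at hcon
    have := Real.rpow_lt_one (div_nonneg (hG0 T₀) hnR.le) hcon (show 0 < (n : ℝ) / p by positivity)
    exact absurd h1 (not_le.2 this)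
  have hstat : ∀ B : Matrix (Fin n) (Fin n) ℝ,
      ∑ k, ‖u k‖ ^ (p - 2) * inner ℝ (u k) (matAct B (u k)) = B.trace := by
    intro B
    have h1 := hasDerivAt_sum_norm_rpow (show 1 < p by linarith) u (fun k => matAct B (u k))
    have h0 : (∑ k, ‖u k + (0 : ℝ) • matAct B (u k)‖ ^ p) / n = 1 := by simpa using hGn
    have h2 := (h1.div_const (n : ℝ)).rpow_const (p := n / p) (Or.inl (by rw [h0]; exact one_ne_zero))
    have h3 := h2.sub (hasDerivAt_det_one_add_smul B)
    have hmin : IsLocalMin (fun s : ℝ => ((∑ k, ‖u k + s • matAct B (u k)‖ ^ p) / n) ^ ((n : ℝ) / p) -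
        (1 + s • B).det) 0 := by
      refine Filter.Eventually.of_forall fun s => ?_
      have e1 := hineq B s
      simp only [h0, Real.one_rpow]
      simp only [zero_smul, add_zero, Matrix.det_one, sub_self]
      linarith
    have h4 := hmin.hasDerivAt_eq_zero h3
    rw [h0, Real.one_rpow] at h4
    have h5 : p * (∑ k, ‖u k‖ ^ (p - 2) * inner ℝ (u k) (matAct B (u k))) / n * (n / p) * 1 =
        ∑ k, ‖u k‖ ^ (p - 2) * inner ℝ (u k) (matAct B (u k)) := by
      field_simp
    linarith
  have hinj : Function.Injective (Matrix.toEuclideanLin T₀.transpose) := by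
    rw [← LinearMap.ker_eq_bot, LinearMap.ker_eq_bot']
    intro y hy
    have h1 : T₀.transpose.mulVec y.ofLp = 0 := by
      have := congrArg (fun z : EuclideanSpace ℝ (Fin n) => z.ofLp) hy
      simpa [Matrix.toEuclideanLin] using this
    have h2 := Matrix.eq_zero_of_mulVec_eq_zero (by rw [Matrix.det_transpose]; exact hdet.ne') h1
    ext i
    simp [h2]
  let Θ := LinearEquiv.ofInjectiveEndo (Matrix.toEuclideanLin T₀.transpose) hinj
  refine ⟨Θ.symm, u, fun k y => ?_, fun y => ?_⟩
  · rw [hu, inner_matAct]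
    have h1 : matAct T₀.transpose (Θ.symm y) = Θ (Θ.symm y) := rfl
    rw [h1, LinearEquiv.apply_symm_apply]
  · have h1 := hstat (Matrix.vecMulVec y.ofLp y.ofLp)
    simp only [matAct_vecMulVec, real_inner_smul_right, Matrix.trace_vecMulVec] at h1
    have h2 : ‖y‖ ^ 2 = y.ofLp ⬝ᵥ y.ofLp := by
      rw [← real_inner_self_eq_norm_sq, EuclideanSpace.inner_eq_star_dotProduct, star_trivial]
    rw [h2, ← h1]
    exact Finset.sum_congr rfl fun k _ => by ring

end Lewis

section Discretization

theorem toReal_eLpNorm_simpleFunc {Ω F : Type*} [MeasurableSpace Ω] {μ : Measure Ω}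
    [NormedAddCommGroup F] [InnerProductSpace ℝ F]
    (g : SimpleFunc Ω F) {p : ℝ} (hp : 0 < p) (hg : MemLp g (ENNReal.ofReal p) μ) (z : F) :
    (eLpNorm (fun ω => inner ℝ (g ω) z) (ENNReal.ofReal p) μ).toReal =
      (∑ x ∈ g.range, μ.real (g ⁻¹' {x}) * |inner ℝ x z| ^ p) ^ (1 / p) := by
  have hp0 : ENNReal.ofReal p ≠ 0 := by simpa using hp
  have hm : MemLp (fun ω => inner ℝ (g ω) z) (ENNReal.ofReal p) μ := hg.inner_const z
  have hint : Integrable g μ := (SimpleFunc.memLp_iff_integrable hp0 ENNReal.ofReal_ne_top).1 hg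
  rw [hm.eLpNorm_eq_integral_rpow_norm hp0 ENNReal.ofReal_ne_top, ENNReal.toReal_ofReal hp.le,
    ENNReal.toReal_ofReal (by positivity), one_div]
  congr 1
  have h1 := SimpleFunc.map_integral g (fun x => |inner ℝ x z| ^ p) hint
    (by simp [Real.zero_rpow hp.ne'])
  have hint2 : Integrable (g.map fun x => |inner ℝ x z| ^ p) μ := by
    rw [SimpleFunc.integrable_iff_finMeasSupp] at hint ⊢
    exact hint.map (by simp [Real.zero_rpow hp.ne'])
  rw [SimpleFunc.integral_eq_integral _ hint2] at h1
  simpa using h1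

/-- A finite-dimensional subspace of `L_p` is nearly isometric to a subspace of a weighted
finite-dimensional `ℓ_p` space. -/
theorem exists_discretization {Ω : Type*} [MeasurableSpace Ω] (μ : Measure Ω) {p : ℝ} (hp : 1 ≤ p)
    (E : Submodule ℝ (Lp ℝ (ENNReal.ofReal p) μ)) {n : ℕ} (hn : 0 < n)
    (hE : Module.finrank ℝ E = n) {δ : ℝ} (hδ : 0 < δ) :
    ∃ (K : Type) (_ : Fintype K) (v : K → EuclideanSpace ℝ (Fin n))
      (a : E ≃ₗ[ℝ] EuclideanSpace ℝ (Fin n)), ∀ y : E,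
      (1 - δ) * ‖(y : Lp ℝ (ENNReal.ofReal p) μ)‖ ≤ (∑ k, |inner ℝ (v k) (a y)| ^ p) ^ (1 / p) ∧
      (∑ k, |inner ℝ (v k) (a y)| ^ p) ^ (1 / p) ≤
        (1 + δ) * ‖(y : Lp ℝ (ENNReal.ofReal p) μ)‖ := by
  have hp0 : 0 < p := by linarith
  have : Fact (1 ≤ ENNReal.ofReal p) := ⟨by simpa using ENNReal.ofReal_le_ofReal hp⟩
  have : FiniteDimensional ℝ E := Module.finite_of_finrank_pos (by omega)
  let b := Module.finBasisOfFinrankEq ℝ E hE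
  let a : E ≃ₗ[ℝ] EuclideanSpace ℝ (Fin n) :=
    b.equivFun.trans (WithLp.linearEquiv 2 ℝ (Fin n → ℝ)).symm
  let A := LinearMap.toContinuousLinearMap (a : E →ₗ[ℝ] EuclideanSpace ℝ (Fin n))
  have hA : ∀ y : E, ‖a y‖ ≤ ‖A‖ * ‖y‖ := fun y => A.le_opNorm y
  let G : Ω → EuclideanSpace ℝ (Fin n) := fun ω =>
    ∑ i, (b i : Lp ℝ (ENNReal.ofReal p) μ) ω • EuclideanSpace.single i (1 : ℝ)
  have hG : MemLp G (ENNReal.ofReal p) μ := by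
    refine memLp_finsetSum _ fun i _ => ?_
    exact ContinuousLinearMap.comp_memLp'
      ((1 : ℝ →L[ℝ] ℝ).smulRight (EuclideanSpace.single i (1 : ℝ))) (Lp.memLp (b i).1)
  have hη : ENNReal.ofReal (δ / (‖A‖ + 1)) ≠ 0 := by
    simpa using (by positivity : 0 < δ / (‖A‖ + 1))
  obtain ⟨g, hgG, hg⟩ := hG.exists_simpleFunc_eLpNorm_sub_lt ENNReal.ofReal_ne_top hη
  have hy : ∀ y : E, (y : Lp ℝ (ENNReal.ofReal p) μ) =ᵐ[μ] fun ω => inner ℝ (G ω) (a y) := by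
    intro y
    have h1 : (y : Lp ℝ (ENNReal.ofReal p) μ) =
        ∑ i, b.repr y i • (b i : Lp ℝ (ENNReal.ofReal p) μ) := by
      have h := congrArg E.subtype (b.sum_repr y)
      simpa only [map_sum, map_smul, Submodule.subtype_apply] using h.symm
    have h2 : ∀ᵐ ω ∂μ, ∀ i, (b.repr y i • (b i : Lp ℝ (ENNReal.ofReal p) μ) :
        Lp ℝ (ENNReal.ofReal p) μ) ω = b.repr y i * (b i : Lp ℝ (ENNReal.ofReal p) μ) ω := by
      rw [ae_all_iff]
      intro i
      filter_upwards [Lp.coeFn_smul (b.repr y i) (b i : Lp ℝ (ENNReal.ofReal p) μ)] with ω hω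
      simpa using hω
    rw [h1]
    filter_upwards [h2, Lp.coeFn_fun_finsetSum Finset.univ
      fun i => b.repr y i • (b i : Lp ℝ (ENNReal.ofReal p) μ)] with ω hω hω'
    rw [hω']
    simp only [hω, G, sum_inner, real_inner_smul_left]
    refine Finset.sum_congr rfl fun i _ => ?_
    rw [EuclideanSpace.inner_single_left]
    simp [a, mul_comm]
  refine ⟨g.range, inferInstance, fun x => μ.real (g ⁻¹' {x.1}) ^ (1 / p) • x.1, a, fun y => ?_⟩
  have hs : MemLp (fun ω => inner ℝ (g ω) (a y)) (ENNReal.ofReal p) μ := hg.inner_const (a y)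
  have hsum : (∑ k : g.range, |inner ℝ (μ.real (g ⁻¹' {k.1}) ^ (1 / p) • k.1) (a y)| ^ p) ^ (1 / p) =
      ‖hs.toLp‖ := by
    rw [Lp.norm_toLp, toReal_eLpNorm_simpleFunc g hp0 hg]
    congr 1
    rw [← Finset.sum_coe_sort g.range]
    refine Finset.sum_congr rfl fun k _ => ?_
    rw [real_inner_smul_left, abs_mul, Real.mul_rpow (abs_nonneg _) (abs_nonneg _),
      abs_of_nonneg (by positivity), ← Real.rpow_mul (by positivity), one_div,
      inv_mul_cancel₀ hp0.ne', Real.rpow_one]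
  have hdist : ‖hs.toLp - (y : Lp ℝ (ENNReal.ofReal p) μ)‖ ≤
      δ * ‖(y : Lp ℝ (ENNReal.ofReal p) μ)‖ := by
    have h1 : ∀ᵐ ω ∂μ, ‖(hs.toLp - (y : Lp ℝ (ENNReal.ofReal p) μ) :
        Lp ℝ (ENNReal.ofReal p) μ) ω‖ ≤ ‖a y‖ * ‖(G - g) ω‖ := by
      filter_upwards [Lp.coeFn_sub hs.toLp (y : Lp ℝ (ENNReal.ofReal p) μ), hs.coeFn_toLp, hy y]
        with ω h1 h2 h3
      rw [h1, Pi.sub_apply, h2, h3, ← inner_sub_left, Pi.sub_apply, mul_comm, norm_sub_rev (G ω)]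
      exact norm_inner_le_norm _ _
    have h2 := eLpNorm_le_mul_eLpNorm_of_ae_le_mul h1 (ENNReal.ofReal p)
    rw [Lp.norm_def]
    have h3 : eLpNorm (hs.toLp - (y : Lp ℝ (ENNReal.ofReal p) μ) : Lp ℝ (ENNReal.ofReal p) μ)
        (ENNReal.ofReal p) μ ≤ ENNReal.ofReal (‖a y‖ * (δ / (‖A‖ + 1))) := by
      rw [ENNReal.ofReal_mul (norm_nonneg _)]
      exact h2.trans (mul_le_mul_right hgG.le _)
    refine (ENNReal.toReal_le_of_le_ofReal (by positivity) h3).trans ?_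
    have h4 : ‖A‖ / (‖A‖ + 1) ≤ 1 := (div_le_one (by positivity)).2 (by linarith)
    have h5 : ‖(y : Lp ℝ (ENNReal.ofReal p) μ)‖ = ‖y‖ := rfl
    calc ‖a y‖ * (δ / (‖A‖ + 1)) ≤ (‖A‖ * ‖y‖) * (δ / (‖A‖ + 1)) := by gcongr; exact hA y
      _ = (‖A‖ / (‖A‖ + 1)) * (δ * ‖y‖) := by ring
      _ ≤ 1 * (δ * ‖y‖) := by gcongr
      _ = _ := by rw [one_mul, h5]
  rw [hsum]
  have := abs_le.1 ((abs_norm_sub_norm_le _ _).trans hdist)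
  constructor <;> linarith [this.1, this.2]

end Discretization

section SampleSize

theorem log_ratio_eq {n p ε : ℝ} (hn : 0 < n) (hε : 0 < ε) (hp : 0 < p) :
    Real.exp (p / 2 * Real.log (n / ε ^ (4 / p))) = n ^ (p / 2) / ε ^ 2 := by
  have h0 : 0 < n / ε ^ (4 / p) := by positivity
  rw [mul_comm, ← Real.rpow_def_of_pos h0, Real.div_rpow hn.le (by positivity),
    ← Real.rpow_mul hε.le, show 4 / p * (p / 2) = (2 : ℕ) by field_simp; norm_num,
    Real.rpow_natCast]

theorem half_le_log_ratio {n p ε : ℝ} (hn : 2 ≤ n) (hε : 0 < ε) (hε1 : ε < 1) (hp : 0 < p) :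
    1 / 2 ≤ Real.log (n / ε ^ (4 / p)) := by
  have h1 : ε ^ (4 / p) ≤ 1 := Real.rpow_le_one hε.le hε1.le (by positivity)
  have h2 : 0 < ε ^ (4 / p) := by positivity
  have h3 : 2 ≤ n / ε ^ (4 / p) := by
    rw [le_div_iff₀ h2]; nlinarith
  have := Real.log_le_log (by norm_num) h3
  linarith [Real.log_two_gt_d9]

/-- Growth condition on the constant that governs the deviation of the sample moments. -/
theorem constant_growth {p : ℝ} (hp : 2 ≤ p) :
    48 * 500000 ^ p * 120 * p ≤ ((10 : ℝ) ^ 10) ^ p := by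
  have h1 : ((10 : ℝ) ^ 10) = 500000 * 2 * 10000 := by norm_num
  rw [h1, Real.mul_rpow (by norm_num) (by norm_num), Real.mul_rpow (by norm_num) (by norm_num)]
  have h2 : p ≤ 2 ^ p := by
    have h := one_add_mul_self_le_rpow_one_add (s := (1 : ℝ)) (p := p) (by norm_num) (by linarith)
    norm_num at h; linarith
  have h3 : (10000 : ℝ) ^ (2 : ℝ) ≤ 10000 ^ p := Real.rpow_le_rpow_of_exponent_le (by norm_num) hp
  have h4 : (48 * 120 : ℝ) ≤ 10000 ^ p := le_trans (by norm_num) h3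
  calc 48 * (500000 : ℝ) ^ p * 120 * p = 500000 ^ p * p * (48 * 120) := by ring
    _ ≤ 500000 ^ p * 2 ^ p * 10000 ^ p := by gcongr

/-- A sample size within the required bounds for which the deviation of the empirical moments of
order `p` and of order `2` is at most a small multiple of `ε`. -/
theorem exists_sampleSize {n : ℕ} (hn : 2 ≤ n) {p ε : ℝ} (hp : 2 ≤ p) (hε : 0 < ε) (hε1 : ε < 1) :
    ∃ (m : ℕ) (L : ℝ), 0 < m ∧ 1 ≤ L ∧ (m : ℝ) ≤ Real.exp L ∧
      (m : ℝ) ≤ sampleBound (10 ^ 21) p n ε (2 / Real.conjExponent p) ∧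
      (m : ℝ) ≤ sampleBound (10 ^ 21) p n ε 2 ∧
      2 * 500000 ^ p * Real.sqrt ((n : ℝ) ^ (p / 2) / m) * L ^ (1 - 1 / p) ≤ ε / 16 ∧
      2 * 500000 ^ (2 : ℝ) * Real.sqrt ((n : ℝ) ^ ((2 : ℝ) / 2) / m) * L ^ (1 - 1 / (2 : ℝ)) ≤
        ε / 16 := by
  have hp0 : 0 < p := by linarith
  have hnR : (2 : ℝ) ≤ n := by exact_mod_cast hn
  have hexp := log_ratio_eq (n := n) (by linarith) hε hp0
  have hl := half_le_log_ratio hnR hε hε1 hp0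
  have hs : 2 / Real.conjExponent p = 2 * (1 - 1 / p) := by
    rw [Real.conjExponent]; field_simp
  simp only [sampleBound, hs]
  generalize Real.log ((n : ℝ) / ε ^ (4 / p)) = l at hexp hl
  have hl0 : 0 < l := by linarith
  have hr1 : 1 / 2 ≤ 1 - 1 / p := by
    have : 1 / p ≤ 1 / 2 := one_div_le_one_div_of_le (by norm_num) hp
    linarith
  have hr2 : 1 - 1 / p ≤ 1 := by
    have : 0 < 1 / p := by positivity
    linarith
  generalize hr : 1 - 1 / p = r at hr1 hr2
  have hN : 0 < (n : ℝ) ^ (p / 2) := by positivity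
  have hl2 : l ^ (2 * r) ≤ 4 * l ^ 2 := by
    have h1 : l ^ (2 * r) ≤ (2 * l) ^ (2 * r) := by gcongr; linarith
    have h2 : (2 * l) ^ (2 * r) ≤ (2 * l) ^ (2 : ℝ) :=
      Real.rpow_le_rpow_of_exponent_le (by linarith) (by linarith)
    rw [Real.rpow_two] at h2
    nlinarith
  have hl1 : 1 ≤ 4 * l ^ (2 * r) := by
    have h2 : (2 * l) ^ (0 : ℝ) ≤ (2 * l) ^ (2 * r) :=
      Real.rpow_le_rpow_of_exponent_le (by linarith) (by linarith)
    have h3 : (2 : ℝ) ^ (2 * r) ≤ 2 ^ (2 : ℝ) :=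
      Real.rpow_le_rpow_of_exponent_le (by norm_num) (by linarith)
    have h4 : 0 < l ^ (2 * r) := by positivity
    rw [Real.rpow_zero, Real.mul_rpow (by norm_num) hl0.le] at h2
    norm_num at h3
    nlinarith
  set T : ℝ := ((10 : ℝ) ^ 20) ^ p / ε ^ 2 * (n : ℝ) ^ (p / 2) * l ^ (2 * r) with hT
  have hTexp : T = ((10 : ℝ) ^ 20) ^ p * Real.exp (p / 2 * l) * l ^ (2 * r) := by
    rw [hT, hexp]; ring
  have hC1 : (4 : ℝ) ≤ ((10 : ℝ) ^ 20) ^ p := by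
    have := Real.rpow_le_rpow_of_exponent_le (show (1 : ℝ) ≤ 10 ^ 20 by norm_num) hp
    exact le_trans (by norm_num) this
  have hT1 : 1 ≤ T := by
    have h1 : 1 ≤ Real.exp (p / 2 * l) := Real.one_le_exp (by positivity)
    have h2 : (4 : ℝ) * 1 ≤ ((10 : ℝ) ^ 20) ^ p * Real.exp (p / 2 * l) :=
      mul_le_mul hC1 h1 (by norm_num) (by positivity)
    have h3 : 0 < l ^ (2 * r) := by positivity
    rw [hTexp]
    nlinarith
  have hm1 : 1 ≤ ⌊T⌋₊ := Nat.le_floor (by exact_mod_cast hT1)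
  have hmT : (⌊T⌋₊ : ℝ) ≤ T := Nat.floor_le (by linarith)
  have hTm : T / 2 ≤ ⌊T⌋₊ := by
    have h1 := Nat.lt_floor_add_one T
    have h2 : (1 : ℝ) ≤ ⌊T⌋₊ := by exact_mod_cast hm1
    linarith
  have hm0 : (0 : ℝ) < ⌊T⌋₊ := by exact_mod_cast hm1
  have hC2 : 4 * ((10 : ℝ) ^ 20) ^ p ≤ ((10 : ℝ) ^ 21) ^ p := by
    rw [show (10 : ℝ) ^ 21 = 10 * 10 ^ 20 by norm_num, Real.mul_rpow (by norm_num) (by norm_num)]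
    have := Real.rpow_le_rpow_of_exponent_le (show (1 : ℝ) ≤ 10 by norm_num) hp
    have h4 : (4 : ℝ) ≤ 10 ^ p := le_trans (by norm_num) this
    gcongr
  have hL1 : 1 ≤ 120 * p * l := by nlinarith
  have hb : 0 ≤ (n : ℝ) ^ (p / 2) / ε ^ 2 := by positivity
  have hmain : 2 * 500000 ^ p * Real.sqrt ((n : ℝ) ^ (p / 2) / ⌊T⌋₊) * (120 * p * l) ^ r ≤
      ε / 16 := by
    have h1 : Real.sqrt ((n : ℝ) ^ (p / 2) / ⌊T⌋₊) ≤ 3 / 2 * ε / (((10 : ℝ) ^ 10) ^ p * l ^ r) := by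
      apply Real.sqrt_le_iff.2 ⟨by positivity, ?_⟩
      have e1 : (((10 : ℝ) ^ 10) ^ p) ^ 2 = ((10 : ℝ) ^ 20) ^ p := by
        rw [← Real.rpow_natCast, ← Real.rpow_mul (by norm_num), mul_comm, Real.rpow_mul (by norm_num)]
        norm_num
      have e2 : (l ^ r) ^ 2 = l ^ (2 * r) := by
        rw [← Real.rpow_natCast, ← Real.rpow_mul hl0.le, mul_comm]; norm_num
      rw [div_pow, mul_pow, mul_pow, e1, e2]
      calc (n : ℝ) ^ (p / 2) / ⌊T⌋₊ ≤ (n : ℝ) ^ (p / 2) / (T / 2) := by gcongr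
        _ = 2 * ε ^ 2 / (((10 : ℝ) ^ 20) ^ p * l ^ (2 * r)) := by
            rw [hT]; field_simp
        _ ≤ _ := by gcongr; norm_num
    have h2 : (120 * p * l) ^ r ≤ 120 * p * l ^ r := by
      rw [Real.mul_rpow (by positivity) hl0.le]
      have : (120 * p) ^ r ≤ (120 * p) ^ (1 : ℝ) :=
        Real.rpow_le_rpow_of_exponent_le (by linarith) hr2
      rw [Real.rpow_one] at this
      gcongr
    have h3 := constant_growth hp
    have h4 : 0 < ((10 : ℝ) ^ 10) ^ p := by positivity
    calc 2 * 500000 ^ p * Real.sqrt ((n : ℝ) ^ (p / 2) / ⌊T⌋₊) * (120 * p * l) ^ r ≤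
        2 * 500000 ^ p * (3 / 2 * ε / (((10 : ℝ) ^ 10) ^ p * l ^ r)) * (120 * p * l ^ r) := by
          gcongr
      _ = ε / 16 * (48 * 500000 ^ p * 120 * p / ((10 : ℝ) ^ 10) ^ p) := by
          field_simp; ring
      _ ≤ ε / 16 * 1 := by
          gcongr
          exact (div_le_one h4).2 h3
      _ = ε / 16 := mul_one _
  refine ⟨⌊T⌋₊, 120 * p * l, hm1, hL1, ?_, ?_, ?_, hmain, le_trans ?_ hmain⟩
  · refine hmT.trans ?_
    have h1 : ((10 : ℝ) ^ 20) ^ p ≤ Real.exp (56 * p) := by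
      rw [mul_comm, mul_comm p, Real.exp_mul]
      gcongr
      have h2 : Real.exp (7 / 10) ^ 80 = Real.exp 56 := by rw [← Real.exp_nat_mul]; norm_num
      have h3 : 2 ≤ Real.exp (7 / 10) := by
        rw [← Real.exp_log (show (0 : ℝ) < 2 by norm_num)]
        exact Real.exp_le_exp.2 (by linarith [Real.log_two_lt_d9])
      rw [← h2]
      exact le_trans (by norm_num) (pow_le_pow_left₀ (by norm_num) h3 80)
    have h2 : l ^ (2 * r) ≤ Real.exp (2 * l) := by
      calc l ^ (2 * r) ≤ Real.exp l ^ (2 * r) := by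
            gcongr; linarith [Real.add_one_le_exp l]
        _ = Real.exp (l * (2 * r)) := by rw [Real.exp_mul]
        _ ≤ _ := Real.exp_le_exp.2 (by nlinarith)
    rw [hTexp]
    calc ((10 : ℝ) ^ 20) ^ p * Real.exp (p / 2 * l) * l ^ (2 * r) ≤
        Real.exp (56 * p) * Real.exp (p / 2 * l) * Real.exp (2 * l) := by gcongr
      _ = Real.exp (56 * p + p / 2 * l + 2 * l) := by rw [Real.exp_add, Real.exp_add]
      _ ≤ _ := Real.exp_le_exp.2 (by nlinarith)
  · refine hmT.trans ?_
    rw [hT]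
    gcongr <;> norm_num
  · refine hmT.trans ?_
    rw [Real.rpow_two]
    calc T = ((10 : ℝ) ^ 20) ^ p * ((n : ℝ) ^ (p / 2) / ε ^ 2) * l ^ (2 * r) := by rw [hT]; ring
      _ ≤ ((10 : ℝ) ^ 20) ^ p * ((n : ℝ) ^ (p / 2) / ε ^ 2) * (4 * l ^ 2) := by gcongr
      _ = (4 * ((10 : ℝ) ^ 20) ^ p) * ((n : ℝ) ^ (p / 2) / ε ^ 2) * l ^ 2 := by ring
      _ ≤ ((10 : ℝ) ^ 21) ^ p * ((n : ℝ) ^ (p / 2) / ε ^ 2) * l ^ 2 := by gcongr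
      _ = _ := by ring
  · have h1 : (n : ℝ) ^ ((2 : ℝ) / 2) ≤ (n : ℝ) ^ (p / 2) :=
      Real.rpow_le_rpow_of_exponent_le (by linarith) (by linarith)
    have h2 : (500000 : ℝ) ^ (2 : ℝ) ≤ 500000 ^ p :=
      Real.rpow_le_rpow_of_exponent_le (by norm_num) hp
    have h3 : (120 * p * l) ^ (1 - 1 / (2 : ℝ)) ≤ (120 * p * l) ^ r :=
      Real.rpow_le_rpow_of_exponent_le hL1 (by linarith)
    gcongr

end SampleSize

section Sampling

theorem exists_sample_of_lewis {K : Type*} [Fintype K] {n m : ℕ} (hn : 0 < n) (hm : 0 < m)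
    {p L η : ℝ} (hp : 2 ≤ p) (hη : η ≤ 1 / 2) (hL : 1 ≤ L) (hmL : (m : ℝ) ≤ Real.exp L)
    (u : K → EuclideanSpace ℝ (Fin n))
    (hu : ∀ y, ∑ k, ‖u k‖ ^ (p - 2) * inner ℝ (u k) y ^ 2 = ‖y‖ ^ 2)
    (hκp : 2 * 500000 ^ p * Real.sqrt ((n : ℝ) ^ (p / 2) / m) * L ^ (1 - 1 / p) ≤ η)
    (hκ2 : 2 * 500000 ^ (2 : ℝ) * Real.sqrt ((n : ℝ) ^ ((2 : ℝ) / 2) / m) *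
      L ^ (1 - 1 / (2 : ℝ)) ≤ η) :
    ∃ x : Fin m → EuclideanSpace ℝ (Fin n), (∀ j, ‖x j‖ = 1) ∧ ∀ y,
      |(n : ℝ) / m * ∑ j, |inner ℝ (x j) y| ^ p - ∑ k, |inner ℝ (u k) y| ^ p| ≤
        4 * η * ∑ k, |inner ℝ (u k) y| ^ p ∧
      |(n : ℝ) / m * ∑ j, |inner ℝ (x j) y| ^ (2 : ℝ) - ‖y‖ ^ (2 : ℝ)| ≤
        4 * η * ‖y‖ ^ (2 : ℝ) := by
  classical
  have hp0 : p ≠ 0 := by linarith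
  have hnR : (0 : ℝ) < n := by exact_mod_cast hn
  let e : EuclideanSpace ℝ (Fin n) := EuclideanSpace.single ⟨0, hn⟩ 1
  let X : K → EuclideanSpace ℝ (Fin n) := fun k => if u k = 0 then e else ‖u k‖⁻¹ • u k
  let w : K → ℝ := fun k => ‖u k‖ ^ p / n
  have hX : ∀ k, ‖X k‖ = 1 := by
    intro k
    by_cases h : u k = 0
    · simp [X, h, e]
    · simp only [X, if_neg h]
      rw [norm_smul, norm_inv, norm_norm, inv_mul_cancel₀ (norm_ne_zero_iff.2 h)]
  have hw : ∀ k, 0 ≤ w k := fun k => by positivity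
  have hpow : ∀ k, ‖u k‖ ^ (p - 2) * ‖u k‖ ^ 2 = ‖u k‖ ^ p := by
    intro k
    by_cases h : u k = 0
    · simp [h, Real.zero_rpow hp0]
    · rw [← Real.rpow_two, ← Real.rpow_add (norm_pos_iff.2 h), sub_add_cancel]
  have hw1 : ∑ k, w k = 1 := by
    let b := EuclideanSpace.basisFun (Fin n) ℝ
    have h1 : ∑ i, ∑ k, ‖u k‖ ^ (p - 2) * inner ℝ (u k) (b i) ^ 2 = n := by
      simp [hu, b.norm_eq_one]
    rw [Finset.sum_comm] at h1
    rw [← Finset.sum_div, div_eq_one_iff_eq hnR.ne', ← h1]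
    refine Finset.sum_congr rfl fun k _ => ?_
    rw [← Finset.mul_sum, ← hpow k]
    congr 1
    have := b.sum_sq_norm_inner_left (u k)
    rw [← this]
    exact Finset.sum_congr rfl fun i _ => by rw [Real.norm_eq_abs, sq_abs]
  have hmom : ∀ q : ℝ, 0 < q → ∀ k y, ‖u k‖ ^ q * |inner ℝ (X k) y| ^ q = |inner ℝ (u k) y| ^ q := by
    intro q hq k y
    by_cases h : u k = 0
    · simp [h, Real.zero_rpow hq.ne']
    · simp only [X, if_neg h]
      rw [← Real.mul_rpow (norm_nonneg _) (abs_nonneg _), real_inner_smul_left, abs_mul, abs_inv,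
        abs_norm, mul_inv_cancel_left₀ (norm_ne_zero_iff.2 h)]
  have hiso : ∀ y, (n : ℝ) * ∑ k, w k * inner ℝ (X k) y ^ 2 = ‖y‖ ^ 2 := by
    intro y
    rw [← hu y, Finset.mul_sum]
    refine Finset.sum_congr rfl fun k _ => ?_
    have h := hmom 2 (by norm_num) k y
    rw [Real.rpow_two, Real.rpow_two, Real.rpow_two, sq_abs, sq_abs] at h
    rw [← h, ← mul_assoc, ← mul_assoc, hpow, mul_div_cancel₀ _ hnR.ne']
  have hMp : ∀ y, momentFun n p w X y = ∑ k, |inner ℝ (u k) y| ^ p := by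
    intro y
    rw [momentFun, Finset.mul_sum]
    refine Finset.sum_congr rfl fun k _ => ?_
    rw [← hmom p (by linarith), ← mul_assoc, mul_div_cancel₀ _ hnR.ne']
  have hM2 : ∀ y, momentFun n 2 w X y = ‖y‖ ^ (2 : ℝ) := by
    intro y
    rw [Real.rpow_two, ← hiso y, momentFun]
    simp only [Real.rpow_two, sq_abs]
  obtain ⟨D, hD, hD0, hDy⟩ := exists_sampling_deviation_le hnR hm hp hL hmL hw hw1 X hX hiso hη hκp
  obtain ⟨D', hD', hD0', hDy'⟩ :=
    exists_sampling_deviation_le hnR hm le_rfl hL hmL hw hw1 X hX hiso hη hκ2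
  obtain ⟨κ, hκ⟩ := exists_le_of_sampleAvg_le (F := fun κ => D κ + D' κ) (c := 4 * η) hw hw1
    (by rw [sampleAvg_add]; linarith)
  refine ⟨fun j => X (κ j), fun j => hX _, fun y => ⟨?_, ?_⟩⟩
  · have h1 := hDy κ y
    rw [hMp] at h1
    refine h1.trans (mul_le_mul_of_nonneg_right (by linarith [hD0' κ]) ?_)
    exact Finset.sum_nonneg fun k _ => by positivity
  · have h1 := hDy' κ y
    rw [hM2] at h1
    exact h1.trans (mul_le_mul_of_nonneg_right (by linarith [hD0 κ]) (by positivity))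

theorem rpow_one_div_bounds {S T η r : ℝ} (hT : 0 ≤ T) (hη0 : 0 ≤ η) (hη : η ≤ 1) (hr : 1 ≤ r)
    (h : |S - T| ≤ η * T) :
    (1 - η) * T ^ (1 / r) ≤ S ^ (1 / r) ∧ S ^ (1 / r) ≤ (1 + η) * T ^ (1 / r) := by
  have hr0 : 0 ≤ 1 / r := by positivity
  have hr1 : 1 / r ≤ 1 := by rw [div_le_one (by linarith)]; exact hr
  obtain ⟨h1, h2⟩ := abs_le.1 h
  have h3 : (1 - η) * T ≤ S := by linarith
  have h4 : S ≤ (1 + η) * T := by linarith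
  have h5 : 0 ≤ (1 - η) * T := mul_nonneg (by linarith) hT
  constructor
  · calc (1 - η) * T ^ (1 / r) ≤ (1 - η) ^ (1 / r) * T ^ (1 / r) := by
          gcongr
          exact Real.self_le_rpow_of_le_one (by linarith) (by linarith) hr1
      _ = ((1 - η) * T) ^ (1 / r) := (Real.mul_rpow (by linarith) hT).symm
      _ ≤ _ := Real.rpow_le_rpow h5 h3 hr0
  · calc S ^ (1 / r) ≤ ((1 + η) * T) ^ (1 / r) := Real.rpow_le_rpow (h5.trans h3) h4 hr0
      _ = (1 + η) ^ (1 / r) * T ^ (1 / r) := Real.mul_rpow (by linarith) hT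
      _ ≤ _ := by
          gcongr
          exact Real.rpow_le_self_of_one_le (by linarith) hr1

end Sampling

section EuclideanStructure

/-- The scalar product obtained by pulling back along a linear isomorphism. -/
@[reducible]
noncomputable def pullbackCore {E V : Type*} [AddCommGroup E] [Module ℝ E] [NormedAddCommGroup V]
    [InnerProductSpace ℝ V] (Φ : E ≃ₗ[ℝ] V) : InnerProductSpace.Core ℝ E where
  inner x y := inner ℝ (Φ x) (Φ y)
  conj_inner_symm x y := inner_conj_symm (Φ x) (Φ y)
  re_inner_nonneg x := real_inner_self_nonneg
  add_left x y z := by simp [inner_add_left]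
  smul_left x y r := by simp [real_inner_smul_left]
  definite x h := by simpa using h

variable {E V : Type*} [AddCommGroup E] [Module ℝ E] [NormedAddCommGroup V] [InnerProductSpace ℝ V]

theorem euclideanNorm_pullbackCore (Φ : E ≃ₗ[ℝ] V) (y : E) :
    euclideanNorm (pullbackCore Φ) y = ‖Φ y‖ :=
  (norm_eq_sqrt_real_inner (Φ y)).symm

theorem empiricalMoment_pullbackCore (Φ : E ≃ₗ[ℝ] V) (n : ℕ) {m : ℕ} (x : Fin m → V) (r : ℝ)
    (y : E) :
    empiricalMoment (pullbackCore Φ) n (fun j => Φ.symm (x j)) r y =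
      ((n : ℝ) / m * ∑ j, |inner ℝ (x j) (Φ y)| ^ r) ^ (1 / r) := by
  have h : ∀ j, (pullbackCore Φ).inner y (Φ.symm (x j)) = inner ℝ (x j) (Φ y) := by
    intro j
    change inner ℝ (Φ y) (Φ (Φ.symm (x j))) = _
    rw [LinearEquiv.apply_symm_apply, real_inner_comm]
  simp only [empiricalMoment, h]

theorem exists_linearEquiv_norm_eq {E : Type*} [NormedAddCommGroup E] [NormedSpace ℝ E]
    (hE : Module.finrank ℝ E = 1) : ∃ Φ : E ≃ₗ[ℝ] ℝ, ∀ y, |Φ y| = ‖y‖ := by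
  obtain ⟨v, hv, hspan⟩ := finrank_eq_one_iff'.1 hE
  let Φ : ℝ ≃ₗ[ℝ] E := LinearEquiv.ofBijective (LinearMap.toSpanSingleton ℝ E (‖v‖⁻¹ • v))
    ⟨fun s t h => by simpa [hv, sub_eq_zero, ← sub_smul] using sub_eq_zero.2 h, fun y => by
      obtain ⟨c, rfl⟩ := hspan y
      refine ⟨c * ‖v‖, ?_⟩
      rw [LinearMap.toSpanSingleton_apply, smul_smul,
        mul_inv_cancel_right₀ (norm_ne_zero_iff.2 hv)]⟩
  refine ⟨Φ.symm, fun y => ?_⟩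
  obtain ⟨t, rfl⟩ := Φ.surjective y
  have h : Φ t = t • ‖v‖⁻¹ • v := rfl
  rw [LinearEquiv.symm_apply_apply, h, norm_smul, norm_smul, norm_inv, norm_norm,
    inv_mul_cancel₀ (norm_ne_zero_iff.2 hv), mul_one, Real.norm_eq_abs]

end EuclideanStructure

theorem mainTheorem5 :
    ∃ C : ℝ, 0 < C ∧
      ∀ (p : ℝ), 2 ≤ p →
      ∀ (Ω : Type*) [MeasurableSpace Ω] (μ : Measure Ω)
        (E : Submodule ℝ (Lp ℝ (ENNReal.ofReal p) μ)) (n : ℕ),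
        1 ≤ n → Module.finrank ℝ E = n →
      ∀ (ε : ℝ), 0 < ε → ε < 1 →
      ∃ (H : InnerProductSpace.Core ℝ E) (m : ℕ) (x : Fin m → E),
        1 ≤ m ∧
        (m : ℝ) ≤ max 1 (sampleBound C p n ε (2 / Real.conjExponent p)) ∧
        (m : ℝ) ≤ max 1 (sampleBound C p n ε 2) ∧
        (∀ j, euclideanNorm H (x j) = 1) ∧
        ∀ y : E,
          ((1 - ε) * ‖(y : Lp ℝ (ENNReal.ofReal p) μ)‖ ≤ empiricalMoment H n x p y ∧
            empiricalMoment H n x p y ≤ (1 + ε) * ‖(y : Lp ℝ (ENNReal.ofReal p) μ)‖) ∧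
          ((1 - ε) * euclideanNorm H y ≤ empiricalMoment H n x 2 y ∧
            empiricalMoment H n x 2 y ≤ (1 + ε) * euclideanNorm H y) := by
  refine ⟨10 ^ 21, by norm_num, fun p hp Ω _ μ E n hn hE ε hε hε1 => ?_⟩
  have hp0 : 0 < p := by linarith
  have : Fact (1 ≤ ENNReal.ofReal p) :=
    ⟨by simpa using ENNReal.ofReal_le_ofReal (show 1 ≤ p by linarith)⟩
  rcases hn.eq_or_lt with rfl | hn2
  · obtain ⟨Φ, hΦ⟩ := exists_linearEquiv_norm_eq hE
    refine ⟨pullbackCore Φ, 1, fun j => Φ.symm ((fun _ => 1 : Fin 1 → ℝ) j), le_rfl, by simp,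
      by simp, fun j => by simp [euclideanNorm_pullbackCore], fun y => ?_⟩
    have h1 : ∀ r : ℝ, 0 < r → empiricalMoment (pullbackCore Φ) 1
        (fun j => Φ.symm ((fun _ => 1 : Fin 1 → ℝ) j)) r y = ‖y‖ := by
      intro r hr
      rw [empiricalMoment_pullbackCore, ← hΦ y]
      simp [← Real.rpow_mul (abs_nonneg (Φ y)), hr.ne']
    have h2 : ‖(y : Lp ℝ (ENNReal.ofReal p) μ)‖ = ‖y‖ := rfl
    rw [h1 p hp0, h1 2 two_pos, euclideanNorm_pullbackCore, Real.norm_eq_abs, hΦ, h2]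
    have h3 := norm_nonneg y
    refine ⟨⟨?_, ?_⟩, ?_, ?_⟩ <;> nlinarith
  · obtain ⟨K, _, v, a, ha⟩ := exists_discretization μ (by linarith) E (by omega) hE
      (show 0 < ε / 8 by linarith)
    have hspan : ∀ y, (∀ k, inner ℝ (v k) y = 0) → y = 0 := by
      intro y hy
      have h1 := (ha (a.symm y)).1
      have h2 : ‖a.symm y‖ ≤ 0 := by
        rw [LinearEquiv.apply_symm_apply] at h1
        simp only [hy, abs_zero, Real.zero_rpow hp0.ne', Finset.sum_const_zero,
          Real.zero_rpow (show 1 / p ≠ 0 by positivity)] at h1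
        exact nonpos_of_mul_nonpos_right h1 (by linarith)
      simpa using norm_le_zero_iff.1 h2
    obtain ⟨Ψ, u, hvu, hu⟩ := exists_lewis_position (by omega) v hp hspan
    obtain ⟨m, L, hm, hL, hmL, hb1, hb2, hκp, hκ2⟩ := exists_sampleSize hn2 hp hε hε1
    obtain ⟨x, hx, hxy⟩ := exists_sample_of_lewis (by omega) hm hp (by linarith) hL hmL u hu hκp hκ2
    refine ⟨pullbackCore (a.trans Ψ), m, fun j => (a.trans Ψ).symm (x j), hm, le_max_of_le_right hb1,
      le_max_of_le_right hb2, fun j => ?_, fun y => ?_⟩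
    · rw [euclideanNorm_pullbackCore, LinearEquiv.apply_symm_apply, hx]
    · rw [empiricalMoment_pullbackCore, empiricalMoment_pullbackCore, euclideanNorm_pullbackCore]
      obtain ⟨hy1, hy2⟩ := hxy ((a.trans Ψ) y)
      obtain ⟨h1, h2⟩ := rpow_one_div_bounds (r := p) (Finset.sum_nonneg fun k _ => by positivity)
        (by linarith) (by linarith) (by linarith) hy1
      obtain ⟨h3, h4⟩ := rpow_one_div_bounds (r := 2) (by positivity) (by linarith) (by linarith)
        one_le_two hy2
      rw [← Real.rpow_mul (norm_nonneg _), mul_one_div_cancel two_ne_zero, Real.rpow_one] at h3 h4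
      have h5 := ha y
      simp only [hvu] at h5
      obtain ⟨h5, h6⟩ := h5
      change (1 - ε / 8) * ‖(y : Lp ℝ (ENNReal.ofReal p) μ)‖ ≤
        (∑ k, |inner ℝ (u k) ((a.trans Ψ) y)| ^ p) ^ (1 / p) at h5
      change (∑ k, |inner ℝ (u k) ((a.trans Ψ) y)| ^ p) ^ (1 / p) ≤
        (1 + ε / 8) * ‖(y : Lp ℝ (ENNReal.ofReal p) μ)‖ at h6
      have h7 := norm_nonneg (y : Lp ℝ (ENNReal.ofReal p) μ)
      have h8 := norm_nonneg ((a.trans Ψ) y)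
      generalize (∑ k, |inner ℝ (u k) ((a.trans Ψ) y)| ^ p) ^ (1 / p) = B at h1 h2 h5 h6
      refine ⟨⟨le_trans ?_ h1, h2.trans ?_⟩, le_trans ?_ h3, h4.trans ?_⟩
      · refine le_trans ?_ (mul_le_mul_of_nonneg_left h5 (by linarith))
        rw [← mul_assoc]
        exact mul_le_mul_of_nonneg_right (by nlinarith) h7
      · refine (mul_le_mul_of_nonneg_left h6 (by linarith)).trans ?_
        rw [← mul_assoc]
        exact mul_le_mul_of_nonneg_right (by nlinarith) h7
      · exact mul_le_mul_of_nonneg_right (by linarith) h8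
      · exact mul_le_mul_of_nonneg_right (by linarith) h8
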